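/- Let $m\ge 1$ and let $J_-=\{a,a+m,\dots,a+m(p-1)\}$, $J_+=\{b,b+m,\dots,b+m(q-1)\}$ be disjoint finite non-empty arithmetic progressions of integers with $p+q=d+2$, $d\ge 2$. For a difference operator $\mathcal D=\sum_{j\in J_-\cup J_+}a^{(j)}T^j$ (with $T$ the shift of sequences and $a^{(j)}$ scalar sequences) write $\mathcal D=\mathcal D_-+\mathcal D_+$ for its parts supported in $J_\mp$; the operator corresponds to a polygon $(v_i)_{i\in\mathbb Z}$ in a real projective space if it annihilates a lift of $(v_i)$. The refactorization pentagram map of $(J_-,J_+)$ is $\tilde v_i=\mathrm{span}\{v_{i+j}: j\in J_-\}\cap\mathrm{span}\{v_{i+j}: j\in J_+\}$ on $J$-corrugated polygons, $J=J_-\sqcup J_+$ (for every $i$ the points $v_{i+j}$, $j\in J$, lie in a projective plane of dimension $|J|-2$); on operators it is the correspondence $\tilde{\mathcal D}_+\mathcal D_-=\tilde{\mathcal D}_-\mathcal D_+$. For tuples $I=(i_1,\dots,i_{d-1})$, $R=(r_1,\dots,r_{d-1})$ of positive integers, $T_{I,R}$ sends a polygon $(v_k)$ in $\mathbb{RP}^d$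 to $\hat v_k=P_k\cap P_{k+r_1}\cap\dots\cap P_{k+r_1+\dots+r_{d-1}}$, where $P_k=\mathrm{span}\langle v_k,v_{k+i_1},\dots,v_{k+i_1+\dots+i_{d-1}}\rangle$. It is long-diagonal if $I=(m,\dots,m)$ and $R$ is the sequence of consecutive differences of the union of two disjoint arithmetic $m$-progressions (one of them possibly empty) with $d$ elements in total. The tuple $I^*$ is $I$ read backwards. Let $R_\pm=\{\max J_\pm-m(d-1),\ \max J_\pm-m(d-2),\dots,\min J_\pm\}$, let $R$ be the sequence of consecutive differences of $R_-\cup R_+$, and let $I=(m,\dots,m)$. Continuous limits. Let $L=\partial^{d+1}+u_{d-1}\partial^{d-1}+\dots+u_0$ have smooth real $2\pi$-periodic coefficients, and let $G:\mathbb R\to\mathbb R^{d+1}$ be a smooth quasi-periodic curve ($G(x+2\pi)=MG(x)$, $M\in SL_{d+1}(\mathbb R)$) with $LG=0$ and $\det(G,G',\dots,G^{(d)})=1$. For a tuple $\bar I$ let $k_0<\dots<k_{d-1}$ be its partial sums $0,\bar i_1,\bar i_1+\bar i_2,\dots$ translated so that $\sum_l k_l=0$. For small $\varepsilon>0$ let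 $L_\varepsilon(x)$ be the lift, normalized by $\det(L_\varepsilon,L_\varepsilon',\dots,L_\varepsilon^{(d)})=1$, of the envelope of the hyperplanes through the points of $G(x+k_0\varepsilon),\dots,G(x+k_{d-1}\varepsilon)$, i.e. $\det(G(x+k_0\varepsilon),\dots,G(x+k_{d-1}\varepsilon),L_\varepsilon^{(j)}(x))=0$ for $0\le j\le d-1$, and let $u_{j,\varepsilon}$ be the coefficients of the operator annihilating $L_\varepsilon$. If $L_\varepsilon=G+\varepsilon^2B+O(\varepsilon^3)$ and $u_{j,\varepsilon}=u_j+\varepsilon^2w_j+O(\varepsilon^3)$, the continuous limit of $T_{\bar I,\bar R}$, for $\bar R$ constant, is $dG/dt=B$, equivalently $du_j/dt=w_j$, $0\le j\le d-1$. The continuous limit of the refactorization pentagram map of $(J_-,J_+)$ is defined as the time reversal of the continuous limit of $T_{R^*,I^*}$. Theorem. (1) $T_{I,R}$ is a long-diagonal pentagram map. It realizes the refactorization pentagram map of $(J_-,J_+)$: up to a fixed shift of indices, wherever $T_{I,R}$ is defined, it is given by the formula of the pair $(J_-,J_+)$, and the images of a polygon in $\mathbb{RP}^d$ under $T_{I,R}$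 and of a $J$-corrugated polygon corresponding to the same operator $\mathcal D$ (no row of which vanishes), wherever the pair map is defined at the latter, both correspond to every $\tilde{\mathcal D}$ with $\tilde{\mathcal D}_+\mathcal D_-=\tilde{\mathcal D}_-\mathcal D_+$. The maps $T_{I,R}$ and $T_{R^*,I^*}$ are inverse to each other up to a shift of indices, wherever the compositions are defined. (2) There is a constant $C>0$ depending only on $d,m,J_-,J_+$ such that, with $Q_2=\partial^2+\frac{2}{d+1}u_{d-1}$: for all $G$ as above the expansions for $T_{R^*,I^*}$ exist, with $B=C\,Q_2G$; and for every $L$ the continuous limit of the refactorization pentagram map is $dL/dt=-C\,[Q_2,L]$. Hence $u(t,x)$ evolves by this limit if and only if $u(-t/C,x)$ solves the $(2,d+1)$-KdV equation $$\frac{dL}{dt}=\Big[\partial^2+\frac{2}{d+1}u_{d-1},\,L\Big];$$ that is, up to rescaling and reversing time the limit is the $(2,d+1)$-KdV flow. (3) For $d=2$ this generalizes the Boussinesq equation: if $L=\partial^3+u\,\partial+v$ is a smooth solution of the $(2,3)$-KdV equation, then $U(t,x)=u(\sqrt3\,t,x)$ satisfies $U_{tt}+2(U^2)_{xx}+U_{xxxx}=0$.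 -/

import Mathlib

open scoped ContDiff Matrix LinearAlgebra.Projectivization

noncomputable section

/-! ## Polygons, jump tuples and the pentagram maps `T_{I,R}` -/

/-- A bi-infinite polygon in the projectivization of `E` (twisted `n`-gons are a special case). -/
abbrev PolygonIn (E : Type) [AddCommGroup E] [Module ℝ E] : Type := ℤ → ℙ ℝ E

/-- The polygon with indices shifted by `s`. -/
def shiftPolygon {E : Type} [AddCommGroup E] [Module ℝ E] (s : ℤ) (v : PolygonIn E) : PolygonIn E :=
  fun k => v (k + s)

/-- Partial sums of a tuple: `0, i₁, i₁ + i₂, …`. A `(d-1)`-tuple is a list of length `d - 1`. -/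
def offset (I : List ℕ) (l : ℕ) : ℤ := ((I.take l).sum : ℤ)

/-- The diagonal hyperplane `P_k = span ⟨v_k, v_{k+i₁}, …, v_{k+i₁+⋯+i_{d-1}}⟩` of a polygon
in `ℝP^d`, as a linear subspace of `ℝ^{d+1}`. -/
def diagHyperplane (d : ℕ) (I : List ℕ) (v : PolygonIn (Fin (d + 1) → ℝ)) (k : ℤ) :
    Submodule ℝ (Fin (d + 1) → ℝ) :=
  ⨆ l : Fin d, (v (k + offset I l)).submodule

/-- `T_{I,R}` is defined at `v` and sends it to `v'`: the `d` points defining each `P_k` are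
independent, and `v'_k` is the only point of `P_k ∩ P_{k+r₁} ∩ ⋯ ∩ P_{k+r₁+⋯+r_{d-1}}`. -/
def IsPentagramImage (d : ℕ) (I R : List ℕ) (v v' : PolygonIn (Fin (d + 1) → ℝ)) : Prop :=
  (∀ k, Projectivization.Independent (fun l : Fin d => v (k + offset I l))) ∧
  ∀ k, (v' k).submodule = ⨅ l : Fin d, diagHyperplane d I v (k + offset R l)

/-- The pentagram maps `T_{I,R}` and `T_{I',R'}` are inverse to each other up to a shift of
indices (as partially defined maps). -/
def AreInverseUpToShift (d : ℕ) (I R I' R' : List ℕ) : Prop :=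
  ∃ s : ℤ, ∀ v v' v'' : PolygonIn (Fin (d + 1) → ℝ),
    (IsPentagramImage d I R v v' → IsPentagramImage d I' R' v' v'' → v'' = shiftPolygon s v) ∧
    (IsPentagramImage d I' R' v v' → IsPentagramImage d I R v' v'' → v'' = shiftPolygon s v)

/-! ## Arithmetic progressions and long-diagonal pentagram maps -/

/-- The arithmetic progression `a, a + m, …, a + m (n - 1)`. -/
def arithProg (a : ℤ) (m n : ℕ) : Finset ℤ :=
  (Finset.range n).image (fun i : ℕ => a + (m : ℤ) * (i : ℤ))

/-- The sequence of differences between consecutive elements of a finite set of integers. -/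
def differences (S : Finset ℤ) : List ℕ :=
  List.zipWith (fun x y => (y - x).toNat) (S.sort (· ≤ ·)) (S.sort (· ≤ ·)).tail

/-- `T_{I,R}` is a long-diagonal pentagram map in `ℝP^d`: `I = (m, …, m)` and `R` is the sequence
of differences of the union of two disjoint arithmetic `m`-progressions with `d` elements in
total. -/
def IsLongDiagonal (m d : ℕ) (I R : List ℕ) : Prop :=
  I = List.replicate (d - 1) m ∧
  ∃ (r r' : ℤ) (n n' : ℕ), n + n' = d ∧
    Disjoint (arithProg r m n) (arithProg r' m n') ∧
    R = differences (arithProg r m n ∪ arithProg r' m n')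

/-! ## Refactorization pentagram maps -/

/-- The difference operator `∑_{j ∈ J} a^{(j)} T^j`, where `a j i` stands for `a^{(j)}_i`, applied
to a bi-infinite sequence of vectors. -/
def diffOp {E : Type} [AddCommGroup E] [Module ℝ E] (J : Finset ℤ) (a : ℤ → ℤ → ℝ)
    (V : ℤ → E) : ℤ → E :=
  fun i => ∑ j ∈ J, a j i • V (i + j)

/-- The refactorization relation `D'₊ D₋ = D'₋ D₊` between the operators
`D = D₋ + D₊` (coefficients `a`) and `D' = D'₋ + D'₊` (coefficients `a'`). -/
def IsRefactorization (Jm Jp : Finset ℤ) (a a' : ℤ → ℤ → ℝ) : Prop :=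
  ∀ ξ : ℤ → ℝ, diffOp Jp a' (diffOp Jm a ξ) = diffOp Jm a' (diffOp Jp a ξ)

/-- The operator supported in `J` with coefficients `a` corresponds to the polygon `v`: it
annihilates a lift of `v`. -/
def OperatorOf {E : Type} [AddCommGroup E] [Module ℝ E] (J : Finset ℤ) (a : ℤ → ℤ → ℝ)
    (v : PolygonIn E) : Prop :=
  ∃ (V : ℤ → E) (hV : ∀ i, V i ≠ 0),
    (∀ i, v i = Projectivization.mk ℝ (V i) (hV i)) ∧ diffOp J a V = 0

/-- `span {v_{i+j} | j ∈ J}` as a linear subspace. -/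
def spanAt {E : Type} [AddCommGroup E] [Module ℝ E] (J : Finset ℤ) (v : PolygonIn E) (i : ℤ) :
    Submodule ℝ E :=
  ⨆ j ∈ J, (v (i + j)).submodule

/-- `J`-corrugated: for each `i` the points `v_{i+j}`, `j ∈ J`, lie in a projective plane of
dimension `|J| - 2`. -/
def IsCorrugated {E : Type} [AddCommGroup E] [Module ℝ E] (J : Finset ℤ) (v : PolygonIn E) : Prop :=
  ∀ i, Module.finrank ℝ (spanAt J v i) + 1 ≤ J.card

/-- The pentagram map associated with the pair `(J₋, J₊)` is defined at the corrugated polygon `v`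
and sends it to `v'`: `v'_i = span {v_{i+j} | j ∈ J₋} ∩ span {v_{i+j} | j ∈ J₊}`. -/
def IsPairImage {E : Type} [AddCommGroup E] [Module ℝ E] (Jm Jp : Finset ℤ)
    (v v' : PolygonIn E) : Prop :=
  IsCorrugated (Jm ∪ Jp) v ∧
  (∀ i, Projectivization.Independent (fun j : Jm => v (i + j))) ∧
  (∀ i, Projectivization.Independent (fun j : Jp => v (i + j))) ∧
  ∀ i, (v' i).submodule = spanAt Jm v i ⊓ spanAt Jp v i

/-- The refactorization pentagram map of the pair `(J₋, J₊)` is realized by `T_{I,R}` on polygons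
in `ℝP^d`. Corrugated polygons `w` (in a projective space of any dimension) and polygons `v` in
`ℝP^d` are matched when they correspond to the same operator; up to a shift of indices, `T_{I,R}`
is given by the formula of the pair `(J₋, J₊)`, and the images of `v` and `w` correspond to the
operators obtained by refactorization. -/
def IsRealizedBy (d : ℕ) (Jm Jp : Finset ℤ) (I R : List ℕ) : Prop :=
  ∃ s : ℤ, ∀ v v' : PolygonIn (Fin (d + 1) → ℝ), IsPentagramImage d I R v v' →
    IsPairImage Jm Jp v (shiftPolygon s v') ∧
    ∀ a a' : ℤ → ℤ → ℝ, (∀ i, ∃ j ∈ Jm ∪ Jp, a j i ≠ 0) → IsRefactorization Jm Jp a a' →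
      OperatorOf (Jm ∪ Jp) a v →
      OperatorOf (Jm ∪ Jp) a' (shiftPolygon s v') ∧
      ∀ (N : ℕ) (w w' : PolygonIn (Fin N → ℝ)), OperatorOf (Jm ∪ Jp) a w →
        IsPairImage Jm Jp w w' → OperatorOf (Jm ∪ Jp) a' w'

/-- For `J` the `m`-progression with first term `a` and `p` terms, the `m`-progression
`max J - m (d - 1), …, min J`. -/
def dualProg (m d : ℕ) (a : ℤ) (p : ℕ) : Finset ℤ :=
  arithProg (a + m * ((p : ℤ) - 1) - m * ((d : ℤ) - 1)) m (d + 1 - p)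

/-- The jump tuple `(m, …, m)` of the long-diagonal realization. -/
def jumpTuple (m d : ℕ) : List ℕ := List.replicate (d - 1) m

/-- The intersection tuple of the long-diagonal realization of the pair
`J₋ = {a, …, a + m (p - 1)}`, `J₊ = {b, …, b + m (q - 1)}`. -/
def intersectionTuple (m d : ℕ) (a b : ℤ) (p q : ℕ) : List ℕ :=
  differences (dualProg m d a p ∪ dualProg m d b q)

/-! ## Differential operators and the `(2, d+1)`-KdV equation

Coefficients `u₀, …, u_{d-1}` are stored as `u : ℕ → ℝ → ℝ`; only `u j` with `j < d` is used. -/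

/-- The coefficients `u₀, …, u_{d-1}` are smooth and `2π`-periodic. -/
def SmoothPeriodic (d : ℕ) (u : ℕ → ℝ → ℝ) : Prop :=
  ∀ j < d, ContDiff ℝ ∞ (u j) ∧ Function.Periodic (u j) (2 * Real.pi)

/-- `L = ∂^{d+1} + u_{d-1} ∂^{d-1} + ⋯ + u₁ ∂ + u₀`. -/
def opL {F : Type} [NormedAddCommGroup F] [NormedSpace ℝ F] (d : ℕ) (u : ℕ → ℝ → ℝ)
    (f : ℝ → F) : ℝ → F :=
  fun x => iteratedDeriv (d + 1) f x + ∑ j ∈ Finset.range d, u j x • iteratedDeriv j f x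

/-- `Q₂ = ∂² + (2 / (d + 1)) u_{d-1}`. -/
def opQ {F : Type} [NormedAddCommGroup F] [NormedSpace ℝ F] (d : ℕ) (u : ℕ → ℝ → ℝ)
    (f : ℝ → F) : ℝ → F :=
  fun x => iteratedDeriv 2 f x + (2 / ((d : ℝ) + 1) * u (d - 1) x) • f x

/-- The commutator `[Q₂, L]`. -/
def commQL (d : ℕ) (u : ℕ → ℝ → ℝ) (f : ℝ → ℝ) : ℝ → ℝ :=
  fun x => opQ d u (opL d u f) x - opL d u (opQ d u f) x

/-- `dL/dt = [Q₂, L]` at all times `t ∈ S`, as an identity of operators on smooth functions. -/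
def IsKdVSolutionOn (d : ℕ) (S : Set ℝ) (u : ℝ → ℕ → ℝ → ℝ) : Prop :=
  ∀ t ∈ S, SmoothPeriodic d (u t) ∧
    ∀ f : ℝ → ℝ, ContDiff ℝ ∞ f → ∀ x : ℝ,
      HasDerivAt (fun s => opL d (u s) f x) (commQL d (u t) f x) t

/-! ## Curves, envelopes and continuous limits -/

/-- `det (G, G', …, G^{(d)})`. -/
def wronskian (d : ℕ) (G : ℝ → Fin (d + 1) → ℝ) (x : ℝ) : ℝ :=
  Matrix.det (Matrix.of fun i j : Fin (d + 1) => iteratedDeriv (j : ℕ) G x i)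

/-- `G` is the normalized lift of a smooth non-degenerate quasi-periodic curve in `ℝP^d`, and `L`
with coefficients `u` is the differential operator annihilating it. -/
def IsCurve (d : ℕ) (u : ℕ → ℝ → ℝ) (G : ℝ → Fin (d + 1) → ℝ) : Prop :=
  ContDiff ℝ ∞ G ∧ (∀ x, wronskian d G x = 1) ∧
  (∃ M : Matrix (Fin (d + 1)) (Fin (d + 1)) ℝ, M.det = 1 ∧
    ∀ x, G (x + 2 * Real.pi) = M *ᵥ G x) ∧
  SmoothPeriodic d u ∧ ∀ x, opL d u G x = 0

/-- The numbers `k₀ < ⋯ < k_{d-1}`: the partial sums of `I` translated to have sum zero. -/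
def centeredOffset (d : ℕ) (I : List ℕ) (l : Fin d) : ℝ :=
  (offset I l : ℝ) - (∑ i : Fin d, (offset I i : ℝ)) / d

/-- `E` is the normalized lift of the envelope of the hyperplanes
`P_ε(x) = (γ(x + k₀ ε), …, γ(x + k_{d-1} ε))`. -/
def IsEnvelopeLift (d : ℕ) (k : Fin d → ℝ) (G : ℝ → Fin (d + 1) → ℝ) (ε : ℝ)
    (E : ℝ → Fin (d + 1) → ℝ) : Prop :=
  ContDiff ℝ ∞ E ∧ (∀ x, wronskian d E x = 1) ∧
  ∀ x, LinearIndependent ℝ (fun l : Fin d => G (x + k l * ε)) ∧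
    ∀ j < d, Matrix.det (Matrix.of (Fin.snoc (α := fun _ => Fin (d + 1) → ℝ)
      (fun l : Fin d => G (x + k l * ε)) (iteratedDeriv j E x))) = 0

/-- The lifts `L_ε` of the envelopes exist for small `ε > 0`, with `L_ε = G + ε² B + O(ε³)`
(locally uniformly in `x`), and the coefficients of the differential operators annihilating them
satisfy `u_{j,ε} = u_j + ε² w_j + O(ε³)` (uniformly in `x`). -/
def HasEnvelopeExpansion (d : ℕ) (k : Fin d → ℝ) (u : ℕ → ℝ → ℝ) (G B : ℝ → Fin (d + 1) → ℝ)
    (w : ℕ → ℝ → ℝ) : Prop :=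
  ∃ (ε₀ : ℝ) (E : ℝ → ℝ → Fin (d + 1) → ℝ) (uε : ℝ → ℕ → ℝ → ℝ), 0 < ε₀ ∧
    (∀ ε ∈ Set.Ioo 0 ε₀, IsEnvelopeLift d k G ε (E ε) ∧ ∀ x, opL d (uε ε) (E ε) x = 0) ∧
    (∀ A : ℝ, ∃ K : ℝ, ∀ ε ∈ Set.Ioo 0 ε₀, ∀ x, |x| ≤ A →
      ‖E ε x - (G x + ε ^ 2 • B x)‖ ≤ K * ε ^ 3) ∧
    ∃ K : ℝ, ∀ ε ∈ Set.Ioo 0 ε₀, ∀ j < d, ∀ x,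
      |uε ε j x - (u j x + ε ^ 2 * w j x)| ≤ K * ε ^ 3

/-- The continuous limit of `T_{I,R}`, where `R = (c, …, c)`, moves the operator with coefficients
`u` with velocity `w`: `du_j/dt = w_j`. -/
def IsLimitVelocity (d : ℕ) (I R : List ℕ) (u w : ℕ → ℝ → ℝ) : Prop :=
  (∃ c : ℕ, 0 < c ∧ R = List.replicate (d - 1) c) ∧
  ∃ G B : ℝ → Fin (d + 1) → ℝ, IsCurve d u G ∧
    HasEnvelopeExpansion d (centeredOffset d I) u G B w

/-- The continuous limit of the refactorization pentagram map of the pair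
`J₋ = {a, …, a + m (p - 1)}`, `J₊ = {b, …, b + m (q - 1)}` moves the operator with coefficients `u`
with velocity `w`. If `T_{I,R}` is the long-diagonal realization, its inverse is `T_{R*,I*}`, where
`*` is reversal of tuples and `I* = (m, …, m)`; the limit of `T_{I,R}` is the limit of `T_{R*,I*}`
with the direction of time reversed. -/
def IsRefactorizationVelocity (m d : ℕ) (a b : ℤ) (p q : ℕ) (u w : ℕ → ℝ → ℝ) : Prop :=
  IsLimitVelocity d (intersectionTuple m d a b p q).reverse (jumpTuple m d).reverse u
    (fun j x => -w j x)

/-- `u` evolves, at all times `t ∈ S`, by the continuous limit of the refactorization pentagram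
map. -/
def IsRefactorizationLimitSolutionOn (m d : ℕ) (a b : ℤ) (p q : ℕ) (S : Set ℝ)
    (u : ℝ → ℕ → ℝ → ℝ) : Prop :=
  ∀ t ∈ S, SmoothPeriodic d (u t) ∧
    ∃ w : ℕ → ℝ → ℝ, IsRefactorizationVelocity m d a b p q (u t) w ∧
      ∀ j < d, ∀ x : ℝ, HasDerivAt (fun s => u s j x) (w j x) t

end

/-! Realization. Write `P_k` for the hyperplane spanned by `v_k, v_{k+m}, …, v_{k+m(d-1)}`. The dual
progression of `J₋` lists the `r` for which the window of `P_{i+r}` contains every `i + j`, `j ∈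
J₋`. These `d + 1 - p` hyperplanes contain the span of the `p` points. If all `d` hyperplanes
attached to `J₋` and `J₊` meet in a line of `ℝ^{d+1}`, a dimension count turns this inclusion into
an equality, so their intersection is the intersection of the two spans
(`independent_and_spanAt_eq`). For a lift `V` annihilated by `D`, the sequence `W = D₋V = -D₊V` lies
in both spans, hence lifts the image polygon, and `D'W = D'₊D₋V - D'₋D₊V = 0`
(`OperatorOf.pairImage`). The map is inverted by duality: the vertices recover the hyperplanes by
spans, and the hyperplanes recover the old vertices by intersections
(`IsPentagramImage.comp_reverse`).

Continuous limit. Let `H` be the dual curve: `H·G^{(j)} = 0` for `j < d`, `H·G^{(d)} = 1`. The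
points `G(x + k_l ε)` have the same span as their rescaled divided differences, and these are
`G^{(i)}`, `i < d`, up to `O(ε³)`, except for corrections `ε² C G^{(d)}` at `i = d-2` and `ε² μ
G^{(d+1)}` at `i = d-1`, where `C = ∑ k_l² / (2d(d-1))`; the condition `∑ k_l = 0` removes the term
of order `ε` (`smoothO_divDiff`). Since `H·G^{(d+1)} = 0` and `H''·G^{(i)} = δ_{i,d-2}` for `i < d`,
the normal covector is `n = H - ε² C H'' + O(ε³)` (`IsCurve.exists_normal`). The envelope is the
curve annihilated by `n, n', …, n^{(d-1)}`. Low-order pairings of `H` and `G` are constant, so `∂²`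
moves across the pairing and `H^{(i)}·Q₂G = H^{(i+2)}·G` for `i < d` (`IsCurve.pairing_opQ`). Hence
`G + ε² C Q₂G` is the envelope to third order. The potential of `Q₂` does not enter this equation;
it is the one for which the Wronskian stays `1` to first order in `ε²` (`IsCurve.trace_opQ`).

On operators, `(L + ε² C [Q₂, L])(G + ε² C Q₂G) = ε² C Q₂LG + O(ε⁴) = O(ε⁴)`, and `[Q₂, L]` has
order less than `d`, so the velocity of `L` is `C [Q₂, L]` (`IsCurve.smoothO_annCoeff`). Normalized
envelope lifts are unique up to a constant factor, which does not affect the annihilating operator,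
so the velocity is well defined (`IsCurve.velocity_unique`); solving `Lf = 0` gives a curve for
every `L` (`exists_isCurve`). Time reversal supplies the sign. Estimates are made for families in
`ε` with all `x`-derivatives controlled, because envelopes and Wronskians involve derivatives.

Boussinesq. For `d = 2` the flow is `u_t = 2v_x - u_xx`, `v_t = v_xx - (2/3)u_xxx - (2/3)u u_x`.
Eliminating `v` gives `3u_tt = -u_xxxx - 2(u²)_xx`, and the factor `√3` in time absorbs the `3`. -/

noncomputable section

/-! ## Families of smooth functions of order `ε ^ n` -/

/-- `f ε x = O(ε ^ n)`, locally uniformly in `x`, for `0 < ε < ε₀`. -/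
def LocO (ε₀ : ℝ) (n : ℕ) (f : ℝ → ℝ → ℝ) : Prop :=
  ∀ A : ℝ, ∃ K : ℝ, ∀ ε ∈ Set.Ioo 0 ε₀, ∀ x, |x| ≤ A → |f ε x| ≤ K * ε ^ n

/-- The functions `f ε` are smooth and their derivatives of order at most `N` are `O(ε ^ n)`. -/
def SmoothOUpTo (ε₀ : ℝ) (N n : ℕ) (f : ℝ → ℝ → ℝ) : Prop :=
  (∀ ε ∈ Set.Ioo 0 ε₀, ContDiff ℝ ∞ (f ε)) ∧
    ∀ j ≤ N, LocO ε₀ n (fun ε => iteratedDeriv j (f ε))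

/-- The functions `f ε` are smooth and all their derivatives are `O(ε ^ n)`. -/
def SmoothO (ε₀ : ℝ) (n : ℕ) (f : ℝ → ℝ → ℝ) : Prop :=
  (∀ ε ∈ Set.Ioo 0 ε₀, ContDiff ℝ ∞ (f ε)) ∧
    ∀ j, LocO ε₀ n (fun ε => iteratedDeriv j (f ε))

namespace LocO
variable {ε₀ : ℝ} {n m : ℕ} {f g : ℝ → ℝ → ℝ}

lemma exists_nonneg (hf : LocO ε₀ n f) (A : ℝ) :
    ∃ K : ℝ, 0 ≤ K ∧ ∀ ε ∈ Set.Ioo 0 ε₀, ∀ x, |x| ≤ A → |f ε x| ≤ K * ε ^ n := by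
  obtain ⟨K, hK⟩ := hf A
  refine ⟨|K|, abs_nonneg _, fun ε hε x hx => (hK ε hε x hx).trans ?_⟩
  have := pow_pos hε.1 n
  gcongr
  exact le_abs_self K

lemma congr (hf : LocO ε₀ n f) (h : ∀ ε ∈ Set.Ioo 0 ε₀, ∀ x, f ε x = g ε x) : LocO ε₀ n g := by
  intro A
  obtain ⟨K, hK⟩ := hf A
  exact ⟨K, fun ε hε x hx => h ε hε x ▸ hK ε hε x hx⟩

lemma add (hf : LocO ε₀ n f) (hg : LocO ε₀ n g) : LocO ε₀ n (fun ε x => f ε x + g ε x) := by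
  intro A
  obtain ⟨K, hK⟩ := hf A
  obtain ⟨K', hK'⟩ := hg A
  refine ⟨K + K', fun ε hε x hx => (abs_add_le _ _).trans ?_⟩
  linarith [hK ε hε x hx, hK' ε hε x hx]

lemma mul (hf : LocO ε₀ n f) (hg : LocO ε₀ m g) :
    LocO ε₀ (n + m) (fun ε x => f ε x * g ε x) := by
  intro A
  obtain ⟨K, hK0, hK⟩ := hf.exists_nonneg A
  obtain ⟨K', hK0', hK'⟩ := hg.exists_nonneg A
  refine ⟨K * K', fun ε hε x hx => ?_⟩
  have := pow_pos hε.1 n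
  calc |f ε x * g ε x| = |f ε x| * |g ε x| := abs_mul _ _
    _ ≤ (K * ε ^ n) * (K' * ε ^ m) := by
        gcongr
        · exact hK ε hε x hx
        · exact hK' ε hε x hx
    _ = K * K' * ε ^ (n + m) := by ring

lemma mono {ε₁ : ℝ} (hf : LocO ε₀ n f) (h : ε₁ ≤ ε₀) : LocO ε₁ n f := by
  intro A
  obtain ⟨K, hK⟩ := hf A
  exact ⟨K, fun ε hε x hx => hK ε ⟨hε.1, hε.2.trans_le h⟩ x hx⟩

lemma weaken (hf : LocO ε₀ n f) (h1 : ε₀ ≤ 1) (h : m ≤ n) : LocO ε₀ m f := by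
  intro A
  obtain ⟨K, hK0, hK⟩ := hf.exists_nonneg A
  refine ⟨K, fun ε hε x hx => (hK ε hε x hx).trans ?_⟩
  have := pow_le_pow_of_le_one hε.1.le (hε.2.le.trans h1) h
  gcongr

lemma of_continuous {c : ℝ → ℝ} (hc : Continuous c) : LocO ε₀ 0 (fun _ => c) := by
  intro A
  obtain ⟨K, hK⟩ := (isCompact_Icc (a := -A) (b := A)).exists_bound_of_continuousOn hc.continuousOn
  refine ⟨K, fun ε _ x hx => ?_⟩
  simpa using hK x (abs_le.mp hx)

end LocO

lemma contDiff_deriv {F : Type*} [NormedAddCommGroup F] [NormedSpace ℝ F] {f : ℝ → F}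
    (hf : ContDiff ℝ ∞ f) : ContDiff ℝ ∞ (deriv f) :=
  ((contDiff_infty_iff_deriv).mp hf).2

lemma contDiff_iteratedDeriv {F : Type*} [NormedAddCommGroup F] [NormedSpace ℝ F] {f : ℝ → F}
    (hf : ContDiff ℝ ∞ f) (j : ℕ) : ContDiff ℝ ∞ (iteratedDeriv j f) := by
  induction j with
  | zero => simpa using hf
  | succ j ih => rw [iteratedDeriv_succ]; exact contDiff_deriv ih

lemma hasDerivAt_iteratedDeriv {F : Type*} [NormedAddCommGroup F] [NormedSpace ℝ F] {f : ℝ → F}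
    (hf : ContDiff ℝ ∞ f) (j : ℕ) (x : ℝ) :
    HasDerivAt (iteratedDeriv j f) (iteratedDeriv (j + 1) f x) x := by
  rw [iteratedDeriv_succ]
  exact ((contDiff_iteratedDeriv hf j).differentiable (by simp)).differentiableAt.hasDerivAt

lemma iteratedDeriv_iteratedDeriv {F : Type*} [NormedAddCommGroup F] [NormedSpace ℝ F]
    (f : ℝ → F) (i j : ℕ) : iteratedDeriv i (iteratedDeriv j f) = iteratedDeriv (i + j) f := by
  simp only [iteratedDeriv_eq_iterate, Function.iterate_add_apply]

namespace SmoothOUpTo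
variable {ε₀ : ℝ} {N n m : ℕ} {f g : ℝ → ℝ → ℝ}

lemma zero_iff : SmoothOUpTo ε₀ 0 n f ↔ (∀ ε ∈ Set.Ioo 0 ε₀, ContDiff ℝ ∞ (f ε)) ∧ LocO ε₀ n f := by
  simp [SmoothOUpTo]

/-- Splits off one derivative. Products, real powers and Taylor remainders are then treated by
induction on `N`, using only the first-order rule of differentiation. -/
lemma succ_iff : SmoothOUpTo ε₀ (N + 1) n f ↔
    SmoothOUpTo ε₀ 0 n f ∧ SmoothOUpTo ε₀ N n (fun ε => deriv (f ε)) := by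
  constructor
  · intro h
    refine ⟨⟨h.1, fun j hj => h.2 j (by omega)⟩, fun ε hε => contDiff_deriv (h.1 ε hε),
      fun j hj => ?_⟩
    have := h.2 (j + 1) (by omega)
    simpa only [iteratedDeriv_succ'] using this
  · intro h
    refine ⟨h.1.1, fun j hj => ?_⟩
    cases j with
    | zero => exact h.1.2 0 le_rfl
    | succ j => simpa only [iteratedDeriv_succ'] using h.2.2 j (by omega)

lemma weakenN {N' : ℕ} (hf : SmoothOUpTo ε₀ N n f) (h : N' ≤ N) : SmoothOUpTo ε₀ N' n f :=
  ⟨hf.1, fun j hj => hf.2 j (hj.trans h)⟩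

lemma congr (hf : SmoothOUpTo ε₀ N n f) (h : ∀ ε ∈ Set.Ioo 0 ε₀, f ε = g ε) :
    SmoothOUpTo ε₀ N n g :=
  ⟨fun ε hε => h ε hε ▸ hf.1 ε hε, fun j hj => (hf.2 j hj).congr fun ε hε x => by rw [h ε hε]⟩

lemma add (hf : SmoothOUpTo ε₀ N n f) (hg : SmoothOUpTo ε₀ N n g) :
    SmoothOUpTo ε₀ N n (fun ε x => f ε x + g ε x) := by
  refine ⟨fun ε hε => (hf.1 ε hε).add (hg.1 ε hε), fun j hj => ?_⟩
  refine ((hf.2 j hj).add (hg.2 j hj)).congr fun ε hε x => ?_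
  have h1 : ContDiffAt ℝ j (f ε) x := ((hf.1 ε hε).of_le (mod_cast le_top)).contDiffAt
  have h2 : ContDiffAt ℝ j (g ε) x := ((hg.1 ε hε).of_le (mod_cast le_top)).contDiffAt
  exact (iteratedDeriv_add h1 h2).symm

lemma mul (hf : SmoothOUpTo ε₀ N n f) (hg : SmoothOUpTo ε₀ N m g) :
    SmoothOUpTo ε₀ N (n + m) (fun ε x => f ε x * g ε x) := by
  induction N generalizing f g with
  | zero =>
    rw [zero_iff] at *
    exact ⟨fun ε hε => (hf.1 ε hε).mul (hg.1 ε hε), hf.2.mul hg.2⟩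
  | succ N ih =>
    have hf' := succ_iff.mp hf
    have hg' := succ_iff.mp hg
    rw [succ_iff]
    constructor
    · rw [zero_iff]
      exact ⟨fun ε hε => (hf.1 ε hε).mul (hg.1 ε hε),
        (zero_iff.mp hf'.1).2.mul (zero_iff.mp hg'.1).2⟩
    · refine ((ih hf'.2 (hg.weakenN N.le_succ)).add (ih (hf.weakenN N.le_succ) hg'.2)).congr
        fun ε hε => ?_
      ext x
      exact (deriv_fun_mul ((hf.1 ε hε).differentiable (by simp) x)
        ((hg.1 ε hε).differentiable (by simp) x)).symm

end SmoothOUpTo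

lemma smoothO_iff {ε₀ : ℝ} {n : ℕ} {f : ℝ → ℝ → ℝ} :
    SmoothO ε₀ n f ↔ ∀ N, SmoothOUpTo ε₀ N n f :=
  ⟨fun h _ => ⟨h.1, fun j _ => h.2 j⟩, fun h => ⟨(h 0).1, fun j => (h j).2 j le_rfl⟩⟩

namespace SmoothO
variable {ε₀ : ℝ} {n m : ℕ} {f g : ℝ → ℝ → ℝ}

lemma congr (hf : SmoothO ε₀ n f) (h : ∀ ε ∈ Set.Ioo 0 ε₀, ∀ x, f ε x = g ε x) :
    SmoothO ε₀ n g :=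
  smoothO_iff.mpr fun N => (smoothO_iff.mp hf N).congr fun ε hε => funext (h ε hε)

lemma locO (hf : SmoothO ε₀ n f) : LocO ε₀ n f := by simpa using hf.2 0

lemma add (hf : SmoothO ε₀ n f) (hg : SmoothO ε₀ n g) : SmoothO ε₀ n (fun ε x => f ε x + g ε x) :=
  smoothO_iff.mpr fun N => (smoothO_iff.mp hf N).add (smoothO_iff.mp hg N)

lemma mul' (hf : SmoothO ε₀ n f) (hg : SmoothO ε₀ m g) :
    SmoothO ε₀ (n + m) (fun ε x => f ε x * g ε x) :=
  smoothO_iff.mpr fun N => (smoothO_iff.mp hf N).mul (smoothO_iff.mp hg N)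

lemma mul (hf : SmoothO ε₀ n f) (hg : SmoothO ε₀ 0 g) :
    SmoothO ε₀ n (fun ε x => f ε x * g ε x) := hf.mul' hg

lemma mul_left (hf : SmoothO ε₀ 0 f) (hg : SmoothO ε₀ n g) :
    SmoothO ε₀ n (fun ε x => f ε x * g ε x) := by
  simpa using hf.mul' hg

lemma mono {ε₁ : ℝ} (hf : SmoothO ε₀ n f) (h : ε₁ ≤ ε₀) : SmoothO ε₁ n f :=
  ⟨fun ε hε => hf.1 ε ⟨hε.1, hε.2.trans_le h⟩, fun j => (hf.2 j).mono h⟩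

lemma weaken (hf : SmoothO ε₀ n f) (h1 : ε₀ ≤ 1) (h : m ≤ n) : SmoothO ε₀ m f :=
  ⟨hf.1, fun j => (hf.2 j).weaken h1 h⟩

lemma of_contDiff {c : ℝ → ℝ} (hc : ContDiff ℝ ∞ c) : SmoothO ε₀ 0 (fun _ => c) :=
  ⟨fun _ _ => hc, fun j => LocO.of_continuous (contDiff_iteratedDeriv hc j).continuous⟩

lemma const (c : ℝ) : SmoothO ε₀ 0 (fun _ _ => c) := of_contDiff contDiff_const

lemma zero : SmoothO ε₀ n (fun _ _ => 0) :=
  ⟨fun _ _ => contDiff_const, fun j A => ⟨0, fun ε _ x _ => by simp⟩⟩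

lemma pow_eps (n : ℕ) : SmoothO ε₀ n (fun ε _ => ε ^ n) := by
  refine ⟨fun _ _ => contDiff_const, fun j A => ⟨1, fun ε hε x _ => ?_⟩⟩
  have := pow_pos hε.1 n
  beta_reduce
  rw [iteratedDeriv_const]
  split_ifs
  · simp [abs_of_pos hε.1]
  · simpa using this.le

lemma const_mul (c : ℝ) (hf : SmoothO ε₀ n f) : SmoothO ε₀ n (fun ε x => c * f ε x) :=
  (const c).mul_left hf

lemma neg (hf : SmoothO ε₀ n f) : SmoothO ε₀ n (fun ε x => -f ε x) :=
  (hf.const_mul (-1)).congr fun _ _ _ => by ring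

lemma sum {ι : Type*} (s : Finset ι) {f : ι → ℝ → ℝ → ℝ} (hf : ∀ i ∈ s, SmoothO ε₀ n (f i)) :
    SmoothO ε₀ n (fun ε x => ∑ i ∈ s, f i ε x) := by
  classical
  induction s using Finset.induction_on with
  | empty => simpa using zero
  | insert a s ha ih =>
    simp only [Finset.sum_insert ha]
    exact (hf a (by simp)).add (ih fun i hi => hf i (by simp [hi]))

lemma iteratedDeriv (hf : SmoothO ε₀ n f) (j : ℕ) :
    SmoothO ε₀ n (fun ε => iteratedDeriv j (f ε)) :=
  ⟨fun ε hε => contDiff_iteratedDeriv (hf.1 ε hε) j, fun i => by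
    simpa only [iteratedDeriv_iteratedDeriv] using hf.2 (i + j)⟩

lemma of_deriv (h : ∀ ε ∈ Set.Ioo 0 ε₀, ContDiff ℝ ∞ (f ε)) (h0 : LocO ε₀ n f)
    (h1 : SmoothO ε₀ n (fun ε => deriv (f ε))) : SmoothO ε₀ n f := by
  refine ⟨h, fun j => ?_⟩
  cases j with
  | zero => simpa using h0
  | succ j => simpa only [iteratedDeriv_succ'] using h1.2 j

/-- Dividing by a power of `ε` lowers the order. -/
lemma inv_pow_mul (hf : SmoothO ε₀ (n + m) f) : SmoothO ε₀ n (fun ε x => (ε ^ m)⁻¹ * f ε x) := by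
  refine ⟨fun ε hε => contDiff_const.mul (hf.1 ε hε), fun j A => ?_⟩
  obtain ⟨K, hK⟩ := hf.2 j A
  refine ⟨K, fun ε hε x hx => ?_⟩
  have := pow_pos hε.1 m
  beta_reduce
  rw [iteratedDeriv_const_mul_field, abs_mul, abs_of_pos (inv_pos.mpr this), inv_mul_le_iff₀ this]
  refine (hK ε hε x hx).trans_eq ?_
  ring

/-- Real powers of a family that stays away from `0` and `∞`. -/
lemma rpow (hf : SmoothO ε₀ 0 f) (h : ∀ ε ∈ Set.Ioo 0 ε₀, ∀ x, f ε x ∈ Set.Icc (1 / 2) 2) (r : ℝ) :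
    SmoothO ε₀ 0 (fun ε x => f ε x ^ r) := by
  rw [smoothO_iff]
  have hpos : ∀ ε ∈ Set.Ioo 0 ε₀, ∀ x, f ε x ≠ 0 := fun ε hε x => by
    have := (h ε hε x).1
    intro h0
    rw [h0] at this
    norm_num at this
  have hs : ∀ r : ℝ, ∀ ε ∈ Set.Ioo 0 ε₀, ContDiff ℝ ∞ (fun x => f ε x ^ r) := fun r ε hε =>
    (hf.1 ε hε).rpow_const_of_ne (hpos ε hε)
  have h0 : ∀ r : ℝ, SmoothOUpTo ε₀ 0 0 (fun ε x => f ε x ^ r) := fun r => by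
    rw [SmoothOUpTo.zero_iff]
    refine ⟨hs r, fun A => ?_⟩
    have hc : ContinuousOn (fun y : ℝ => y ^ r) (Set.Icc (1 / 2) 2) := fun y hy =>
      (Real.continuousAt_rpow_const y r (Or.inl (by
        rintro rfl; norm_num at hy))).continuousWithinAt
    obtain ⟨K, hK⟩ := isCompact_Icc.exists_bound_of_continuousOn hc
    exact ⟨K, fun ε hε x _ => by simpa using hK _ (h ε hε x)⟩
  intro N
  induction N generalizing r with
  | zero => exact h0 r
  | succ N ih =>
    rw [SmoothOUpTo.succ_iff]
    refine ⟨h0 r, ?_⟩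
    -- The derivative is `r f' f^{r-1}`; the exponent changes, so the induction hypothesis is needed
    -- at `r - 1`.
    have h1 := smoothO_iff.mp (hf.iteratedDeriv 1) N
    have h2 := (smoothO_iff.mp (const (ε₀ := ε₀) r) N).mul (h1.mul (ih (r - 1)))
    refine h2.congr fun ε hε => ?_
    ext x
    have hd : HasDerivAt (f ε) (deriv (f ε) x) x :=
      ((hf.1 ε hε).differentiable (by simp) x).hasDerivAt
    rw [(hd.rpow_const (p := r) (Or.inl (hpos ε hε x))).deriv, iteratedDeriv_one]
    ring

end SmoothO
end

/-! ### Determinants and inverses of matrices of families -/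

noncomputable section

/-- The ring of families of smooth functions with locally bounded derivatives. -/
def smoothORing (ε₀ : ℝ) : Subring (ℝ → ℝ → ℝ) where
  carrier := {f | SmoothO ε₀ 0 f}
  mul_mem' hf hg := SmoothO.mul hf hg
  one_mem' := SmoothO.const 1
  add_mem' hf hg := SmoothO.add hf hg
  zero_mem' := SmoothO.const 0
  neg_mem' hf := SmoothO.neg hf

/-- The families of order `ε ^ n` form an ideal. -/
def smoothOIdeal (ε₀ : ℝ) (n : ℕ) : Ideal (smoothORing ε₀) where
  carrier := {f | SmoothO ε₀ n f.1}
  add_mem' hf hg := SmoothO.add hf hg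
  zero_mem' := SmoothO.zero
  smul_mem' c _ hf := SmoothO.mul_left c.2 hf

/-- Evaluation of families. -/
def smoothOEval (ε₀ ε x : ℝ) : smoothORing ε₀ →+* ℝ where
  toFun f := f.1 ε x
  map_one' := rfl
  map_mul' _ _ := rfl
  map_zero' := rfl
  map_add' _ _ := rfl

section Matrix
variable {ι : Type*} [Fintype ι] [DecidableEq ι] {ε₀ : ℝ}

/-- A matrix of families as a matrix over the ring of families. -/
def toSmoothOMatrix (A : ℝ → ℝ → Matrix ι ι ℝ)
    (hA : ∀ i j, SmoothO ε₀ 0 (fun ε x => A ε x i j)) : Matrix ι ι (smoothORing ε₀) :=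
  Matrix.of fun i j => ⟨fun ε x => A ε x i j, hA i j⟩

lemma toSmoothOMatrix_map (A : ℝ → ℝ → Matrix ι ι ℝ)
    (hA : ∀ i j, SmoothO ε₀ 0 (fun ε x => A ε x i j)) (ε x : ℝ) :
    (smoothOEval ε₀ ε x).mapMatrix (toSmoothOMatrix A hA) = A ε x := rfl

lemma toSmoothOMatrix_det (A : ℝ → ℝ → Matrix ι ι ℝ)
    (hA : ∀ i j, SmoothO ε₀ 0 (fun ε x => A ε x i j)) (ε x : ℝ) :
    (toSmoothOMatrix A hA).det.1 ε x = (A ε x).det := by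
  rw [← toSmoothOMatrix_map A hA, ← RingHom.map_det]
  rfl

lemma SmoothO.det {A : ℝ → ℝ → Matrix ι ι ℝ}
    (hA : ∀ i j, SmoothO ε₀ 0 (fun ε x => A ε x i j)) : SmoothO ε₀ 0 (fun ε x => (A ε x).det) :=
  SmoothO.congr (toSmoothOMatrix A hA).det.2 fun ε _ x => toSmoothOMatrix_det A hA ε x

/-- Determinants commute with reduction modulo the ideal of families of order `ε ^ n`, and the two
matrices agree in the quotient. -/
lemma SmoothO.det_sub_det {n : ℕ} {A B : ℝ → ℝ → Matrix ι ι ℝ}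
    (hA : ∀ i j, SmoothO ε₀ 0 (fun ε x => A ε x i j))
    (hB : ∀ i j, SmoothO ε₀ 0 (fun ε x => B ε x i j))
    (h : ∀ i j, SmoothO ε₀ n (fun ε x => A ε x i j - B ε x i j)) :
    SmoothO ε₀ n (fun ε x => (A ε x).det - (B ε x).det) := by
  have key : (toSmoothOMatrix A hA).det - (toSmoothOMatrix B hB).det ∈ smoothOIdeal ε₀ n := by
    rw [← Ideal.Quotient.eq, RingHom.map_det, RingHom.map_det]
    congr 1
    ext i j
    exact Ideal.Quotient.eq.mpr (h i j)
  refine SmoothO.congr key fun ε _ x => ?_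
  rw [← toSmoothOMatrix_det A hA, ← toSmoothOMatrix_det B hB]
  rfl

/-- In the ring of families, `det (1 + r A) = 1 + r tr A + r² c` with `c` in the ring. Taking `r =
ε²` gives the error `O(ε⁴)`. -/
lemma SmoothO.det_one_add {A : ℝ → ℝ → Matrix ι ι ℝ}
    (hA : ∀ i j, SmoothO ε₀ 0 (fun ε x => A ε x i j)) :
    SmoothO ε₀ 4 (fun ε x => (1 + ε ^ 2 • A ε x).det - (1 + ε ^ 2 * (A ε x).trace)) := by
  set r : smoothORing ε₀ := ⟨fun ε _ => ε ^ 2, by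
    exact ⟨fun _ _ => contDiff_const, fun j A => by
      obtain ⟨K, hK⟩ := (SmoothO.pow_eps (ε₀ := ε₀) 2).2 j A
      -- No bound `ε₀ ≤ 1` is assumed here, so `ε²` is bounded by `ε₀²`.
      refine ⟨|K| * ε₀ ^ 2, fun ε hε x hx => (hK ε hε x hx).trans ?_⟩
      have h1 : ε ^ 2 ≤ ε₀ ^ 2 := pow_le_pow_left₀ hε.1.le hε.2.le 2
      rw [pow_zero, mul_one]
      have := hε.1
      gcongr
      exact le_abs_self K⟩⟩ with hr
  have hA' := Matrix.det_one_add_smul r (toSmoothOMatrix A hA)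
  set c := Polynomial.eval r (Matrix.det (1 + (Polynomial.X : Polynomial (smoothORing ε₀)) •
    (toSmoothOMatrix A hA).map Polynomial.C)).divX.divX
  have h4 : SmoothO ε₀ 4 (fun ε x => c.1 ε x * ε ^ 4) := SmoothO.mul_left c.2 (SmoothO.pow_eps 4)
  refine h4.congr fun ε _ x => ?_
  have hev := congrArg (smoothOEval ε₀ ε x) hA'
  rw [RingHom.map_det] at hev
  have h1 : (smoothOEval ε₀ ε x).mapMatrix (1 + r • toSmoothOMatrix A hA) = 1 + ε ^ 2 • A ε x := by
    rw [map_add, map_one]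
    congr 1
  have h2 : smoothOEval ε₀ ε x (toSmoothOMatrix A hA).trace = (A ε x).trace := by
    rw [Matrix.trace, Matrix.trace, map_sum]
    rfl
  rw [h1] at hev
  simp only [map_add, map_mul, map_pow, map_one, h2] at hev
  rw [hev]
  change c.1 ε x * ε ^ 4 = 1 + (A ε x).trace * ε ^ 2 + c.1 ε x * (ε ^ 2) ^ 2 - _
  ring

/-- Cramer's rule: entries of the adjugate are determinants, and the determinant divided by stays in
`[1/2, 2]`. -/
lemma SmoothO.inv {A : ℝ → ℝ → Matrix ι ι ℝ}
    (hA : ∀ i j, SmoothO ε₀ 0 (fun ε x => A ε x i j))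
    (h : ∀ ε ∈ Set.Ioo 0 ε₀, ∀ x, (A ε x).det ∈ Set.Icc (1 / 2) 2) (i j : ι) :
    SmoothO ε₀ 0 (fun ε x => (A ε x)⁻¹ i j) := by
  have h1 : SmoothO ε₀ 0 (fun ε x => (A ε x).adjugate i j) := by
    simp only [Matrix.adjugate_apply]
    refine SmoothO.det fun k l => ?_
    by_cases hk : k = j
    · subst hk
      simpa [Matrix.updateRow_self] using SmoothO.const _
    · simpa [Matrix.updateRow_ne hk] using hA k l
  refine (((SmoothO.det hA).rpow h (-1)).mul h1).congr fun ε _ x => ?_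
  rw [Matrix.inv_def, Ring.inverse_eq_inv', Matrix.smul_apply, smul_eq_mul, Real.rpow_neg_one]

end Matrix

section Vector
variable {κ : Type*} [Fintype κ] {ε₀ : ℝ}

lemma SmoothO.dotProduct {n : ℕ} {v w : ℝ → ℝ → κ → ℝ}
    (hv : ∀ i, SmoothO ε₀ n (fun ε x => v ε x i)) (hw : ∀ i, SmoothO ε₀ 0 (fun ε x => w ε x i)) :
    SmoothO ε₀ n (fun ε x => v ε x ⬝ᵥ w ε x) :=
  SmoothO.sum _ fun i _ => (hv i).mul (hw i)

lemma SmoothO.mulVec {n : ℕ} {A : ℝ → ℝ → Matrix κ κ ℝ} {v : ℝ → ℝ → κ → ℝ}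
    (hA : ∀ i j, SmoothO ε₀ 0 (fun ε x => A ε x i j))
    (hv : ∀ i, SmoothO ε₀ n (fun ε x => v ε x i)) (i : κ) :
    SmoothO ε₀ n (fun ε x => (A ε x *ᵥ v ε x) i) :=
  SmoothO.sum _ fun j _ => (hA i j).mul_left (hv j)

lemma SmoothO.vecMul {n : ℕ} {A : ℝ → ℝ → Matrix κ κ ℝ} {v : ℝ → ℝ → κ → ℝ}
    (hA : ∀ i j, SmoothO ε₀ 0 (fun ε x => A ε x i j))
    (hv : ∀ i, SmoothO ε₀ n (fun ε x => v ε x i)) (i : κ) :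
    SmoothO ε₀ n (fun ε x => (v ε x ᵥ* A ε x) i) :=
  SmoothO.sum _ fun j _ => (hv j).mul (hA j i)

end Vector

/-- A periodic family close to `1` is uniformly close to `1`. -/
lemma SmoothO.exists_uniform {ε₀ T : ℝ} {n : ℕ} {f : ℝ → ℝ → ℝ} (hε₀ : 0 < ε₀) (hε₁ : ε₀ ≤ 1)
    (hT : 0 < T) (hn : n ≠ 0) (hf : SmoothO ε₀ n (fun ε x => f ε x - 1))
    (hper : ∀ ε ∈ Set.Ioo 0 ε₀, ∀ x, f ε (x + T) = f ε x) :
    ∃ ε₁, 0 < ε₁ ∧ ε₁ ≤ ε₀ ∧ ∀ ε ∈ Set.Ioo 0 ε₁, ∀ x, f ε x ∈ Set.Icc (1 / 2) 2 := by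
  obtain ⟨K, hK0, hK⟩ := (hf.weaken hε₁ (Nat.one_le_iff_ne_zero.mpr hn)).locO.exists_nonneg T
  -- This radius makes `K ε ≤ 1/2` on one period; periodicity extends the bound to all `x`.
  refine ⟨min ε₀ (1 / (2 * (K + 1))), by positivity, min_le_left _ _, fun ε hε x => ?_⟩
  have hε' : ε ∈ Set.Ioo 0 ε₀ := ⟨hε.1, hε.2.trans_le (min_le_left _ _)⟩
  obtain ⟨y, hy, hxy⟩ := Function.Periodic.exists_mem_Ico₀ (f := f ε) (hper ε hε') hT x
  have h1 := hK ε hε' y (by rw [abs_of_nonneg hy.1]; exact hy.2.le)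
  have h2 : ε < 1 / (2 * (K + 1)) := hε.2.trans_le (min_le_right _ _)
  rw [lt_div_iff₀ (by positivity)] at h2
  have h3 := abs_le.mp h1
  rw [hxy]
  constructor <;> nlinarith [hε.1]

end

noncomputable section

/-! ## The commutator `[Q₂, L]` -/

/-- `T` is a differential operator of order less than `d` with smooth periodic coefficients. -/
def IsLowerOrder (d : ℕ) (T : (ℝ → ℝ) → ℝ → ℝ) : Prop :=
  ∃ c : ℕ → ℝ → ℝ, SmoothPeriodic d c ∧ ∀ f : ℝ → ℝ, ContDiff ℝ ∞ f → ∀ x,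
    T f x = ∑ j ∈ Finset.range d, c j x * iteratedDeriv j f x

namespace IsLowerOrder
variable {d : ℕ} {T T' : (ℝ → ℝ) → ℝ → ℝ}

lemma congr (hT : IsLowerOrder d T) (h : ∀ f, ContDiff ℝ ∞ f → ∀ x, T' f x = T f x) :
    IsLowerOrder d T' := by
  obtain ⟨c, hc, hT⟩ := hT
  exact ⟨c, hc, fun f hf x => (h f hf x).trans (hT f hf x)⟩

lemma add (hT : IsLowerOrder d T) (hT' : IsLowerOrder d T') :
    IsLowerOrder d (fun f x => T f x + T' f x) := by
  obtain ⟨c, hc, hT⟩ := hT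
  obtain ⟨c', hc', hT'⟩ := hT'
  refine ⟨fun j x => c j x + c' j x, fun j hj => ⟨(hc j hj).1.add (hc' j hj).1,
    (hc j hj).2.add (hc' j hj).2⟩, fun f hf x => ?_⟩
  simp only [hT f hf, hT' f hf, add_mul, Finset.sum_add_distrib]

lemma zero : IsLowerOrder d (fun _ _ => 0) :=
  ⟨fun _ _ => 0, fun _ _ => ⟨contDiff_const, fun _ => rfl⟩, by simp⟩

lemma single {g : ℝ → ℝ} (hg : ContDiff ℝ ∞ g) (hp : Function.Periodic g (2 * Real.pi)) {j : ℕ}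
    (hj : j < d) : IsLowerOrder d (fun f x => g x * iteratedDeriv j f x) := by
  refine ⟨fun i x => if i = j then g x else 0, fun i _ => ?_, fun f hf x => ?_⟩
  · by_cases h : i = j
    · simp only [if_pos h]; exact ⟨hg, hp⟩
    · simp only [if_neg h]; exact ⟨contDiff_const, fun _ => rfl⟩
  · simp [ite_mul, hj]

lemma sum {ι : Type*} (s : Finset ι) {T : ι → (ℝ → ℝ) → ℝ → ℝ}
    (h : ∀ i ∈ s, IsLowerOrder d (T i)) : IsLowerOrder d (fun f x => ∑ i ∈ s, T i f x) := by
  classical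
  induction s using Finset.induction_on with
  | empty => simpa using zero
  | insert a s ha ih =>
    simp only [Finset.sum_insert ha]
    exact (h a (by simp)).add (ih fun i hi => h i (by simp [hi]))

end IsLowerOrder

lemma contDiffAt_of_infty {F : Type*} [NormedAddCommGroup F] [NormedSpace ℝ F] {f : ℝ → F}
    (hf : ContDiff ℝ ∞ f) (n : ℕ) (x : ℝ) : ContDiffAt ℝ n f x :=
  (hf.of_le (mod_cast le_top)).contDiffAt

lemma periodic_iteratedDeriv {F : Type*} [NormedAddCommGroup F] [NormedSpace ℝ F] {f : ℝ → F}
    {T : ℝ} (hf : Function.Periodic f T) (j : ℕ) : Function.Periodic (iteratedDeriv j f) T := by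
  intro x
  have := congrFun (iteratedDeriv_comp_add_const j f T) x
  rw [← this]
  congr 1
  exact funext hf

/-- The terms of order above `d` cancel between `Q₂L` and `LQ₂`. The coefficient of `∂^d` is
`2u'_{d-1} - (d+1)q'` with `q = 2u_{d-1}/(d+1)`, so it vanishes by the choice of the potential.
Hence `dL/dt = [Q₂, L]` preserves the shape of `L`. -/
lemma isLowerOrder_commQL {d : ℕ} (hd : 1 ≤ d) {u : ℕ → ℝ → ℝ} (hu : SmoothPeriodic d u) :
    IsLowerOrder d (commQL d u) := by
  obtain ⟨n, rfl⟩ : ∃ n, d = n + 1 := ⟨d - 1, by omega⟩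
  set q : ℝ → ℝ := fun x => 2 / ((↑(n + 1) : ℝ) + 1) * u n x with hq
  have hun := hu n (Nat.lt_succ_self n)
  have hqs : ContDiff ℝ ∞ q := contDiff_const.mul hun.1
  have hqp : Function.Periodic q (2 * Real.pi) := fun x => by simp only [hq, hun.2 x]
  have hL2 : ∀ f, ContDiff ℝ ∞ f → ∀ x, iteratedDeriv 2 (opL (n + 1) u f) x =
      iteratedDeriv (n + 4) f x + ∑ j ∈ Finset.range (n + 1),
        (iteratedDeriv 2 (u j) x * iteratedDeriv j f x
          + 2 * iteratedDeriv 1 (u j) x * iteratedDeriv (j + 1) f x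
          + u j x * iteratedDeriv (j + 2) f x) := by
    intro f hf x
    have h1 : ∀ j ∈ Finset.range (n + 1), ContDiffAt ℝ 2 (fun x => u j x * iteratedDeriv j f x) x :=
      fun j hj => contDiffAt_of_infty
        ((hu j (Finset.mem_range.mp hj)).1.mul (contDiff_iteratedDeriv hf j)) 2 x
    have h2 : opL (n + 1) u f = fun x => iteratedDeriv (n + 2) f x +
        ∑ j ∈ Finset.range (n + 1), u j x * iteratedDeriv j f x := rfl
    rw [h2, iteratedDeriv_fun_add (contDiffAt_of_infty (contDiff_iteratedDeriv hf _) 2 x)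
      (ContDiffAt.sum h1), iteratedDeriv_iteratedDeriv, iteratedDeriv_fun_sum h1]
    congr 1
    · congr 1; omega
    refine Finset.sum_congr rfl fun j hj => ?_
    rw [iteratedDeriv_fun_mul (contDiffAt_of_infty (hu j (Finset.mem_range.mp hj)).1 2 x)
      (contDiffAt_of_infty (contDiff_iteratedDeriv hf j) 2 x)]
    simp only [Finset.sum_range_succ, Finset.sum_range_zero, iteratedDeriv_iteratedDeriv]
    norm_num
    rw [add_comm 2 j, add_comm 1 j]
    ring
  have hQ : ∀ f, ContDiff ℝ ∞ f → ∀ k x, iteratedDeriv k (opQ (n + 1) u f) x =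
      iteratedDeriv (k + 2) f x +
        ∑ i ∈ Finset.range (k + 1), k.choose i * iteratedDeriv (k - i) q x * iteratedDeriv i f x := by
    intro f hf k x
    have h2 : opQ (n + 1) u f = fun x => iteratedDeriv 2 f x + f x * q x := by
      ext x; simp [opQ, hq]; ring
    rw [h2, iteratedDeriv_fun_add (contDiffAt_of_infty (contDiff_iteratedDeriv hf _) k x)
      (contDiffAt_of_infty (hf.mul hqs) k x), iteratedDeriv_iteratedDeriv,
      iteratedDeriv_fun_mul (contDiffAt_of_infty hf k x) (contDiffAt_of_infty hqs k x)]
    congr 1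
    refine Finset.sum_congr rfl fun i _ => by ring
  -- The terms that survive. The products `u_j ∂^{j+2}`, which reach order `d + 1`, occur in both
  -- `Q₂L` and `LQ₂` and are already left out.
  have key : IsLowerOrder (n + 1) (fun f x =>
      (∑ j ∈ Finset.range (n + 1), (iteratedDeriv 2 (u j) x + q x * u j x) * iteratedDeriv j f x)
      + (∑ j ∈ Finset.range n, (2 * iteratedDeriv 1 (u j) x) * iteratedDeriv (j + 1) f x)
      + (∑ i ∈ Finset.range (n + 1),
          (-((n + 2).choose i * iteratedDeriv (n + 2 - i) q x)) * iteratedDeriv i f x)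
      + ∑ j ∈ Finset.range (n + 1), ∑ i ∈ Finset.range (j + 1),
          (-(u j x * (j.choose i * iteratedDeriv (j - i) q x))) * iteratedDeriv i f x) := by
    refine .add (.add (.add (.sum _ fun j hj => ?_) (.sum _ fun j hj => ?_))
      (.sum _ fun i hi => ?_)) (.sum _ fun j hj => .sum _ fun i hi => ?_)
    · have h := hu j (Finset.mem_range.mp hj)
      exact .single ((contDiff_iteratedDeriv h.1 2).add (hqs.mul h.1))
        ((periodic_iteratedDeriv h.2 2).add (hqp.mul h.2)) (Finset.mem_range.mp hj)
    · have hj' := Finset.mem_range.mp hj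
      have h := hu j (by omega)
      exact .single (contDiff_const.mul (contDiff_iteratedDeriv h.1 1))
        (fun x => by simp only [periodic_iteratedDeriv h.2 1 x]) (by omega)
    · exact .single (contDiff_const.mul (contDiff_iteratedDeriv hqs _)).neg
        (fun x => by simp only [periodic_iteratedDeriv hqp _ x]) (Finset.mem_range.mp hi)
    · have h := hu j (Finset.mem_range.mp hj)
      have hj' := Finset.mem_range.mp hj
      have hi' := Finset.mem_range.mp hi
      exact .single (h.1.mul (contDiff_const.mul (contDiff_iteratedDeriv hqs _))).neg
        (fun x => by simp only [periodic_iteratedDeriv hqp _ x, h.2 x]) (by omega)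
  refine key.congr fun f hf x => ?_
  have e1 : commQL (n + 1) u f x = iteratedDeriv 2 (opL (n + 1) u f) x + q x * opL (n + 1) u f x
      - (iteratedDeriv (n + 2) (opQ (n + 1) u f) x +
        ∑ j ∈ Finset.range (n + 1), u j x * iteratedDeriv j (opQ (n + 1) u f) x) := rfl
  have e2 : opL (n + 1) u f x = iteratedDeriv (n + 2) f x +
        ∑ j ∈ Finset.range (n + 1), u j x * iteratedDeriv j f x := rfl
  -- The two top Leibniz terms of `∂^{d+1} q` are split off, where `d = n + 1`; the identity
  -- `(d+1)q' = 2u'_{d-1}` puts the one of order `d` in the form that cancels.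
  have e3 : ∑ i ∈ Finset.range (n + 2 + 1),
      (n + 2).choose i * iteratedDeriv (n + 2 - i) q x * iteratedDeriv i f x =
      (∑ i ∈ Finset.range (n + 1),
        (n + 2).choose i * iteratedDeriv (n + 2 - i) q x * iteratedDeriv i f x)
      + 2 * iteratedDeriv 1 (u n) x * iteratedDeriv (n + 1) f x + q x * iteratedDeriv (n + 2) f x := by
    rw [Finset.sum_range_succ, Finset.sum_range_succ]
    have hc : ((n + 2).choose (n + 1) : ℝ) = n + 2 := by
      rw [show n + 2 = (n + 1) + 1 from rfl, Nat.choose_succ_self_right]; push_cast; ring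
    have hq1 : iteratedDeriv 1 q x = 2 / ((↑(n + 1) : ℝ) + 1) * iteratedDeriv 1 (u n) x := by
      rw [hq, iteratedDeriv_const_mul_field]
    rw [Nat.choose_self, Nat.sub_self, show n + 2 - (n + 1) = 1 by omega, hc, hq1, iteratedDeriv_zero]
    push_cast
    have : (n : ℝ) + 1 + 1 ≠ 0 := by positivity
    field_simp
    ring
  rw [e1, hL2 f hf, e2, hQ f hf, e3]
  simp only [hQ f hf]
  rw [Finset.sum_add_distrib, Finset.sum_add_distrib,
    Finset.sum_range_succ (fun j => 2 * iteratedDeriv 1 (u j) x * iteratedDeriv (j + 1) f x)]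
  simp only [mul_add, add_mul, Finset.sum_add_distrib, neg_mul, Finset.sum_neg_distrib,
    Finset.mul_sum, mul_assoc]
  ring

end

noncomputable section

/-! ## Vector-valued functions and their pairings -/

section Pairing
variable {ι : Type*} [Fintype ι]

lemma iteratedDeriv_pi_apply {f : ℝ → ι → ℝ} (hf : ContDiff ℝ ∞ f) (j : ℕ) (x : ℝ) (a : ι) :
    iteratedDeriv j f x a = iteratedDeriv j (fun y => f y a) x := by
  induction j generalizing x with
  | zero => simp
  | succ j ih =>
    have h := hasDerivAt_pi.mp (hasDerivAt_iteratedDeriv hf j x) a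
    rw [← h.deriv, iteratedDeriv_succ]
    congr 1
    ext y
    exact ih y

lemma iteratedDeriv_mulVec_of_equivariant {f : ℝ → ι → ℝ} (hf : ContDiff ℝ ∞ f) {T : ℝ}
    {A : Matrix ι ι ℝ} (h : ∀ x, f (x + T) = A *ᵥ f x) (j : ℕ) (x : ℝ) :
    iteratedDeriv j f (x + T) = A *ᵥ iteratedDeriv j f x := by
  induction j generalizing x with
  | zero => simpa using h x
  | succ j ih =>
    have h1 : HasDerivAt (fun y => iteratedDeriv j f (y + T)) (iteratedDeriv (j + 1) f (x + T)) x :=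
      (hasDerivAt_iteratedDeriv hf j (x + T)).comp_add_const x T
    have h2 : HasDerivAt (fun y => A *ᵥ iteratedDeriv j f y) (A *ᵥ iteratedDeriv (j + 1) f x) x := by
      rw [hasDerivAt_pi]
      intro a
      simp only [Matrix.mulVec, dotProduct]
      exact HasDerivAt.fun_sum fun b _ =>
        (hasDerivAt_pi.mp (hasDerivAt_iteratedDeriv hf j x) b).const_mul _
    simp only [ih] at h1
    exact h1.unique h2

lemma hasDerivAt_pairing {h g : ℝ → ι → ℝ} (hh : ContDiff ℝ ∞ h) (hg : ContDiff ℝ ∞ g)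
    (i j : ℕ) (x : ℝ) :
    HasDerivAt (fun y => iteratedDeriv i h y ⬝ᵥ iteratedDeriv j g y)
      (iteratedDeriv (i + 1) h x ⬝ᵥ iteratedDeriv j g x +
        iteratedDeriv i h x ⬝ᵥ iteratedDeriv (j + 1) g x) x := by
  simp only [dotProduct, ← Finset.sum_add_distrib]
  exact HasDerivAt.fun_sum fun a _ =>
    (hasDerivAt_pi.mp (hasDerivAt_iteratedDeriv hh i x) a).mul
      (hasDerivAt_pi.mp (hasDerivAt_iteratedDeriv hg j x) a)

/-- If a pairing of derivatives is constant, then a derivative moves across with a sign. -/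
lemma pairing_succ_left {h g : ℝ → ι → ℝ} (hh : ContDiff ℝ ∞ h) (hg : ContDiff ℝ ∞ g)
    {i j : ℕ} {c : ℝ} (hc : ∀ x, iteratedDeriv i h x ⬝ᵥ iteratedDeriv j g x = c) (x : ℝ) :
    iteratedDeriv (i + 1) h x ⬝ᵥ iteratedDeriv j g x =
      -(iteratedDeriv i h x ⬝ᵥ iteratedDeriv (j + 1) g x) := by
  have h1 := hasDerivAt_pairing hh hg i j x
  simp only [hc] at h1
  linarith [h1.unique (hasDerivAt_const x c)]

/-- A pairing that vanishes identically has zero derivative, so one derivative at a time moves from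
`g` to `h` while the total order stays below `N`. -/
lemma pairing_eq_zero {h g : ℝ → ι → ℝ} (hh : ContDiff ℝ ∞ h) (hg : ContDiff ℝ ∞ g) {N : ℕ}
    (h0 : ∀ j < N, ∀ x, h x ⬝ᵥ iteratedDeriv j g x = 0) (i : ℕ) :
    ∀ j, i + j < N → ∀ x, iteratedDeriv i h x ⬝ᵥ iteratedDeriv j g x = 0 := by
  induction i with
  | zero => intro j hj x; simpa using h0 j (by omega) x
  | succ i ih =>
    intro j hj x
    rw [pairing_succ_left hh hg (ih j (by omega)), ih (j + 1) (by omega), neg_zero]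

lemma pairing_eq_zero' {h g : ℝ → ι → ℝ} (hh : ContDiff ℝ ∞ h) (hg : ContDiff ℝ ∞ g) {N : ℕ}
    (h0 : ∀ i < N, ∀ x, iteratedDeriv i h x ⬝ᵥ g x = 0) (i j : ℕ) (hij : i + j < N) (x : ℝ) :
    iteratedDeriv i h x ⬝ᵥ iteratedDeriv j g x = 0 := by
  rw [dotProduct_comm]
  refine pairing_eq_zero hg hh (N := N) (fun i hi x => ?_) j i (by omega) x
  rw [dotProduct_comm]
  exact h0 i hi x

lemma pairing_eq_pow {h g : ℝ → ι → ℝ} (hh : ContDiff ℝ ∞ h) (hg : ContDiff ℝ ∞ g) {N : ℕ}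
    (h0 : ∀ j < N, ∀ x, h x ⬝ᵥ iteratedDeriv j g x = 0)
    (h1 : ∀ x, h x ⬝ᵥ iteratedDeriv N g x = 1) (i : ℕ) :
    ∀ j, i + j = N → ∀ x, iteratedDeriv i h x ⬝ᵥ iteratedDeriv j g x = (-1) ^ i := by
  induction i with
  | zero =>
    intro j hj x
    obtain rfl : j = N := by omega
    simpa using h1 x
  | succ i ih =>
    intro j hj x
    rw [pairing_succ_left hh hg (pairing_eq_zero hh hg h0 i j (by omega)), ih (j + 1) (by omega),
      pow_succ]
    ring

/-- The two pairings differentiated on the way have total order at most `N`, hence are constant (`0`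
or `±1`), and two moves cost `(-1)² = 1`. The outer pairings may have total order `N + 1`, where
they need not be constant. -/
lemma pairing_shift_two {h g : ℝ → ι → ℝ} (hh : ContDiff ℝ ∞ h) (hg : ContDiff ℝ ∞ g) {N : ℕ}
    (h0 : ∀ j < N, ∀ x, h x ⬝ᵥ iteratedDeriv j g x = 0)
    (h1 : ∀ x, h x ⬝ᵥ iteratedDeriv N g x = 1) {i j : ℕ} (hij : i + j < N) (x : ℝ) :
    iteratedDeriv (i + 2) h x ⬝ᵥ iteratedDeriv j g x =
      iteratedDeriv i h x ⬝ᵥ iteratedDeriv (j + 2) g x := by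
  obtain ⟨c, hc⟩ : ∃ c : ℝ, ∀ x, iteratedDeriv (i + 1) h x ⬝ᵥ iteratedDeriv j g x = c := by
    rcases Nat.lt_or_ge (i + 1 + j) N with hlt | hge
    · exact ⟨0, pairing_eq_zero hh hg h0 (i + 1) j hlt⟩
    · exact ⟨_, pairing_eq_pow hh hg h0 h1 (i + 1) j (by omega)⟩
  obtain ⟨c', hc'⟩ : ∃ c : ℝ, ∀ x, iteratedDeriv i h x ⬝ᵥ iteratedDeriv (j + 1) g x = c := by
    rcases Nat.lt_or_ge (i + (j + 1)) N with hlt | hge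
    · exact ⟨0, pairing_eq_zero hh hg h0 i (j + 1) hlt⟩
    · exact ⟨_, pairing_eq_pow hh hg h0 h1 i (j + 1) (by omega)⟩
  rw [pairing_succ_left hh hg hc, pairing_succ_left hh hg hc', neg_neg]

lemma iteratedDeriv_smul_vec {l : ℝ → ℝ} {g : ℝ → ι → ℝ} (hl : ContDiff ℝ ∞ l)
    (hg : ContDiff ℝ ∞ g) (j : ℕ) (x : ℝ) (a : ι) :
    iteratedDeriv j (fun y => l y • g y) x a =
      ∑ i ∈ Finset.range (j + 1), j.choose i * iteratedDeriv (j - i) l x * iteratedDeriv i g x a := by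
  rw [iteratedDeriv_pi_apply (f := fun y => l y • g y) (hl.smul hg)]
  have hga : ContDiff ℝ ∞ fun y => g y a := contDiff_pi.mp hg a
  have : (fun y => (l y • g y) a) = fun y => g y a * l y := by
    ext y; simp [mul_comm]
  rw [this, iteratedDeriv_fun_mul (contDiffAt_of_infty hga j x) (contDiffAt_of_infty hl j x)]
  refine Finset.sum_congr rfl fun i _ => ?_
  rw [iteratedDeriv_pi_apply hg]
  ring

lemma smoothO_iteratedDeriv_apply {ε₀ : ℝ} {n : ℕ} {v : ℝ → ℝ → ι → ℝ}
    (hv : ∀ a, SmoothO ε₀ n (fun ε x => v ε x a)) (j : ℕ) (a : ι) :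
    SmoothO ε₀ n (fun ε x => iteratedDeriv j (v ε) x a) := by
  refine ((hv a).iteratedDeriv j).congr fun ε hε x => ?_
  rw [iteratedDeriv_pi_apply (contDiff_pi.mpr fun a => (hv a).1 ε hε)]

end Pairing

/-! ## Wronskian matrices -/

/-- The matrix with columns `G, G', …, G^{(d)}`. -/
def wmat (d : ℕ) (G : ℝ → Fin (d + 1) → ℝ) (x : ℝ) : Matrix (Fin (d + 1)) (Fin (d + 1)) ℝ :=
  Matrix.of fun i j => iteratedDeriv (j : ℕ) G x i

section Wronskian
variable {d : ℕ} {G : ℝ → Fin (d + 1) → ℝ}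

lemma wmat_mulVec (v : Fin (d + 1) → ℝ) (x : ℝ) :
    wmat d G x *ᵥ v = ∑ j : Fin (d + 1), v j • iteratedDeriv (j : ℕ) G x := by
  ext a
  simp [wmat, Matrix.mulVec, dotProduct, mul_comm]

/-- By the Leibniz rule the Wronskian matrix is multiplied on the right by an upper triangular
matrix with diagonal entries `l x`. -/
lemma wronskian_smul {l : ℝ → ℝ} (hl : ContDiff ℝ ∞ l) (hG : ContDiff ℝ ∞ G) (x : ℝ) :
    wronskian d (fun y => l y • G y) x = l x ^ (d + 1) * wronskian d G x := by
  set T : Matrix (Fin (d + 1)) (Fin (d + 1)) ℝ := Matrix.of fun i j =>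
    if (i : ℕ) ≤ j then ((j : ℕ).choose i : ℝ) * iteratedDeriv ((j : ℕ) - i) l x else 0 with hT
  have h1 : wmat d (fun y => l y • G y) x = wmat d G x * T := by
    ext a j
    rw [Matrix.mul_apply]
    change iteratedDeriv (j : ℕ) (fun y => l y • G y) x a = _
    rw [iteratedDeriv_smul_vec hl hG]
    simp only [wmat, hT, Matrix.of_apply, mul_ite, mul_zero]
    rw [Fin.sum_univ_eq_sum_range (fun i => if i ≤ (j : ℕ) then iteratedDeriv i G x a *
      (((j : ℕ).choose i : ℝ) * iteratedDeriv ((j : ℕ) - i) l x) else 0) (d + 1),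
      ← Finset.sum_filter]
    have : (Finset.range (d + 1)).filter (· ≤ (j : ℕ)) = Finset.range ((j : ℕ) + 1) := by
      ext i; simp; omega
    rw [this]
    exact Finset.sum_congr rfl fun i _ => by ring
  have h2 : T.det = l x ^ (d + 1) := by
    rw [Matrix.det_of_isUpperTriangular]
    · simp [hT]
    · intro i j hij
      have : ¬ (i : ℕ) ≤ j := not_le.mpr hij
      simp only [hT, Matrix.of_apply, if_neg this]
  change (wmat d (fun y => l y • G y) x).det = _ * (wmat d G x).det
  rw [h1, Matrix.det_mul, h2, mul_comm]

lemma wmat_equivariant (hG : ContDiff ℝ ∞ G) {T : ℝ} {A : Matrix (Fin (d + 1)) (Fin (d + 1)) ℝ}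
    (h : ∀ x, G (x + T) = A *ᵥ G x) (x : ℝ) : wmat d G (x + T) = A * wmat d G x := by
  ext a j
  change iteratedDeriv (j : ℕ) G (x + T) a = _
  rw [iteratedDeriv_mulVec_of_equivariant hG h]
  rfl

/-- The derivative of a Wronskian is obtained by differentiating its last column. -/
lemma hasDerivAt_wronskian (hG : ContDiff ℝ ∞ G) (x : ℝ) :
    HasDerivAt (wronskian d G)
      ((wmat d G x).updateCol (Fin.last d) (iteratedDeriv (d + 1) G x)).det x := by
  have h1 : ∀ y, wronskian d G y =
      (Matrix.detRowAlternating (R := ℝ) (n := Fin (d + 1))).toMultilinearMap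
        (fun j => iteratedDeriv (j : ℕ) G y) := fun y => by
    rw [wronskian, ← Matrix.det_transpose]
    rfl
  have hc : Continuous (Matrix.detRowAlternating (R := ℝ) (n := Fin (d + 1))).toMultilinearMap :=
    Continuous.matrix_det continuous_id
  let D : ContinuousMultilinearMap ℝ (fun _ : Fin (d + 1) => Fin (d + 1) → ℝ) ℝ :=
    ⟨(Matrix.detRowAlternating (R := ℝ) (n := Fin (d + 1))).toMultilinearMap, hc⟩
  have h2 := (D.hasFDerivAt (fun j : Fin (d + 1) => iteratedDeriv (j : ℕ) G x)).comp_hasDerivAt x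
    (hasDerivAt_pi.mpr fun j : Fin (d + 1) => hasDerivAt_iteratedDeriv hG j x)
  have h3 : wronskian d G = D ∘ fun y => fun j : Fin (d + 1) => iteratedDeriv (j : ℕ) G y :=
    funext h1
  rw [h3]
  refine h2.congr_deriv ?_
  rw [ContinuousMultilinearMap.linearDeriv_apply, Finset.sum_eq_single (Fin.last d)]
  · rw [← Matrix.det_transpose, ← Matrix.updateRow_transpose]
    rfl
  · intro j _ hj
    have hjd : (j : ℕ) < d := Fin.val_lt_last hj
    -- For `j < d`, the derivative of column `j` is a copy of column `j + 1`.
    refine (Matrix.detRowAlternating (R := ℝ) (n := Fin (d + 1))).map_eq_zero_of_eq _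
      (i := j) (j := ⟨j + 1, by omega⟩) ?_ (by intro h; simpa using congrArg Fin.val h)
    rw [Function.update_self, Function.update_of_ne (by intro h; simpa using congrArg Fin.val h)]
  · simp

end Wronskian
end

noncomputable section

/-! ## Divided differences -/

section Coefficients
open Polynomial

lemma coeff_X_sub_C_mul_succ {R : Type*} [CommRing R] (p : R[X]) (a : R) (n : ℕ) :
    ((X - C a) * p).coeff (n + 1) = p.coeff n - a * p.coeff (n + 1) := by
  rw [sub_mul, coeff_sub, coeff_X_mul, coeff_C_mul]

lemma coeff_X_sub_C_mul_zero {R : Type*} [CommRing R] (p : R[X]) (a : R) :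
    ((X - C a) * p).coeff 0 = -(a * p.coeff 0) := by
  rw [sub_mul, coeff_sub, coeff_C_mul, mul_coeff_zero, coeff_X_zero, zero_mul, zero_sub]

/-- Newton's identity `2e₂ = p₁² - p₂`. For nodes with sum zero it leaves `-∑ k_l²`, the source of
the constant of the continuous limit. -/
lemma coeff_prod_X_sub_C_card_sub_two {R ι : Type*} [CommRing R] (k : ι → R)
    (s : Finset ι) (n : ℕ) (hs : s.card = n + 2) :
    2 * (∏ l ∈ s, (X - C (k l))).coeff n = (∑ l ∈ s, k l) ^ 2 - ∑ l ∈ s, k l ^ 2 := by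
  classical
  induction n generalizing s with
  | zero =>
    obtain ⟨a, b, hab, rfl⟩ := Finset.card_eq_two.mp hs
    rw [Finset.prod_pair hab, Finset.sum_pair hab, Finset.sum_pair hab, coeff_X_sub_C_mul_zero,
      coeff_sub, coeff_X_zero, coeff_C_zero]
    ring
  | succ n ih =>
    obtain ⟨a, t, ha, rfl, ht⟩ := Finset.card_eq_succ.mp hs
    have h1 := prod_X_sub_C_coeff_card_pred t k (by omega)
    rw [ht, show n + 2 - 1 = n + 1 by omega] at h1
    rw [Finset.prod_insert ha, Finset.sum_insert ha, Finset.sum_insert ha, coeff_X_sub_C_mul_succ,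
      h1, mul_sub, ih t ht]
    ring

end Coefficients

section Vandermonde
variable {d : ℕ} {k : Fin d → ℝ}

/-- The weights `c i l` with `∑ l, c i l * k l ^ j = δ i j` for `j < d`. -/
def vandermondeWeight (k : Fin d → ℝ) : Matrix (Fin d) (Fin d) ℝ := (Matrix.vandermonde k)⁻¹

lemma isUnit_det_vandermonde (hk : Function.Injective k) : IsUnit (Matrix.vandermonde k).det :=
  isUnit_iff_ne_zero.mpr (Matrix.det_vandermonde_ne_zero_iff.mpr hk)

lemma vandermondeWeight_sum_pow (hk : Function.Injective k) (i j : Fin d) :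
    ∑ l, vandermondeWeight k i l * k l ^ (j : ℕ) = if i = j then 1 else 0 := by
  have h := congrFun (congrFun (Matrix.nonsing_inv_mul _ (isUnit_det_vandermonde hk)) i) j
  rwa [Matrix.mul_apply, Matrix.one_apply] at h

lemma sum_pow_mul_vandermondeWeight (hk : Function.Injective k) (l l' : Fin d) :
    ∑ i : Fin d, k l ^ (i : ℕ) * vandermondeWeight k i l' = if l = l' then 1 else 0 := by
  have h := congrFun (congrFun (Matrix.mul_nonsing_inv _ (isUnit_det_vandermonde hk)) l) l'
  rwa [Matrix.mul_apply, Matrix.one_apply] at h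

/-- Each node is a root of `∏ (X - k_l)`, so `k_l^d` is a combination of lower powers, and the
weights pick out its coefficient of index `i`. -/
lemma vandermondeWeight_sum_pow_top (hk : Function.Injective k) (i : Fin d) :
    ∑ l, vandermondeWeight k i l * k l ^ d =
      -(∏ l, (Polynomial.X - Polynomial.C (k l))).coeff i := by
  set P := ∏ l, (Polynomial.X - Polynomial.C (k l)) with hP
  have hmonic : P.Monic := Polynomial.monic_prod_of_monic _ _ fun l _ => Polynomial.monic_X_sub_C _
  have hdeg : P.natDegree = d := by
    rw [hP, Polynomial.natDegree_prod_of_monic _ _ fun l _ => Polynomial.monic_X_sub_C _]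
    simp
  have hroot : ∀ l, k l ^ d = -∑ j : Fin d, P.coeff j * k l ^ (j : ℕ) := by
    intro l
    have h0 : P.eval (k l) = 0 := by
      rw [hP, Polynomial.eval_prod]
      exact Finset.prod_eq_zero (Finset.mem_univ l) (by simp)
    rw [Polynomial.eval_eq_sum_range, hdeg, Finset.sum_range_succ,
      Finset.sum_range fun j => P.coeff j * k l ^ j] at h0
    have h1 : P.coeff d = 1 := by rw [← hdeg]; exact hmonic
    rw [h1] at h0
    linarith
  simp only [hroot, mul_neg, Finset.sum_neg_distrib, Finset.mul_sum, neg_inj]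
  rw [Finset.sum_comm, Finset.sum_eq_single i]
  · have := vandermondeWeight_sum_pow hk i i
    rw [if_pos rfl] at this
    calc _ = P.coeff i * ∑ l, vandermondeWeight k i l * k l ^ (i : ℕ) := by
          rw [Finset.mul_sum]; exact Finset.sum_congr rfl fun l _ => by ring
      _ = _ := by rw [this, mul_one]
  · intro j _ hj
    have := vandermondeWeight_sum_pow hk i j
    rw [if_neg (Ne.symm hj)] at this
    calc _ = P.coeff j * ∑ l, vandermondeWeight k i l * k l ^ (j : ℕ) := by
          rw [Finset.mul_sum]; exact Finset.sum_congr rfl fun l _ => by ring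
      _ = _ := by rw [this, mul_zero]
  · simp

end Vandermonde

/-! ### Taylor remainders with all their derivatives -/

section Taylor

/-- The `h`-derivative of the remainder of `g` is the remainder of `g'` with one term fewer; the
mean value inequality supplies the extra factor `|h|`. -/
lemma abs_taylor_le {g : ℝ → ℝ} (hg : ContDiff ℝ ∞ g) (N : ℕ) (A : ℝ) :
    ∃ K, 0 ≤ K ∧ ∀ x h : ℝ, |x| + |h| ≤ A →
      |g (x + h) - ∑ j ∈ Finset.range N, h ^ j / j.factorial * iteratedDeriv j g x|
        ≤ K * |h| ^ N := by
  induction N generalizing g with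
  | zero =>
    obtain ⟨K, hK⟩ :=
      (isCompact_Icc (a := -A) (b := A)).exists_bound_of_continuousOn hg.continuous.continuousOn
    refine ⟨max K 0, le_max_right _ _, fun x h hx => ?_⟩
    have := hK (x + h) (abs_le.mp ((abs_add_le x h).trans hx))
    simpa using Or.inl this
  | succ N ih =>
    obtain ⟨K, hK0, hK⟩ := ih (contDiff_deriv hg)
    refine ⟨K, hK0, fun x h hx => ?_⟩
    set F : ℝ → ℝ := fun s => g (x + s) -
      ∑ j ∈ Finset.range (N + 1), s ^ j / j.factorial * iteratedDeriv j g x with hF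
    have hd : ∀ s, HasDerivAt F (deriv g (x + s) -
        ∑ j ∈ Finset.range N, s ^ j / j.factorial * iteratedDeriv j (deriv g) x) s := by
      intro s
      have h1 : HasDerivAt (fun s => g (x + s)) (deriv g (x + s)) s :=
        HasDerivAt.comp_const_add x s ((hg.differentiable (by simp)) _).hasDerivAt
      have h2 : HasDerivAt (fun s : ℝ =>
          ∑ j ∈ Finset.range (N + 1), s ^ j / j.factorial * iteratedDeriv j g x)
          (∑ j ∈ Finset.range (N + 1),
            ((j : ℕ) * s ^ (j - 1)) / j.factorial * iteratedDeriv j g x) s :=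
        HasDerivAt.fun_sum fun j _ => ((hasDerivAt_pow j s).div_const _).mul_const _
      refine (h1.sub h2).congr_deriv ?_
      congr 1
      rw [Finset.sum_range_succ']
      simp only [Nat.cast_zero, zero_mul, zero_div, add_zero, ← iteratedDeriv_succ']
      refine Finset.sum_congr rfl fun j _ => ?_
      rw [Nat.add_sub_cancel, Nat.factorial_succ]
      push_cast
      have : (j.factorial : ℝ) ≠ 0 := by positivity
      field_simp
    have hb : ∀ s ∈ Set.uIcc 0 h, ‖deriv g (x + s) -
        ∑ j ∈ Finset.range N, s ^ j / j.factorial * iteratedDeriv j (deriv g) x‖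
          ≤ K * |h| ^ N := by
      intro s hs
      have hsh : |s| ≤ |h| := by simpa using Set.abs_sub_left_of_mem_uIcc hs
      refine (hK x s (by linarith)).trans ?_
      gcongr
    have := (convex_uIcc (0 : ℝ) h).norm_image_sub_le_of_norm_hasDerivWithin_le
      (fun s _ => (hd s).hasDerivWithinAt) hb Set.left_mem_uIcc Set.right_mem_uIcc
    have hF0 : F 0 = 0 := by
      simp only [hF, add_zero]
      rw [Finset.sum_range_succ']
      simp
    rw [hF0, sub_zero, sub_zero, Real.norm_eq_abs, Real.norm_eq_abs] at this
    calc _ ≤ _ := this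
      _ = _ := by ring

/-- The `x`-derivative of the remainder of `g` is the remainder of `g'` with the same number of
terms, so the pointwise bound applies to every derivative. -/
lemma smoothO_taylor {ε₀ : ℝ} (hε₁ : ε₀ ≤ 1) {g : ℝ → ℝ} (hg : ContDiff ℝ ∞ g) (N : ℕ) (κ : ℝ) :
    SmoothO ε₀ N (fun ε x => g (x + κ * ε) -
      ∑ j ∈ Finset.range N, (κ * ε) ^ j / j.factorial * iteratedDeriv j g x) := by
  rw [smoothO_iff]
  have hs : ∀ g : ℝ → ℝ, ContDiff ℝ ∞ g → ∀ ε : ℝ, ContDiff ℝ ∞ (fun x => g (x + κ * ε) -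
      ∑ j ∈ Finset.range N, (κ * ε) ^ j / j.factorial * iteratedDeriv j g x) := fun g hg ε =>
    (hg.comp (contDiff_id.add contDiff_const)).sub
      (ContDiff.sum fun j _ => contDiff_const.mul (contDiff_iteratedDeriv hg j))
  have h0 : ∀ g : ℝ → ℝ, ContDiff ℝ ∞ g → SmoothOUpTo ε₀ 0 N (fun ε x => g (x + κ * ε) -
      ∑ j ∈ Finset.range N, (κ * ε) ^ j / j.factorial * iteratedDeriv j g x) := by
    intro g hg
    rw [SmoothOUpTo.zero_iff]
    refine ⟨fun ε _ => hs g hg ε, fun A => ?_⟩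
    obtain ⟨K, hK0, hK⟩ := abs_taylor_le hg N (A + |κ|)
    refine ⟨K * |κ| ^ N, fun ε hε x hx => ?_⟩
    have h1 : |κ * ε| = |κ| * ε := by rw [abs_mul, abs_of_pos hε.1]
    have h2 : |κ| * ε ≤ |κ| := mul_le_of_le_one_right (abs_nonneg _) (hε.2.le.trans hε₁)
    refine (hK x (κ * ε) (by linarith)).trans_eq ?_
    rw [h1]
    ring
  intro M
  induction M generalizing g with
  | zero => exact h0 g hg
  | succ M ih =>
    rw [SmoothOUpTo.succ_iff]
    refine ⟨h0 g hg, (ih (contDiff_deriv hg)).congr fun ε _ => ?_⟩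
    ext x
    have h1 : HasDerivAt (fun x => g (x + κ * ε)) (deriv g (x + κ * ε)) x :=
      HasDerivAt.comp_add_const x _ ((hg.differentiable (by simp)) _).hasDerivAt
    have h2 : HasDerivAt (fun x => ∑ j ∈ Finset.range N,
        (κ * ε) ^ j / j.factorial * iteratedDeriv j g x) (∑ j ∈ Finset.range N,
        (κ * ε) ^ j / j.factorial * iteratedDeriv (j + 1) g x) x :=
      HasDerivAt.fun_sum fun j _ => (hasDerivAt_iteratedDeriv hg j x).const_mul _
    rw [(h1.fun_sub h2).deriv]
    simp only [iteratedDeriv_succ']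

end Taylor

section DividedDifference
variable {d : ℕ} {k : Fin d → ℝ}

/-- The rescaled divided differences of `g` at the points `x + k l * ε`. -/
def divDiff {E : Type*} [AddCommGroup E] [Module ℝ E] (k : Fin d → ℝ) (i : Fin d) (g : ℝ → E)
    (ε x : ℝ) : E :=
  ((ε ^ (i : ℕ))⁻¹ * (i : ℕ).factorial) • ∑ l, vandermondeWeight k i l • g (x + k l * ε)

/-- The constant of the continuous limit. -/
def limitConst (k : Fin d → ℝ) : ℝ := (∑ l, k l ^ 2) / (2 * (d * (d - 1)))

/-- By Taylor's formula `g^{(j)}` enters with coefficient `m_j ε^{j-i}`, where `m_j = (i!/j!) ∑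
c_{il} k_l^j` equals `δ_{ij}` for `j < d`. The first correction is `m_d ε^{d-i}`. For `i = d-1` it
vanishes because `∑ k_l = 0`, and `j = d+1` contributes `μ`; for `i = d-2` it is the limit constant.
The value of `μ` never matters, only that it does not depend on `g`. -/
lemma smoothO_divDiff {ε₀ : ℝ} (hε₁ : ε₀ ≤ 1) (hd : 2 ≤ d) (hk : Function.Injective k)
    (hsum : ∑ l, k l = 0) (i : Fin d) :
    ∃ μ : ℝ, ∀ g : ℝ → ℝ, ContDiff ℝ ∞ g →
      SmoothO ε₀ 3 (fun ε x => divDiff k i g ε x - (iteratedDeriv i g x +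
        ε ^ 2 * ((if (i : ℕ) + 2 = d then limitConst k else 0) * iteratedDeriv d g x +
          (if (i : ℕ) + 1 = d then μ else 0) * iteratedDeriv (d + 1) g x))) := by
  set m : ℕ → ℝ := fun j => ((i : ℕ).factorial / j.factorial : ℝ) *
    ∑ l, vandermondeWeight k i l * k l ^ j with hm
  have hm0 : ∀ j < d, m j = if j = i then 1 else 0 := by
    intro j hj
    have := vandermondeWeight_sum_pow hk i ⟨j, hj⟩
    simp only [hm]
    rw [this]
    by_cases h : j = i
    · subst h
      simp [Nat.factorial_ne_zero]
    · have h' : ¬ (i = ⟨j, hj⟩) := fun h' => h (by rw [h'])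
      simp [h, h']
  have hm1 : (i : ℕ) + 1 = d → m d = 0 := by
    intro h
    have h1 := Polynomial.prod_X_sub_C_coeff_card_pred Finset.univ k (by simp; omega)
    rw [Finset.card_fin, show d - 1 = i by omega, hsum, neg_zero] at h1
    simp only [hm]
    rw [vandermondeWeight_sum_pow_top hk, h1, neg_zero, mul_zero]
  have hm2 : (i : ℕ) + 2 = d → m d = limitConst k := by
    intro h
    have h1 := coeff_prod_X_sub_C_card_sub_two k Finset.univ i (by simp [h])
    rw [hsum] at h1
    have h2 : (d.factorial : ℝ) = d * (d - 1) * (i : ℕ).factorial := by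
      conv_lhs => rw [← h]
      rw [show (i : ℕ) + 2 = (i + 1) + 1 from rfl, Nat.factorial_succ, Nat.factorial_succ]
      have : (d : ℝ) = i + 2 := by exact_mod_cast h.symm
      rw [this]
      push_cast
      ring
    have h3 : ((i : ℕ).factorial : ℝ) ≠ 0 := by positivity
    have h4 : (d : ℝ) ≠ 0 := by positivity
    have h5 : (d : ℝ) - 1 ≠ 0 := by
      have : (2 : ℝ) ≤ d := by exact_mod_cast hd
      intro h; linarith
    simp only [hm, limitConst]
    rw [vandermondeWeight_sum_pow_top hk, h2]
    field_simp
    linarith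
  refine ⟨m (d + 1), fun g hg => ?_⟩
  -- the Taylor remainder
  have hR : SmoothO ε₀ 3 (fun ε x => (ε ^ (i : ℕ))⁻¹ * ∑ l,
      ((i : ℕ).factorial * vandermondeWeight k i l) * (g (x + k l * ε) -
        ∑ j ∈ Finset.range (d + 3), (k l * ε) ^ j / j.factorial * iteratedDeriv j g x)) := by
    refine SmoothO.inv_pow_mul (SmoothO.sum _ fun l _ => SmoothO.const_mul _ ?_)
    -- A remainder of order `d + 3` is still `O(ε³)` after division by `ε^i`, as `i < d`.
    exact (smoothO_taylor hε₁ hg (d + 3) (k l)).weaken hε₁ (by omega)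
  have hmono : ∀ (j e : ℕ), 3 ≤ e → SmoothO ε₀ 3 (fun ε x => m j * ε ^ e * iteratedDeriv j g x) :=
    fun j e he => ((SmoothO.pow_eps e).const_mul (m j) |>.weaken hε₁ he).mul
      (SmoothO.of_contDiff (contDiff_iteratedDeriv hg j))
  -- The Taylor terms with `j = d, d+1, d+2` that are negligible; the conditions on `i` say that the
  -- exponent `j - i` is at least `3`.
  have hT : SmoothO ε₀ 3 (fun ε x =>
      (if (i : ℕ) + 3 ≤ d then m d * ε ^ (d - i) * iteratedDeriv d g x else 0) +
      (if (i : ℕ) + 2 ≤ d then m (d + 1) * ε ^ (d + 1 - i) * iteratedDeriv (d + 1) g x else 0) +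
      m (d + 2) * ε ^ (d + 2 - i) * iteratedDeriv (d + 2) g x) := by
    refine .add (.add ?_ ?_) (hmono _ _ (by omega))
    · split_ifs with h
      · exact hmono _ _ (by omega)
      · exact .zero
    · split_ifs with h
      · exact hmono _ _ (by omega)
      · exact .zero
  refine (hR.add hT).congr fun ε hε x => ?_
  have hε0 : ε ≠ 0 := hε.1.ne'
  have hsplit : divDiff k i g ε x = (ε ^ (i : ℕ))⁻¹ * ∑ l,
      ((i : ℕ).factorial * vandermondeWeight k i l) * (g (x + k l * ε) -
        ∑ j ∈ Finset.range (d + 3), (k l * ε) ^ j / j.factorial * iteratedDeriv j g x)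
      + ∑ j ∈ Finset.range (d + 3), (ε ^ (i : ℕ))⁻¹ * ε ^ j * m j * iteratedDeriv j g x := by
    have e1 : ∑ j ∈ Finset.range (d + 3), (ε ^ (i : ℕ))⁻¹ * ε ^ j * m j * iteratedDeriv j g x =
        (ε ^ (i : ℕ))⁻¹ * ∑ l, ((i : ℕ).factorial * vandermondeWeight k i l) *
          ∑ j ∈ Finset.range (d + 3), (k l * ε) ^ j / j.factorial * iteratedDeriv j g x := by
      simp only [Finset.mul_sum, hm, Finset.sum_mul]
      rw [Finset.sum_comm]
      refine Finset.sum_congr rfl fun l _ => Finset.sum_congr rfl fun j _ => ?_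
      rw [mul_pow]
      ring
    rw [e1, ← mul_add, ← Finset.sum_add_distrib, divDiff, smul_eq_mul, mul_assoc, Finset.mul_sum]
    congr 1
    refine Finset.sum_congr rfl fun l _ => ?_
    rw [smul_eq_mul]
    ring
  have hlow : ∑ j ∈ Finset.range d, (ε ^ (i : ℕ))⁻¹ * ε ^ j * m j * iteratedDeriv j g x =
      iteratedDeriv i g x := by
    rw [Finset.sum_eq_single (i : ℕ)]
    · rw [hm0 i i.2, if_pos rfl, inv_mul_cancel₀ (pow_ne_zero _ hε0)]
      ring
    · intro j hj hji
      rw [hm0 j (Finset.mem_range.mp hj), if_neg hji]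
      ring
    · intro h; exact absurd (Finset.mem_range.mpr i.2) h
  have hpow : ∀ j, (i : ℕ) ≤ j → (ε ^ (i : ℕ))⁻¹ * ε ^ j = ε ^ (j - i) := by
    intro j hj
    rw [pow_sub₀ ε hε0 hj, mul_comm]
  rw [hsplit, Finset.sum_range_succ, Finset.sum_range_succ, Finset.sum_range_succ, hlow,
    hpow d i.2.le, hpow (d + 1) (by omega), hpow (d + 2) (by omega)]
  obtain h | h | h : (i : ℕ) + 1 = d ∨ (i : ℕ) + 2 = d ∨ (i : ℕ) + 3 ≤ d := by omega
  · rw [if_neg (by omega), if_neg (by omega), if_neg (by omega), if_pos h, hm1 h,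
      show d + 1 - i = 2 by omega]
    ring
  · rw [if_neg (by omega), if_pos h.le, if_pos h, if_neg (by omega), hm2 h,
      show d - i = 2 by omega]
    ring
  · rw [if_pos h, if_pos (by omega), if_neg (by omega), if_neg (by omega)]
    ring

end DividedDifference
end

noncomputable section

/-! ## The dual curve -/

section Curve
variable {d : ℕ} {u : ℕ → ℝ → ℝ} {G : ℝ → Fin (d + 1) → ℝ}

lemma IsCurve.contDiff (hG : IsCurve d u G) : ContDiff ℝ ∞ G := hG.1

lemma IsCurve.det_wmat (hG : IsCurve d u G) (x : ℝ) : (wmat d G x).det = 1 := hG.2.1 x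

lemma IsCurve.contDiff_apply (hG : IsCurve d u G) (a : Fin (d + 1)) :
    ContDiff ℝ ∞ fun x => G x a := contDiff_pi.mp hG.contDiff a

lemma IsCurve.iteratedDeriv_top (hG : IsCurve d u G) (x : ℝ) :
    iteratedDeriv (d + 1) G x = -∑ j ∈ Finset.range d, u j x • iteratedDeriv j G x :=
  eq_neg_of_add_eq_zero_left (hG.2.2.2.2 x)

/-- The covector dual to `G^{(d)}` in the frame `G, G', …, G^{(d)}`. -/
def dualCurve (d : ℕ) (G : ℝ → Fin (d + 1) → ℝ) (x : ℝ) : Fin (d + 1) → ℝ :=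
  (wmat d G x)⁻¹ (Fin.last d)

lemma smoothO_wmat {ε₀ : ℝ} {v : ℝ → ℝ → Fin (d + 1) → ℝ} {n : ℕ}
    (hv : ∀ a, SmoothO ε₀ n (fun ε x => v ε x a)) (i j : Fin (d + 1)) :
    SmoothO ε₀ n (fun ε x => wmat d (v ε) x i j) :=
  smoothO_iteratedDeriv_apply hv j i

lemma SmoothO.of_contDiff_vec {ι : Type*} [Fintype ι] {ε₀ : ℝ} {f : ℝ → ι → ℝ}
    (hf : ContDiff ℝ ∞ f) (a : ι) : SmoothO ε₀ 0 (fun _ x => f x a) :=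
  SmoothO.of_contDiff (contDiff_pi.mp hf a)

lemma IsCurve.contDiff_dualCurve (hG : IsCurve d u G) : ContDiff ℝ ∞ (dualCurve d G) := by
  rw [contDiff_pi]
  intro a
  -- Smoothness of the inverse matrix is read off from a family that does not depend on `ε`, at the
  -- parameter `1/2`.
  refine (SmoothO.inv (ε₀ := 1) (A := fun _ x => wmat d G x)
    (smoothO_wmat (v := fun _ => G) (SmoothO.of_contDiff_vec hG.contDiff))
    (fun ε _ x => ?_) (Fin.last d) a).1 (1 / 2) (by norm_num)
  rw [hG.det_wmat]
  norm_num

lemma inv_mulVec_wmat {v : ℝ → Fin (d + 1) → ℝ} {x : ℝ} (h : IsUnit (wmat d v x).det)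
    (j : Fin (d + 1)) :
    (wmat d v x)⁻¹ *ᵥ iteratedDeriv (j : ℕ) v x = Pi.single j 1 := by
  have h1 : iteratedDeriv (j : ℕ) v x = wmat d v x *ᵥ Pi.single j 1 := by
    rw [Matrix.mulVec_single_one]
    rfl
  rw [h1, Matrix.mulVec_mulVec, Matrix.nonsing_inv_mul _ h, Matrix.one_mulVec]

lemma IsCurve.inv_mulVec (hG : IsCurve d u G) (x : ℝ) (j : Fin (d + 1)) :
    (wmat d G x)⁻¹ *ᵥ iteratedDeriv (j : ℕ) G x = Pi.single j 1 :=
  inv_mulVec_wmat (by rw [hG.det_wmat]; exact isUnit_one) j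

lemma IsCurve.dualCurve_pairing (hG : IsCurve d u G) {j : ℕ} (hj : j < d) (x : ℝ) :
    dualCurve d G x ⬝ᵥ iteratedDeriv j G x = 0 := by
  have h := congrFun (hG.inv_mulVec x ⟨j, by omega⟩) (Fin.last d)
  rw [Pi.single_eq_of_ne (by intro h; have := congrArg Fin.val h; simp at this; omega)] at h
  exact h

lemma IsCurve.dualCurve_pairing_top (hG : IsCurve d u G) (x : ℝ) :
    dualCurve d G x ⬝ᵥ iteratedDeriv d G x = 1 := by
  have h := congrFun (hG.inv_mulVec x (Fin.last d)) (Fin.last d)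
  rw [Pi.single_eq_same] at h
  exact h

/-- `L` has no term `∂^d`, so `G^{(d+1)}` lies in the span of `G, …, G^{(d-1)}`, which `H`
annihilates. -/
lemma IsCurve.dualCurve_pairing_succ (hG : IsCurve d u G) (x : ℝ) :
    dualCurve d G x ⬝ᵥ iteratedDeriv (d + 1) G x = 0 := by
  rw [hG.iteratedDeriv_top, dotProduct_neg, dotProduct_sum, neg_eq_zero]
  refine Finset.sum_eq_zero fun j hj => ?_
  rw [dotProduct_smul, hG.dualCurve_pairing (Finset.mem_range.mp hj), smul_zero]

/-- The rows `(-1)^{d-i} h^{(d-i)}`. -/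
def rowMat (d : ℕ) (h : ℝ → Fin (d + 1) → ℝ) (x : ℝ) : Matrix (Fin (d + 1)) (Fin (d + 1)) ℝ :=
  Matrix.of fun i a => (-1) ^ (d - (i : ℕ)) * iteratedDeriv (d - (i : ℕ)) h x a

lemma rowMat_mulVec (h : ℝ → Fin (d + 1) → ℝ) (x : ℝ) (v : Fin (d + 1) → ℝ) (i : Fin (d + 1)) :
    (rowMat d h x *ᵥ v) i = (-1) ^ (d - (i : ℕ)) * (iteratedDeriv (d - (i : ℕ)) h x ⬝ᵥ v) := by
  simp only [rowMat, Matrix.mulVec, dotProduct, Matrix.of_apply, Finset.mul_sum, mul_assoc]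

lemma smoothO_rowMat {ε₀ : ℝ} {v : ℝ → ℝ → Fin (d + 1) → ℝ} {n : ℕ}
    (hv : ∀ a, SmoothO ε₀ n (fun ε x => v ε x a)) (i j : Fin (d + 1)) :
    SmoothO ε₀ n (fun ε x => rowMat d (v ε) x i j) :=
  (smoothO_iteratedDeriv_apply hv (d - i) j).const_mul _

/-- The product with the Wronskian matrix of `G` is upper triangular. Its diagonal is `1` because
`H^{(d-i)}·G^{(i)} = (-1)^{d-i}`, the sign built into the rows. -/
lemma IsCurve.det_rowMat_dualCurve (hG : IsCurve d u G) (x : ℝ) :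
    (rowMat d (dualCurve d G) x).det = 1 := by
  have hH := hG.contDiff_dualCurve
  have h1 : (rowMat d (dualCurve d G) x * wmat d G x).det = 1 := by
    have hent : ∀ i j, (rowMat d (dualCurve d G) x * wmat d G x) i j =
        (-1) ^ (d - (i : ℕ)) * (iteratedDeriv (d - (i : ℕ)) (dualCurve d G) x ⬝ᵥ
          iteratedDeriv (j : ℕ) G x) := fun i j =>
      rowMat_mulVec (dualCurve d G) x (iteratedDeriv (j : ℕ) G x) i
    rw [Matrix.det_of_isUpperTriangular]
    · refine Finset.prod_eq_one fun i _ => ?_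
      rw [hent, pairing_eq_pow hH hG.contDiff (fun j hj x => hG.dualCurve_pairing hj x)
        hG.dualCurve_pairing_top _ _ (by omega), ← mul_pow]
      norm_num
    · intro i j hij
      have hij' : (j : ℕ) < i := hij
      rw [hent, pairing_eq_zero hH hG.contDiff (fun j hj x => hG.dualCurve_pairing hj x) _ _
        (by omega), mul_zero]
  rwa [Matrix.det_mul, hG.det_wmat, mul_one] at h1

lemma rowMat_equivariant {h : ℝ → Fin (d + 1) → ℝ} (hh : ContDiff ℝ ∞ h) {T : ℝ}
    {A : Matrix (Fin (d + 1)) (Fin (d + 1)) ℝ} (hA : ∀ x, h (x + T) = h x ᵥ* A) (x : ℝ) :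
    rowMat d h (x + T) = rowMat d h x * A := by
  have h2 : ∀ x, h (x + T) = Aᵀ *ᵥ h x := fun x => by rw [hA, Matrix.mulVec_transpose]
  ext i a
  change _ * iteratedDeriv (d - (i : ℕ)) h (x + T) a = _
  rw [iteratedDeriv_mulVec_of_equivariant hh h2, Matrix.mulVec_transpose, Matrix.mul_apply]
  simp only [rowMat, Matrix.vecMul, dotProduct, Matrix.of_apply, Finset.mul_sum, mul_assoc]

lemma IsCurve.dualCurve_equivariant (hG : IsCurve d u G)
    {M : Matrix (Fin (d + 1)) (Fin (d + 1)) ℝ} {T : ℝ}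
    (h : ∀ x, G (x + T) = M *ᵥ G x) (x : ℝ) :
    dualCurve d G (x + T) = dualCurve d G x ᵥ* M⁻¹ := by
  rw [dualCurve, wmat_equivariant hG.contDiff h, Matrix.mul_inv_rev]
  rfl

end Curve

/-! ## The approximate normal covector and the approximate lift -/

section Approx
variable {d : ℕ} {u : ℕ → ℝ → ℝ} {G : ℝ → Fin (d + 1) → ℝ}

/-- The normal covector of the hyperplanes up to terms of order `ε ^ 3`. -/
def approxNormal (d : ℕ) (G : ℝ → Fin (d + 1) → ℝ) (C ε x : ℝ) : Fin (d + 1) → ℝ :=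
  dualCurve d G x - (ε ^ 2 * C) • iteratedDeriv 2 (dualCurve d G) x

/-- The lift of the envelope up to terms of order `ε ^ 3`. -/
def approxLift (d : ℕ) (u : ℕ → ℝ → ℝ) (G : ℝ → Fin (d + 1) → ℝ) (C ε x : ℝ) : Fin (d + 1) → ℝ :=
  G x + ε ^ 2 • C • opQ d u G x

lemma IsCurve.contDiff_opQ (hd : 2 ≤ d) (hG : IsCurve d u G) : ContDiff ℝ ∞ (opQ d u G) := by
  have h : ContDiff ℝ ∞ (fun x => 2 / ((d : ℝ) + 1) * u (d - 1) x) :=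
    contDiff_const.mul (hG.2.2.2.1 (d - 1) (by omega)).1
  exact (contDiff_iteratedDeriv hG.contDiff 2).add (h.smul hG.contDiff)

lemma smoothO_sq {ε₀ : ℝ} (hε₁ : ε₀ ≤ 1) : SmoothO ε₀ 0 (fun ε _ => ε ^ 2) :=
  (SmoothO.pow_eps 2).weaken hε₁ (by norm_num)

lemma IsCurve.smoothO_approxNormal_sub (hG : IsCurve d u G) {ε₀ : ℝ} (C : ℝ) (a : Fin (d + 1)) :
    SmoothO ε₀ 2 (fun ε x => approxNormal d G C ε x a - dualCurve d G x a) := by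
  have h := (SmoothO.pow_eps (ε₀ := ε₀) 2).mul ((SmoothO.of_contDiff_vec (ε₀ := ε₀)
    (contDiff_iteratedDeriv hG.contDiff_dualCurve 2) a).const_mul (-C))
  refine h.congr fun ε _ x => ?_
  simp [approxNormal]
  ring

lemma IsCurve.smoothO_approxNormal (hG : IsCurve d u G) {ε₀ : ℝ} (hε₁ : ε₀ ≤ 1) (C : ℝ)
    (a : Fin (d + 1)) : SmoothO ε₀ 0 (fun ε x => approxNormal d G C ε x a) := by
  refine (((hG.smoothO_approxNormal_sub C a).weaken hε₁ (Nat.zero_le _)).add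
    (SmoothO.of_contDiff_vec hG.contDiff_dualCurve a)).congr fun ε _ x => ?_
  simp

lemma IsCurve.smoothO_approxLift_sub (hd : 2 ≤ d) (hG : IsCurve d u G) {ε₀ : ℝ} (C : ℝ)
    (a : Fin (d + 1)) : SmoothO ε₀ 2 (fun ε x => approxLift d u G C ε x a - G x a) := by
  have h := (SmoothO.pow_eps (ε₀ := ε₀) 2).mul ((SmoothO.of_contDiff_vec (ε₀ := ε₀)
    (hG.contDiff_opQ hd) a).const_mul C)
  refine h.congr fun ε _ x => ?_
  simp [approxLift]

lemma IsCurve.smoothO_approxLift (hd : 2 ≤ d) (hG : IsCurve d u G) {ε₀ : ℝ} (hε₁ : ε₀ ≤ 1) (C : ℝ)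
    (a : Fin (d + 1)) : SmoothO ε₀ 0 (fun ε x => approxLift d u G C ε x a) := by
  refine (((hG.smoothO_approxLift_sub hd C a).weaken hε₁ (Nat.zero_le _)).add
    (SmoothO.of_contDiff_vec hG.contDiff a)).congr fun ε _ x => ?_
  simp

/-- `H^{(i)}` pairs with `Q₂ G` as `H^{(i+2)}` does with `G`. -/
lemma IsCurve.pairing_opQ (hG : IsCurve d u G) {i : ℕ} (hi : i < d) (x : ℝ) :
    iteratedDeriv i (dualCurve d G) x ⬝ᵥ opQ d u G x =
      iteratedDeriv (i + 2) (dualCurve d G) x ⬝ᵥ G x := by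
  have h0 : ∀ j < d, ∀ x, dualCurve d G x ⬝ᵥ iteratedDeriv j G x = 0 :=
    fun j hj x => hG.dualCurve_pairing hj x
  have h1 := pairing_shift_two hG.contDiff_dualCurve hG.contDiff h0 hG.dualCurve_pairing_top
    (i := i) (j := 0) (by omega) x
  -- The potential of `Q₂` drops out because `H^{(i)}·G = 0`.
  have h2 := pairing_eq_zero hG.contDiff_dualCurve hG.contDiff h0 i 0 (by omega) x
  rw [iteratedDeriv_zero] at h1 h2
  rw [h1, opQ, dotProduct_add, dotProduct_smul, h2, smul_zero, add_zero, zero_add]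

/-- The approximate normal annihilates the approximate lift to third order. -/
lemma IsCurve.smoothO_approxNormal_approxLift (hd : 2 ≤ d) (hG : IsCurve d u G) {ε₀ : ℝ}
    (hε₁ : ε₀ ≤ 1) (C : ℝ) {i : ℕ} (hi : i < d) :
    SmoothO ε₀ 3 (fun ε x =>
      iteratedDeriv i (approxNormal d G C ε) x ⬝ᵥ approxLift d u G C ε x) := by
  have hH := hG.contDiff_dualCurve
  -- The terms in `ε²` cancel exactly by `IsCurve.pairing_opQ`; this is all that remains.
  have h : SmoothO ε₀ 3 (fun ε x => ε ^ 4 * (-(C ^ 2) *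
      (iteratedDeriv (i + 2) (dualCurve d G) x ⬝ᵥ opQ d u G x))) := by
    refine ((SmoothO.pow_eps 4).weaken hε₁ (by norm_num)).mul (SmoothO.const_mul _ ?_)
    exact SmoothO.dotProduct (SmoothO.of_contDiff_vec (contDiff_iteratedDeriv hH _))
      (SmoothO.of_contDiff_vec (hG.contDiff_opQ hd))
  refine h.congr fun ε _ x => ?_
  have hder : iteratedDeriv i (approxNormal d G C ε) x = iteratedDeriv i (dualCurve d G) x -
      (ε ^ 2 * C) • iteratedDeriv (i + 2) (dualCurve d G) x := by
    have : approxNormal d G C ε = fun x => dualCurve d G x -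
      (ε ^ 2 * C) • iteratedDeriv 2 (dualCurve d G) x := rfl
    have hs : ContDiff ℝ ∞ fun x => (ε ^ 2 * C) • iteratedDeriv 2 (dualCurve d G) x :=
      (contDiff_const (c := ε ^ 2 * C)).smul (contDiff_iteratedDeriv hH 2)
    rw [this, iteratedDeriv_fun_sub (contDiffAt_of_infty hH i x) (contDiffAt_of_infty hs i x),
      iteratedDeriv_fun_const_smul_field, iteratedDeriv_iteratedDeriv]
  have h2 := pairing_eq_zero hH hG.contDiff (fun j hj x => hG.dualCurve_pairing hj x) i 0
    (by omega) x
  rw [iteratedDeriv_zero] at h2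
  rw [hder, approxLift]
  simp only [sub_dotProduct, dotProduct_add, smul_dotProduct, dotProduct_smul, smul_eq_mul,
    hG.pairing_opQ hi, h2]
  ring

end Approx
end

noncomputable section

/-! ## The normal covector of the hyperplanes -/

section Normal
variable {d : ℕ} {k : Fin d → ℝ} {u : ℕ → ℝ → ℝ} {G : ℝ → Fin (d + 1) → ℝ}

lemma divDiff_apply {ι : Type*} (i : Fin d) (g : ℝ → ι → ℝ) (ε x : ℝ) (a : ι) :
    divDiff k i g ε x a = divDiff k i (fun y => g y a) ε x := by
  simp [divDiff, Finset.sum_apply]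

/-- The values of `g` recovered from its divided differences. -/
lemma sum_divDiff (hk : Function.Injective k) {E : Type*} [AddCommGroup E] [Module ℝ E]
    (g : ℝ → E) {ε : ℝ} (hε : ε ≠ 0) (x : ℝ) (l : Fin d) :
    g (x + k l * ε) = ∑ i : Fin d, (k l ^ (i : ℕ) * (ε ^ (i : ℕ) / (i : ℕ).factorial)) •
      divDiff k i g ε x := by
  have h : ∀ i : Fin d, (k l ^ (i : ℕ) * (ε ^ (i : ℕ) / (i : ℕ).factorial)) • divDiff k i g ε x =
      ∑ l', (k l ^ (i : ℕ) * vandermondeWeight k i l') • g (x + k l' * ε) := by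
    intro i
    rw [divDiff, smul_smul, Finset.smul_sum]
    refine Finset.sum_congr rfl fun l' _ => ?_
    rw [smul_smul]
    congr 1
    have h1 : ((i : ℕ).factorial : ℝ) ≠ 0 := by positivity
    have h2 : ε ^ (i : ℕ) ≠ 0 := pow_ne_zero _ hε
    field_simp
  simp only [h]
  rw [Finset.sum_comm]
  simp only [← Finset.sum_smul, sum_pow_mul_vandermondeWeight hk, ite_smul, one_smul, zero_smul,
    Finset.sum_ite_eq, Finset.mem_univ, if_true]

/-- The frame of the divided differences completed by `G^{(d)}`. -/
def frameMat (k : Fin d → ℝ) (G : ℝ → Fin (d + 1) → ℝ) (ε x : ℝ) :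
    Matrix (Fin (d + 1)) (Fin (d + 1)) ℝ :=
  Matrix.of fun a j => if h : (j : ℕ) < d then divDiff k ⟨j, h⟩ G ε x a else iteratedDeriv d G x a

lemma smoothO_frameMat_sub (hd : 2 ≤ d) (hk : Function.Injective k) (hsum : ∑ l, k l = 0)
    (hG : IsCurve d u G) {ε₀ : ℝ} (hε₁ : ε₀ ≤ 1) (a j : Fin (d + 1)) :
    SmoothO ε₀ 2 (fun ε x => frameMat k G ε x a j - wmat d G x a j) := by
  by_cases h : (j : ℕ) < d
  · obtain ⟨μ, hμ⟩ := smoothO_divDiff hε₁ hd hk hsum ⟨j, h⟩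
    have hg := hG.contDiff_apply a
    have h1 := (hμ _ hg).weaken hε₁ (show 2 ≤ 3 by norm_num)
    have h2 := (SmoothO.pow_eps (ε₀ := ε₀) 2).mul
      (((SmoothO.of_contDiff (contDiff_iteratedDeriv hg d)).const_mul
        (if (j : ℕ) + 2 = d then limitConst k else 0)).add
      ((SmoothO.of_contDiff (contDiff_iteratedDeriv hg (d + 1))).const_mul
        (if (j : ℕ) + 1 = d then μ else 0)))
    refine (h1.add h2).congr fun ε _ x => ?_
    simp only [frameMat, wmat, Matrix.of_apply, dif_pos h, divDiff_apply,
      iteratedDeriv_pi_apply hG.contDiff]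
    ring
  · refine SmoothO.zero.congr fun ε _ x => ?_
    obtain rfl : j = Fin.last d := Fin.ext (by simp; omega)
    simp [frameMat, wmat]

lemma SmoothO.of_sub {ε₀ : ℝ} (hε₁ : ε₀ ≤ 1) {n : ℕ} {f g : ℝ → ℝ → ℝ}
    (h : SmoothO ε₀ n (fun ε x => f ε x - g ε x)) (hg : SmoothO ε₀ 0 g) : SmoothO ε₀ 0 f :=
  ((h.weaken hε₁ (Nat.zero_le _)).add hg).congr fun _ _ _ => sub_add_cancel _ _

lemma smoothO_frameMat (hd : 2 ≤ d) (hk : Function.Injective k) (hsum : ∑ l, k l = 0)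
    (hG : IsCurve d u G) {ε₀ : ℝ} (hε₁ : ε₀ ≤ 1) (a j : Fin (d + 1)) :
    SmoothO ε₀ 0 (fun ε x => frameMat k G ε x a j) :=
  (smoothO_frameMat_sub hd hk hsum hG hε₁ a j).of_sub hε₁
    (smoothO_wmat (SmoothO.of_contDiff_vec hG.contDiff) a j)

lemma frameMat_equivariant (hG : IsCurve d u G) {T : ℝ}
    {M : Matrix (Fin (d + 1)) (Fin (d + 1)) ℝ} (h : ∀ x, G (x + T) = M *ᵥ G x) (ε x : ℝ) :
    frameMat k G ε (x + T) = M * frameMat k G ε x := by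
  ext a j
  by_cases hj : (j : ℕ) < d
  · have h1 : divDiff k ⟨j, hj⟩ G ε (x + T) = M *ᵥ divDiff k ⟨j, hj⟩ G ε x := by
      simp only [divDiff, Matrix.mulVec_smul, Matrix.mulVec_sum, add_right_comm x T, h]
    simp only [Matrix.mul_apply, frameMat, Matrix.of_apply, dif_pos hj, h1]
    rfl
  · simp only [Matrix.mul_apply, frameMat, Matrix.of_apply, dif_neg hj,
      iteratedDeriv_mulVec_of_equivariant hG.contDiff h]
    rfl

/-- At `i = d-2` the correction `ε² C G^{(d)}` pairs with `H` to `ε² C`, and `-ε² C H''` pairs with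
`G^{(d-2)}` to `-ε² C`. At `i = d-1` the correction is a multiple of `G^{(d+1)}`, which `H`
annihilates, and `H''·G^{(d-1)} = H·G^{(d+1)} = 0`. -/
lemma smoothO_approxNormal_divDiff (hd : 2 ≤ d) (hk : Function.Injective k)
    (hsum : ∑ l, k l = 0) (hG : IsCurve d u G) {ε₀ : ℝ} (hε₁ : ε₀ ≤ 1) (i : Fin d) :
    SmoothO ε₀ 3 (fun ε x => approxNormal d G (limitConst k) ε x ⬝ᵥ divDiff k i G ε x) := by
  obtain ⟨μ, hμ⟩ := smoothO_divDiff hε₁ hd hk hsum i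
  set C := limitConst k with hC
  set α : ℝ := if (i : ℕ) + 2 = d then C else 0 with hα
  set β : ℝ := if (i : ℕ) + 1 = d then μ else 0 with hβ
  have hH := hG.contDiff_dualCurve
  have h1 : SmoothO ε₀ 3 (fun ε x => (fun a => divDiff k i G ε x a - (iteratedDeriv i G x a +
      ε ^ 2 * (α * iteratedDeriv d G x a + β * iteratedDeriv (d + 1) G x a))) ⬝ᵥ
        approxNormal d G C ε x) := by
    refine SmoothO.dotProduct (fun a => ?_) (hG.smoothO_approxNormal hε₁ C)
    refine (hμ _ (hG.contDiff_apply a)).congr fun ε _ x => ?_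
    simp only [divDiff_apply, iteratedDeriv_pi_apply hG.contDiff]
  have h2 : SmoothO ε₀ 3 (fun ε x => ε ^ 4 * (-C * (iteratedDeriv 2 (dualCurve d G) x ⬝ᵥ
      (α • iteratedDeriv d G x + β • iteratedDeriv (d + 1) G x)))) := by
    refine ((SmoothO.pow_eps 4).weaken hε₁ (by norm_num)).mul (SmoothO.const_mul _ ?_)
    exact SmoothO.dotProduct (SmoothO.of_contDiff_vec (contDiff_iteratedDeriv hH _))
      (SmoothO.of_contDiff_vec (((contDiff_const (c := α)).smul (contDiff_iteratedDeriv hG.contDiff d)).add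
        ((contDiff_const (c := β)).smul (contDiff_iteratedDeriv hG.contDiff (d + 1)))))
  refine (h1.add h2).congr fun ε _ x => ?_
  have e1 : (fun a => divDiff k i G ε x a - (iteratedDeriv i G x a +
      ε ^ 2 * (α * iteratedDeriv d G x a + β * iteratedDeriv (d + 1) G x a))) =
      divDiff k i G ε x - (iteratedDeriv i G x +
        ε ^ 2 • (α • iteratedDeriv d G x + β • iteratedDeriv (d + 1) G x)) := rfl
  have e2 : iteratedDeriv 2 (dualCurve d G) x ⬝ᵥ iteratedDeriv i G x =
      if (i : ℕ) + 2 = d then 1 else 0 := by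
    have := pairing_shift_two hH hG.contDiff (fun j hj x => hG.dualCurve_pairing hj x)
      hG.dualCurve_pairing_top (i := 0) (j := i) (by omega) x
    rw [iteratedDeriv_zero, zero_add] at this
    rw [this]
    obtain h | h | h : (i : ℕ) + 2 < d ∨ (i : ℕ) + 2 = d ∨ (i : ℕ) + 2 = d + 1 := by omega
    · rw [hG.dualCurve_pairing h, if_neg (by omega)]
    · rw [h, hG.dualCurve_pairing_top, if_pos rfl]
    · rw [h, hG.dualCurve_pairing_succ, if_neg (by omega)]
  have e3 : C * (if (i : ℕ) + 2 = d then 1 else 0) = α := by simp [hα]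
  rw [e1, dotProduct_comm, dotProduct_sub]
  have e4 : approxNormal d G C ε x ⬝ᵥ (iteratedDeriv i G x +
      ε ^ 2 • (α • iteratedDeriv d G x + β • iteratedDeriv (d + 1) G x)) =
      ε ^ 4 * (-C * (iteratedDeriv 2 (dualCurve d G) x ⬝ᵥ
      (α • iteratedDeriv d G x + β • iteratedDeriv (d + 1) G x))) := by
    simp only [approxNormal, sub_dotProduct, dotProduct_add, smul_dotProduct, dotProduct_smul,
      smul_eq_mul, e2, hG.dualCurve_pairing i.2, hG.dualCurve_pairing_top,
      hG.dualCurve_pairing_succ]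
    rw [mul_assoc (ε ^ 2) C, e3]
    ring
  rw [e4]
  ring

lemma approxNormal_equivariant (hG : IsCurve d u G) {T : ℝ}
    {M : Matrix (Fin (d + 1)) (Fin (d + 1)) ℝ} (h : ∀ x, G (x + T) = M *ᵥ G x) (C ε x : ℝ) :
    approxNormal d G C ε (x + T) = approxNormal d G C ε x ᵥ* M⁻¹ := by
  have h2 : ∀ x, dualCurve d G (x + T) = (M⁻¹)ᵀ *ᵥ dualCurve d G x := fun x => by
    rw [hG.dualCurve_equivariant h, Matrix.mulVec_transpose]
  rw [approxNormal, iteratedDeriv_mulVec_of_equivariant hG.contDiff_dualCurve h2, h2,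
    ← Matrix.mulVec_smul, ← Matrix.mulVec_sub, Matrix.mulVec_transpose]
  rfl

lemma vecMul_dotProduct_mulVec_of_inv {M : Matrix (Fin (d + 1)) (Fin (d + 1)) ℝ}
    (hM : M.det = 1) (v w : Fin (d + 1) → ℝ) : (v ᵥ* M⁻¹) ⬝ᵥ (M *ᵥ w) = v ⬝ᵥ w := by
  rw [Matrix.dotProduct_mulVec, Matrix.vecMul_vecMul,
    Matrix.nonsing_inv_mul _ (by rw [hM]; exact isUnit_one), Matrix.vecMul_one]

lemma isUnit_of_mem_Icc {r : ℝ} (h : r ∈ Set.Icc (1 / 2 : ℝ) 2) : IsUnit r :=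
  isUnit_iff_ne_zero.mpr (by rintro rfl; norm_num at h)

/-- The hyperplanes through the points `G (x + k l * ε)` and their normal covectors. -/
lemma IsCurve.exists_normal (hd : 2 ≤ d) (hk : Function.Injective k) (hsum : ∑ l, k l = 0)
    (hG : IsCurve d u G) {M : Matrix (Fin (d + 1)) (Fin (d + 1)) ℝ} (hM : M.det = 1)
    (hGM : ∀ x, G (x + 2 * Real.pi) = M *ᵥ G x) :
    ∃ ε₀, 0 < ε₀ ∧ ε₀ ≤ 1 ∧ ∃ n : ℝ → ℝ → Fin (d + 1) → ℝ,
      (∀ a, SmoothO ε₀ 3 (fun ε x => n ε x a - approxNormal d G (limitConst k) ε x a)) ∧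
      (∀ ε ∈ Set.Ioo 0 ε₀, ∀ x l, n ε x ⬝ᵥ G (x + k l * ε) = 0) ∧
      (∀ ε ∈ Set.Ioo 0 ε₀, ∀ x, LinearIndependent ℝ (fun l => G (x + k l * ε))) ∧
      ∀ ε ∈ Set.Ioo 0 ε₀, ∀ x, n ε (x + 2 * Real.pi) = n ε x ᵥ* M⁻¹ := by
  set C := limitConst k
  have hdet : SmoothO 1 2 (fun ε x => (frameMat k G ε x).det - 1) := by
    refine (SmoothO.det_sub_det (smoothO_frameMat hd hk hsum hG le_rfl)
      (smoothO_wmat (SmoothO.of_contDiff_vec hG.contDiff))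
      (smoothO_frameMat_sub hd hk hsum hG le_rfl)).congr fun ε _ x => ?_
    rw [hG.det_wmat]
  obtain ⟨ε₀, hε₀, hε₁, hunit⟩ := hdet.exists_uniform one_pos le_rfl Real.two_pi_pos two_ne_zero
    (fun ε _ x => by rw [frameMat_equivariant hG hGM, Matrix.det_mul, hM, one_mul])
  -- `n` annihilates the divided differences and agrees with the approximate normal on `G^{(d)}`. In
  -- the frame, their difference then has only the entries `-(approxNormal · divDiff)`, each
  -- `O(ε³)`.
  set ρ : ℝ → ℝ → ℝ := fun ε x => approxNormal d G C ε x ⬝ᵥ iteratedDeriv d G x with hρ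
  set n : ℝ → ℝ → Fin (d + 1) → ℝ := fun ε x =>
    Pi.single (Fin.last d) (ρ ε x) ᵥ* (frameMat k G ε x)⁻¹ with hn
  have hnF : ∀ ε ∈ Set.Ioo 0 ε₀, ∀ x, n ε x ᵥ* frameMat k G ε x =
      Pi.single (Fin.last d) (ρ ε x) := fun ε hε x => by
    rw [hn, Matrix.vecMul_vecMul, Matrix.nonsing_inv_mul _ (isUnit_of_mem_Icc (hunit ε hε x)),
      Matrix.vecMul_one]
  refine ⟨ε₀, hε₀, hε₁, n, fun a => ?_, fun ε hε x l => ?_, fun ε hε x => ?_, fun ε _ x => ?_⟩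
  · have h1 : ∀ j : Fin (d + 1), SmoothO ε₀ 3 (fun ε x =>
        (if h : (j : ℕ) < d then -(approxNormal d G C ε x ⬝ᵥ divDiff k ⟨j, h⟩ G ε x) else 0)) := by
      intro j
      by_cases h : (j : ℕ) < d
      · simpa only [dif_pos h] using (smoothO_approxNormal_divDiff hd hk hsum hG hε₁ ⟨j, h⟩).neg
      · simpa only [dif_neg h] using SmoothO.zero
    refine (SmoothO.vecMul (SmoothO.inv (smoothO_frameMat hd hk hsum hG hε₁) hunit) h1 a).congr
      fun ε hε x => ?_
    have h2 : (fun j : Fin (d + 1) =>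
        if h : (j : ℕ) < d then -(approxNormal d G C ε x ⬝ᵥ divDiff k ⟨j, h⟩ G ε x) else 0) =
        (n ε x - approxNormal d G C ε x) ᵥ* frameMat k G ε x := by
      rw [Matrix.sub_vecMul, hnF ε hε x]
      ext j
      by_cases h : (j : ℕ) < d
      · rw [dif_pos h, Pi.sub_apply, Pi.single_eq_of_ne (by rintro rfl; simp at h), zero_sub]
        simp only [Matrix.vecMul, frameMat, dif_pos h, Matrix.of_apply]
      · obtain rfl : j = Fin.last d := Fin.ext (by simp; omega)
        rw [dif_neg h, Pi.sub_apply, Pi.single_eq_same, hρ, eq_comm, sub_eq_zero]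
        simp only [Matrix.vecMul, frameMat, dif_neg h, Matrix.of_apply]
    rw [h2, Matrix.vecMul_vecMul, Matrix.mul_nonsing_inv _ (isUnit_of_mem_Icc (hunit ε hε x)),
      Matrix.vecMul_one]
    rfl
  · rw [sum_divDiff hk G hε.1.ne' x l, dotProduct_sum]
    refine Finset.sum_eq_zero fun i _ => ?_
    have h1 := congrFun (hnF ε hε x) i.castSucc
    rw [Pi.single_eq_of_ne (Fin.castSucc_lt_last i).ne] at h1
    have h2 : n ε x ⬝ᵥ divDiff k i G ε x = 0 := by
      rw [← h1]
      simp only [Matrix.vecMul, frameMat, Matrix.of_apply, Fin.val_castSucc, dif_pos i.2]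
    rw [dotProduct_smul, h2, smul_zero]
  · rw [Fintype.linearIndependent_iff]
    intro b hb
    -- A relation among the points becomes one among the divided differences, which are columns of
    -- an invertible frame; the Vandermonde matrix then kills its coefficients.
    have h1 : ∑ i : Fin d, (∑ l, b l * (k l ^ (i : ℕ) * (ε ^ (i : ℕ) / (i : ℕ).factorial))) •
        divDiff k i G ε x = 0 := by
      rw [← hb]
      simp only [Finset.sum_smul]
      rw [Finset.sum_comm]
      refine Finset.sum_congr rfl fun l _ => ?_
      rw [sum_divDiff hk G hε.1.ne' x l, Finset.smul_sum]
      exact Finset.sum_congr rfl fun i _ => by rw [smul_smul]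
    have h2 : frameMat k G ε x *ᵥ (Fin.snoc (α := fun _ => ℝ) (fun i : Fin d =>
        ∑ l, b l * (k l ^ (i : ℕ) * (ε ^ (i : ℕ) / (i : ℕ).factorial))) 0) = 0 := by
      rw [← h1]
      ext a
      simp only [Matrix.mulVec, dotProduct]
      rw [Fin.sum_univ_castSucc]
      simp [frameMat, mul_comm, Finset.sum_apply]
    have h3 : (Fin.snoc (α := fun _ => ℝ) (fun i : Fin d =>
        ∑ l, b l * (k l ^ (i : ℕ) * (ε ^ (i : ℕ) / (i : ℕ).factorial))) 0) = 0 :=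
      Matrix.eq_zero_of_mulVec_eq_zero (isUnit_of_mem_Icc (hunit ε hε x)).ne_zero h2
    have h4 : b ᵥ* Matrix.vandermonde k = 0 := by
      ext i
      have h5 := congrFun h3 i.castSucc
      rw [Fin.snoc_castSucc, Pi.zero_apply] at h5
      simp only [← mul_assoc] at h5
      rw [← Finset.sum_mul] at h5
      refine (mul_eq_zero.mp h5).resolve_right ?_
      have := hε.1
      positivity
    exact congrFun (Matrix.eq_zero_of_vecMul_eq_zero (isUnit_det_vandermonde hk).ne_zero h4)
  · have h1 : ρ ε (x + 2 * Real.pi) = ρ ε x := by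
      simp only [hρ]
      rw [approxNormal_equivariant hG hGM, iteratedDeriv_mulVec_of_equivariant hG.contDiff hGM,
        vecMul_dotProduct_mulVec_of_inv hM]
    simp only [hn]
    rw [h1, frameMat_equivariant hG hGM, Matrix.mul_inv_rev, Matrix.vecMul_vecMul]

end Normal
end

noncomputable section

/-! ## The normalized lift of the envelope -/

section Lift
variable {d : ℕ} {k : Fin d → ℝ} {u : ℕ → ℝ → ℝ} {G : ℝ → Fin (d + 1) → ℝ}

lemma IsCurve.iteratedDeriv_top_succ (hG : IsCurve d u G) (x : ℝ) :
    iteratedDeriv (d + 2) G x = -∑ j ∈ Finset.range d,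
      (u j x • iteratedDeriv (j + 1) G x + deriv (u j) x • iteratedDeriv j G x) := by
  have h1 := hasDerivAt_iteratedDeriv hG.contDiff (d + 1) x
  have h2 : HasDerivAt (fun x => -∑ j ∈ Finset.range d, u j x • iteratedDeriv j G x)
      (-∑ j ∈ Finset.range d,
        (u j x • iteratedDeriv (j + 1) G x + deriv (u j) x • iteratedDeriv j G x)) x := by
    refine (HasDerivAt.fun_sum fun j hj => ?_).neg
    have hu := (hG.2.2.2.1 j (Finset.mem_range.mp hj)).1
    exact (hu.differentiable (by simp) x).hasDerivAt.smul (hasDerivAt_iteratedDeriv hG.contDiff j x)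
  rw [show iteratedDeriv (d + 1) G = _ from funext hG.iteratedDeriv_top] at h1
  exact h1.unique h2

lemma IsCurve.inv_mulVec_apply (hG : IsCurve d u G) (x : ℝ) {j : ℕ} (hj : j ≤ d)
    (i : Fin (d + 1)) :
    ((wmat d G x)⁻¹ *ᵥ iteratedDeriv j G x) i = if (i : ℕ) = j then 1 else 0 := by
  rw [hG.inv_mulVec x ⟨j, by omega⟩, Pi.single_apply]
  simp only [Fin.ext_iff]

/-- In the frame `G, …, G^{(d)}` the map `G^{(j)} ↦ G^{(j+2)}` has diagonal entries only in the last
two columns, each equal to `-u_{d-1}`. Multiplication by the potential contributes itself `d + 1`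
times, that is `2u_{d-1}` in all. -/
lemma IsCurve.trace_opQ (hd : 2 ≤ d) (hG : IsCurve d u G) (x : ℝ) :
    ((wmat d G x)⁻¹ * wmat d (opQ d u G) x).trace = 0 := by
  set q : ℝ → ℝ := fun x => 2 / ((d : ℝ) + 1) * u (d - 1) x with hq
  have hqs : ContDiff ℝ ∞ q := contDiff_const.mul (hG.2.2.2.1 (d - 1) (by omega)).1
  have hQ : ∀ j : ℕ, iteratedDeriv j (opQ d u G) x = iteratedDeriv (j + 2) G x +
      ∑ i ∈ Finset.range (j + 1), ((j.choose i : ℝ) * iteratedDeriv (j - i) q x) •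
        iteratedDeriv i G x := by
    intro j
    have h1 : opQ d u G = fun x => iteratedDeriv 2 G x + q x • G x := rfl
    have h2 : ContDiff ℝ ∞ fun x => q x • G x := hqs.smul hG.contDiff
    rw [h1, iteratedDeriv_fun_add (contDiffAt_of_infty (contDiff_iteratedDeriv hG.contDiff 2) j x)
      (contDiffAt_of_infty h2 j x), iteratedDeriv_iteratedDeriv]
    congr 1
    ext a
    rw [iteratedDeriv_smul_vec hqs hG.contDiff, Finset.sum_apply]
    rfl
  have hdiag : ∀ j : Fin (d + 1), ((wmat d G x)⁻¹ * wmat d (opQ d u G) x) j j =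
      ((wmat d G x)⁻¹ *ᵥ iteratedDeriv ((j : ℕ) + 2) G x) j + q x := by
    intro j
    have h1 : ((wmat d G x)⁻¹ * wmat d (opQ d u G) x) j j =
        ((wmat d G x)⁻¹ *ᵥ iteratedDeriv (j : ℕ) (opQ d u G) x) j := rfl
    rw [h1, hQ, Matrix.mulVec_add, Pi.add_apply, Matrix.mulVec_sum, Finset.sum_apply,
      Finset.sum_eq_single (j : ℕ)]
    · rw [Matrix.mulVec_smul, Pi.smul_apply, hG.inv_mulVec_apply x (j := j) (by omega), if_pos rfl]
      simp
    · intro i hi hij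
      have := Finset.mem_range.mp hi
      rw [Matrix.mulVec_smul, Pi.smul_apply, hG.inv_mulVec_apply x (j := i) (by omega),
        if_neg (Ne.symm hij), smul_zero]
    · simp
  obtain ⟨n, rfl⟩ : ∃ n, d = n + 2 := ⟨d - 2, by omega⟩
  rw [Matrix.trace]
  simp only [Matrix.diag_apply, hdiag]
  rw [Finset.sum_add_distrib, Fin.sum_univ_castSucc, Fin.sum_univ_castSucc]
  have h1 : ∑ i : Fin (n + 1), ((wmat (n + 2) G x)⁻¹ *ᵥ
      iteratedDeriv (((i.castSucc.castSucc : Fin (n + 3)) : ℕ) + 2) G x) i.castSucc.castSucc = 0 := by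
    refine Finset.sum_eq_zero fun i _ => ?_
    rw [hG.inv_mulVec_apply x (by simp; omega), if_neg (by omega)]
  have h2 : ((wmat (n + 2) G x)⁻¹ *ᵥ iteratedDeriv
      ((((Fin.last (n + 1)).castSucc : Fin (n + 3)) : ℕ) + 2) G x) (Fin.last (n + 1)).castSucc =
      -u (n + 1) x := by
    rw [show (((Fin.last (n + 1)).castSucc : Fin (n + 3)) : ℕ) + 2 = n + 2 + 1 by simp,
      hG.iteratedDeriv_top, Matrix.mulVec_neg, Matrix.mulVec_sum, Pi.neg_apply, Finset.sum_apply,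
      Finset.sum_eq_single (n + 1)]
    · rw [Matrix.mulVec_smul, Pi.smul_apply, hG.inv_mulVec_apply x (by omega), if_pos (by simp)]
      simp
    · intro i hi hij
      have := Finset.mem_range.mp hi
      rw [Matrix.mulVec_smul, Pi.smul_apply, hG.inv_mulVec_apply x (by omega),
        if_neg (by simp; omega), smul_zero]
    · simp
  have h3 : ((wmat (n + 2) G x)⁻¹ *ᵥ iteratedDeriv
      (((Fin.last (n + 2) : Fin (n + 3)) : ℕ) + 2) G x) (Fin.last (n + 2)) = -u (n + 1) x := by
    rw [show ((Fin.last (n + 2) : Fin (n + 3)) : ℕ) + 2 = n + 2 + 2 by simp,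
      hG.iteratedDeriv_top_succ, Matrix.mulVec_neg, Matrix.mulVec_sum, Pi.neg_apply,
      Finset.sum_apply, Finset.sum_eq_single (n + 1)]
    · rw [Matrix.mulVec_add, Pi.add_apply, Matrix.mulVec_smul, Pi.smul_apply, Matrix.mulVec_smul,
        Pi.smul_apply, hG.inv_mulVec_apply x (by omega), hG.inv_mulVec_apply x (by omega),
        if_pos (by simp), if_neg (by simp)]
      simp
    · intro i hi hij
      have := Finset.mem_range.mp hi
      rw [Matrix.mulVec_add, Pi.add_apply, Matrix.mulVec_smul, Pi.smul_apply, Matrix.mulVec_smul,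
        Pi.smul_apply, hG.inv_mulVec_apply x (by omega), hG.inv_mulVec_apply x (by omega),
        if_neg (by simp; omega), if_neg (by simp; omega), smul_zero, smul_zero, add_zero]
    · simp
  rw [h1, h2, h3]
  simp only [Finset.sum_const, Finset.card_univ, Fintype.card_fin, hq, nsmul_eq_mul]
  have : ((n + 2 : ℕ) : ℝ) + 1 ≠ 0 := by positivity
  push_cast at this ⊢
  field_simp
  ring

/-- Relative to the frame of `G` the matrix is `1 + ε² A`, and `A` has trace zero. -/
lemma IsCurve.smoothO_wronskian_approxLift (hd : 2 ≤ d) (hG : IsCurve d u G) {ε₀ : ℝ} (C : ℝ) :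
    SmoothO ε₀ 4 (fun ε x => (wmat d (approxLift d u G C ε) x).det - 1) := by
  have hQ := hG.contDiff_opQ hd
  have hent : ∀ i j, SmoothO ε₀ 0
      (fun _ x => (C • ((wmat d G x)⁻¹ * wmat d (opQ d u G) x)) i j) := by
    intro i j
    simp only [Matrix.smul_apply, Matrix.mul_apply, smul_eq_mul]
    refine SmoothO.const_mul _ (SmoothO.sum _ fun l _ => SmoothO.mul ?_ ?_)
    · refine SmoothO.inv (A := fun _ x => wmat d G x)
        (smoothO_wmat (v := fun _ => G) (SmoothO.of_contDiff_vec hG.contDiff)) (fun ε _ x => ?_) i l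
      rw [hG.det_wmat]
      norm_num
    · exact smoothO_wmat (v := fun _ => opQ d u G) (SmoothO.of_contDiff_vec hQ) l j
  refine (SmoothO.det_one_add hent).congr fun ε _ x => ?_
  rw [Matrix.trace_smul, hG.trace_opQ hd, smul_zero, mul_zero, add_zero]
  congr 1
  have h1 : wmat d (approxLift d u G C ε) x = wmat d G x *
      (1 + ε ^ 2 • C • ((wmat d G x)⁻¹ * wmat d (opQ d u G) x)) := by
    rw [mul_add, mul_one, Matrix.mul_smul, Matrix.mul_smul, ← mul_assoc, Matrix.mul_nonsing_inv _
      (by rw [hG.det_wmat]; exact isUnit_one), one_mul]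
    ext a j
    have h2 : approxLift d u G C ε = fun x => G x + (ε ^ 2 * C) • opQ d u G x := by
      ext x; simp [approxLift, mul_assoc]
    have h3 : ContDiff ℝ ∞ fun x => (ε ^ 2 * C) • opQ d u G x :=
      (contDiff_const (c := ε ^ 2 * C)).smul hQ
    simp only [wmat, Matrix.of_apply, Matrix.add_apply, Matrix.smul_apply, smul_eq_mul]
    rw [h2, iteratedDeriv_fun_add (contDiffAt_of_infty hG.contDiff j x)
      (contDiffAt_of_infty h3 j x), iteratedDeriv_fun_const_smul_field, Pi.add_apply,
      Pi.smul_apply, smul_eq_mul, mul_assoc]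
  rw [h1, Matrix.det_mul, hG.det_wmat, one_mul]

end Lift
end

/-! ### Covectors annihilating an envelope, uniqueness and normalization -/

noncomputable section

section Lift
variable {d : ℕ} {k : Fin d → ℝ} {u : ℕ → ℝ → ℝ} {G : ℝ → Fin (d + 1) → ℝ}

lemma smoothO_iteratedDeriv_sub {ι : Type*} [Fintype ι] {ε₀ : ℝ} {n : ℕ}
    {v w : ℝ → ℝ → ι → ℝ} (hv : ∀ ε ∈ Set.Ioo 0 ε₀, ContDiff ℝ ∞ (v ε))
    (hw : ∀ ε ∈ Set.Ioo 0 ε₀, ContDiff ℝ ∞ (w ε))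
    (h : ∀ a, SmoothO ε₀ n (fun ε x => v ε x a - w ε x a)) (j : ℕ) (a : ι) :
    SmoothO ε₀ n (fun ε x => iteratedDeriv j (v ε) x a - iteratedDeriv j (w ε) x a) := by
  refine (smoothO_iteratedDeriv_apply (v := fun ε x => v ε x - w ε x) h j a).congr
    fun ε hε x => ?_
  rw [iteratedDeriv_fun_sub (contDiffAt_of_infty (hv ε hε) j x)
    (contDiffAt_of_infty (hw ε hε) j x)]
  rfl

/-- A covector annihilating the hyperplanes annihilates the derivatives of the envelope. -/
lemma IsEnvelopeLift.pairing {ε : ℝ} {E n : ℝ → Fin (d + 1) → ℝ}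
    (hE : IsEnvelopeLift d k G ε E) (hn : ∀ x l, n x ⬝ᵥ G (x + k l * ε) = 0) {j : ℕ} (hj : j < d)
    (x : ℝ) : n x ⬝ᵥ iteratedDeriv j E x = 0 := by
  obtain ⟨hli, hdet⟩ := hE.2.2 x
  -- The first `d` rows are independent, so the vanishing determinant forces the last row into their
  -- span.
  have h1 : ¬ LinearIndependent ℝ (Fin.snoc (α := fun _ => Fin (d + 1) → ℝ)
      (fun l : Fin d => G (x + k l * ε)) (iteratedDeriv j E x)) := by
    intro h
    have := (Matrix.linearIndependent_rows_iff_isUnit (A := Matrix.of (Fin.snoc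
      (α := fun _ => Fin (d + 1) → ℝ) (fun l : Fin d => G (x + k l * ε))
      (iteratedDeriv j E x)))).mp h
    rw [Matrix.isUnit_iff_isUnit_det, hdet j hj] at this
    exact not_isUnit_zero this
  have h2 : iteratedDeriv j E x ∈ Submodule.span ℝ (Set.range fun l : Fin d => G (x + k l * ε)) := by
    by_contra h
    exact h1 (linearIndependent_finSnoc.mpr ⟨hli, h⟩)
  clear h1
  generalize iteratedDeriv j E x = y at h2 ⊢
  induction h2 using Submodule.span_induction with
  | mem v hv => obtain ⟨l, rfl⟩ := hv; exact hn x l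
  | zero => simp
  | add v w _ _ hv hw => rw [dotProduct_add, hv, hw, add_zero]
  | smul c v _ hv => rw [dotProduct_smul, hv, smul_zero]

lemma det_snoc_eq_zero {v : Fin d → Fin (d + 1) → ℝ} {w n : Fin (d + 1) → ℝ} (hn : n ≠ 0)
    (hv : ∀ l, n ⬝ᵥ v l = 0) (hw : n ⬝ᵥ w = 0) :
    (Matrix.of (Fin.snoc (α := fun _ => Fin (d + 1) → ℝ) v w)).det = 0 := by
  refine Matrix.exists_mulVec_eq_zero_iff.mp ⟨n, hn, ?_⟩
  ext i
  refine Fin.lastCases ?_ (fun i => ?_) i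
  · simpa [Matrix.mulVec, dotProduct_comm] using hw
  · simpa [Matrix.mulVec, dotProduct_comm] using hv i

/-- Row `i` carries the derivative of order `d - i`, so only row `0` is unconstrained. -/
lemma rowMat_mulVec_eq_single {n E : ℝ → Fin (d + 1) → ℝ} {x : ℝ}
    (h : ∀ i < d, iteratedDeriv i n x ⬝ᵥ E x = 0) :
    rowMat d n x *ᵥ E x = Pi.single 0 ((rowMat d n x *ᵥ E x) 0) := by
  ext i
  by_cases hi : i = 0
  · subst hi; simp
  · rw [Pi.single_eq_of_ne hi, rowMat_mulVec, h _ (by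
      have : (i : ℕ) ≠ 0 := fun h => hi (Fin.ext h)
      omega), mul_zero]

lemma contDiff_dotProduct {ι : Type*} [Fintype ι] {f g : ℝ → ι → ℝ} (hf : ContDiff ℝ ∞ f)
    (hg : ContDiff ℝ ∞ g) : ContDiff ℝ ∞ fun x => f x ⬝ᵥ g x :=
  ContDiff.sum fun a _ => (contDiff_pi.mp hf a).mul (contDiff_pi.mp hg a)

lemma ne_zero_of_wronskian {E : ℝ → Fin (d + 1) → ℝ} (hE : ∀ x, wronskian d E x = 1) (x : ℝ) :
    E x ≠ 0 := by
  intro h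
  have h1 := hE x
  rw [wronskian, Matrix.det_eq_zero_of_column_eq_zero 0 (fun i => by simp [h])] at h1
  exact zero_ne_one h1

/-- Two normalized curves annihilated by the same covectors are proportional. -/
lemma exists_const_smul {n E E' : ℝ → Fin (d + 1) → ℝ} (hn : ContDiff ℝ ∞ n)
    (hE : ContDiff ℝ ∞ E) (hE' : ContDiff ℝ ∞ E') (hW : ∀ x, wronskian d E x = 1)
    (hW' : ∀ x, wronskian d E' x = 1) (hdet : ∀ x, IsUnit (rowMat d n x).det)
    (h : ∀ i < d, ∀ x, iteratedDeriv i n x ⬝ᵥ E x = 0)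
    (h' : ∀ i < d, ∀ x, iteratedDeriv i n x ⬝ᵥ E' x = 0) :
    ∃ s : ℝ, s ≠ 0 ∧ E' = fun x => s • E x := by
  set σ : ℝ → ℝ := fun x => (rowMat d n x *ᵥ E x) 0 with hσ
  set σ' : ℝ → ℝ := fun x => (rowMat d n x *ᵥ E' x) 0 with hσ'
  have hsm : ∀ {F : ℝ → Fin (d + 1) → ℝ}, ContDiff ℝ ∞ F →
      ContDiff ℝ ∞ fun x => (rowMat d n x *ᵥ F x) 0 := fun hF => by
    simp only [rowMat_mulVec]
    exact contDiff_const.mul (contDiff_dotProduct (contDiff_iteratedDeriv hn _) hF)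
  have hσ0 : ∀ x, σ x ≠ 0 := fun x h0 => by
    have h1 := rowMat_mulVec_eq_single (fun i hi => h i hi x)
    rw [show (rowMat d n x *ᵥ E x) 0 = 0 from h0, Pi.single_zero] at h1
    exact ne_zero_of_wronskian hW x
      (Matrix.eq_zero_of_mulVec_eq_zero (hdet x).ne_zero h1)
  set t : ℝ → ℝ := fun x => σ' x / σ x with ht
  have hts : ContDiff ℝ ∞ t := (hsm hE').div (hsm hE) hσ0
  have hEt : E' = fun x => t x • E x := by
    ext1 x
    have h1 : rowMat d n x *ᵥ (E' x - t x • E x) = 0 := by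
      rw [Matrix.mulVec_sub, Matrix.mulVec_smul, rowMat_mulVec_eq_single (fun i hi => h i hi x),
        rowMat_mulVec_eq_single (fun i hi => h' i hi x), ← Pi.single_smul, smul_eq_mul]
      change (Pi.single 0 (σ' x) - Pi.single 0 (σ' x / σ x * σ x) : Fin (d + 1) → ℝ) = 0
      rw [div_mul_cancel₀ _ (hσ0 x), sub_self]
    exact sub_eq_zero.mp (Matrix.eq_zero_of_mulVec_eq_zero (hdet x).ne_zero h1)
  -- The Wronskian is homogeneous of degree `d + 1`; differentiating `t^{d+1} = 1` then shows that
  -- `t` is constant.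
  have hpow : ∀ x, t x ^ (d + 1) = 1 := fun x => by
    have h1 := wronskian_smul hts hE x
    rw [← hEt, hW, hW', mul_one] at h1
    exact h1.symm
  have ht0 : ∀ x, t x ≠ 0 := fun x h0 => by
    have := hpow x
    rw [h0, zero_pow (Nat.succ_ne_zero d)] at this
    exact zero_ne_one this
  have hdt : ∀ x, deriv t x = 0 := fun x => by
    have h1 : HasDerivAt (fun x => t x ^ (d + 1)) _ x :=
      (hts.differentiable (by simp) x).hasDerivAt.pow (d + 1)
    simp only [hpow] at h1
    have h2 := h1.unique (hasDerivAt_const x 1)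
    rw [mul_eq_zero, mul_eq_zero] at h2
    rcases h2 with (h2 | h2) | h2
    · exact absurd h2 (by positivity)
    · exact absurd h2 (pow_ne_zero _ (ht0 x))
    · exact h2
  refine ⟨t 0, ht0 0, ?_⟩
  rw [hEt]
  ext1 x
  rw [is_const_of_deriv_eq_zero (hts.differentiable (by simp)) hdt x 0]

/-- The geometric sum that multiplies `r - 1` is at least `1`. This bounds the distance of
`W^{-1/(d+1)}` from `1` by that of `W⁻¹`. -/
lemma abs_sub_one_le_pow {r : ℝ} (hr : 0 ≤ r) (n : ℕ) : |r - 1| ≤ |r ^ (n + 1) - 1| := by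
  have h1 : r ^ (n + 1) - 1 = (∑ i ∈ Finset.range (n + 1), r ^ i) * (r - 1) :=
    (geom_sum_mul r (n + 1)).symm
  rw [h1, abs_mul]
  refine le_mul_of_one_le_left (abs_nonneg _) ?_
  rw [Finset.sum_range_succ']
  have : 0 ≤ ∑ i ∈ Finset.range n, r ^ (i + 1) := Finset.sum_nonneg fun i _ => by positivity
  refine le_trans ?_ (le_abs_self _)
  simpa using this

/-- The normalizing factor `W^{-1/(d+1)}`. -/
lemma SmoothO.normalizing_factor {ε₀ : ℝ} (hε₁ : ε₀ ≤ 1) {n : ℕ} {W : ℝ → ℝ → ℝ}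
    (hW : SmoothO ε₀ n (fun ε x => W ε x - 1))
    (h : ∀ ε ∈ Set.Ioo 0 ε₀, ∀ x, W ε x ∈ Set.Icc (1 / 2) 2) (d : ℕ) :
    ∃ l : ℝ → ℝ → ℝ, SmoothO ε₀ n (fun ε x => l ε x - 1) ∧
      (∀ ε ∈ Set.Ioo 0 ε₀, ∀ x, l ε x ^ (d + 1) * W ε x = 1) ∧
      ∀ ε x y, W ε x = W ε y → l ε x = l ε y := by
  have hW0 : SmoothO ε₀ 0 W := hW.of_sub hε₁ (SmoothO.const 1)
  have hpos : ∀ ε ∈ Set.Ioo 0 ε₀, ∀ x, 0 < W ε x := fun ε hε x => by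
    linarith [(h ε hε x).1]
  set r : ℝ := -1 / ((d : ℝ) + 1) with hr
  have hs := hW0.rpow h r
  have hpow : ∀ ε ∈ Set.Ioo 0 ε₀, ∀ x, (W ε x ^ r) ^ (d + 1) = (W ε x)⁻¹ := fun ε hε x => by
    rw [← Real.rpow_natCast, ← Real.rpow_mul (hpos ε hε x).le, ← Real.rpow_neg_one]
    congr 1
    have : (d : ℝ) + 1 ≠ 0 := by positivity
    rw [hr]
    push_cast
    field_simp
  refine ⟨fun ε x => W ε x ^ r, ?_, fun ε hε x => ?_, fun ε x y hxy => by simp only [hxy]⟩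
  · refine SmoothO.of_deriv (fun ε hε => (hs.1 ε hε).sub contDiff_const) (fun A => ?_) ?_
    · obtain ⟨K, hK⟩ := hW.locO A
      refine ⟨2 * K, fun ε hε x hx => ?_⟩
      have h1 := abs_sub_one_le_pow (Real.rpow_nonneg (hpos ε hε x).le r) d
      rw [hpow ε hε x] at h1
      refine h1.trans ?_
      have h2 : (W ε x)⁻¹ - 1 = -(W ε x - 1) * (W ε x)⁻¹ := by
        have := (hpos ε hε x).ne'
        field_simp
        ring
      rw [h2, abs_mul, abs_neg, abs_of_pos (inv_pos.mpr (hpos ε hε x))]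
      have h3 : (W ε x)⁻¹ ≤ 2 := by
        rw [inv_le_comm₀ (hpos ε hε x) two_pos]
        linarith [(h ε hε x).1]
      calc |W ε x - 1| * (W ε x)⁻¹ ≤ (K * ε ^ n) * 2 :=
            mul_le_mul (hK ε hε x hx) h3 (inv_pos.mpr (hpos ε hε x)).le
              ((abs_nonneg _).trans (hK ε hε x hx))
        _ = 2 * K * ε ^ n := by ring
    · have h1 := ((hW.iteratedDeriv 1).mul (hW0.rpow h (r - 1))).const_mul r
      refine h1.congr fun ε hε x => ?_
      have hd : HasDerivAt (W ε) (deriv (W ε) x) x :=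
        ((hW0.1 ε hε).differentiable (by simp) x).hasDerivAt
      rw [((hd.rpow_const (p := r) (Or.inl (hpos ε hε x).ne')).sub_const 1).deriv,
        iteratedDeriv_one, (hd.sub_const 1).deriv]
      ring
  · rw [hpow ε hε x, inv_mul_cancel₀ (hpos ε hε x).ne']

end Lift
end

/-! ### Existence of the envelope lifts -/

noncomputable section

section Lift
variable {d : ℕ} {k : Fin d → ℝ} {u : ℕ → ℝ → ℝ} {G : ℝ → Fin (d + 1) → ℝ}

lemma IsCurve.opQ_equivariant (hd : 2 ≤ d) (hG : IsCurve d u G)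
    {M : Matrix (Fin (d + 1)) (Fin (d + 1)) ℝ}
    (hGM : ∀ x, G (x + 2 * Real.pi) = M *ᵥ G x) (x : ℝ) :
    opQ d u G (x + 2 * Real.pi) = M *ᵥ opQ d u G x := by
  rw [opQ, opQ, iteratedDeriv_mulVec_of_equivariant hG.contDiff hGM, hGM,
    (hG.2.2.2.1 (d - 1) (by omega)).2 x, Matrix.mulVec_add, Matrix.mulVec_smul]

/-- The normalized lifts of the envelopes exist, are unique up to a constant, and agree with
`G + ε² C Q₂ G` to third order. -/
theorem IsCurve.exists_envelopeLift (hd : 2 ≤ d) (hk : Function.Injective k)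
    (hsum : ∑ l, k l = 0) (hG : IsCurve d u G) {M : Matrix (Fin (d + 1)) (Fin (d + 1)) ℝ}
    (hM : M.det = 1) (hGM : ∀ x, G (x + 2 * Real.pi) = M *ᵥ G x) :
    ∃ ε₀, 0 < ε₀ ∧ ε₀ ≤ 1 ∧ ∃ E : ℝ → ℝ → Fin (d + 1) → ℝ,
      (∀ ε ∈ Set.Ioo 0 ε₀, IsEnvelopeLift d k G ε (E ε)) ∧
      (∀ a, SmoothO ε₀ 3 (fun ε x => E ε x a - approxLift d u G (limitConst k) ε x a)) ∧
      (∀ ε ∈ Set.Ioo 0 ε₀, ∀ x, E ε (x + 2 * Real.pi) = M *ᵥ E ε x) ∧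
      ∀ ε ∈ Set.Ioo 0 ε₀, ∀ E', IsEnvelopeLift d k G ε E' →
        ∃ s : ℝ, s ≠ 0 ∧ E' = fun x => s • E ε x := by
  obtain ⟨ε₀, hε₀, hε₁, n, hnapp, hnG, hli, hnM⟩ := hG.exists_normal hd hk hsum hM hGM
  set C := limitConst k with hC
  set F := approxLift d u G C with hF
  have hH := hG.contDiff_dualCurve
  -- the normal covector and its derivatives
  have hnH : ∀ a, SmoothO ε₀ 2 (fun ε x => n ε x a - dualCurve d G x a) := fun a =>
    (((hnapp a).weaken hε₁ (by norm_num)).add (hG.smoothO_approxNormal_sub C a)).congr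
      fun _ _ _ => by ring
  have hn : ∀ a, SmoothO ε₀ 0 (fun ε x => n ε x a) := fun a =>
    (hnH a).of_sub hε₁ (SmoothO.of_contDiff_vec hH a)
  have hns : ∀ ε ∈ Set.Ioo 0 ε₀, ContDiff ℝ ∞ (n ε) := fun ε hε =>
    contDiff_pi.mpr fun a => (hn a).1 ε hε
  have hZ : SmoothO ε₀ 2 (fun ε x => (rowMat d (n ε) x).det - 1) := by
    refine (SmoothO.det_sub_det (smoothO_rowMat hn)
      (smoothO_rowMat (v := fun _ => dualCurve d G) (SmoothO.of_contDiff_vec hH))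
      (fun i j => ?_)).congr fun ε _ x => by rw [hG.det_rowMat_dualCurve]
    refine ((smoothO_iteratedDeriv_sub hns (fun _ _ => hH) hnH (d - i) j).const_mul
      ((-1) ^ (d - (i : ℕ)))).congr fun ε _ x => ?_
    simp only [rowMat, Matrix.of_apply, mul_sub]
  obtain ⟨ε₁, hε₁0, hε₁₀, hZunit⟩ := hZ.exists_uniform hε₀ hε₁ Real.two_pi_pos two_ne_zero
    (fun ε hε x => by
      rw [rowMat_equivariant (hns ε hε) (hnM ε hε), Matrix.det_mul, Matrix.det_nonsing_inv, hM]
      simp)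
  have hε₁1 : ε₁ ≤ 1 := hε₁₀.trans hε₁
  have hsub : ∀ ε ∈ Set.Ioo 0 ε₁, ε ∈ Set.Ioo 0 ε₀ := fun ε hε => ⟨hε.1, hε.2.trans_le hε₁₀⟩
  have hFO := fun a => hG.smoothO_approxLift (ε₀ := ε₁) hd hε₁1 C a
  have hFs : ∀ ε ∈ Set.Ioo 0 ε₁, ContDiff ℝ ∞ (F ε) := fun ε hε =>
    contDiff_pi.mpr fun a => (hFO a).1 ε hε
  have hn' : ∀ a, SmoothO ε₁ 0 (fun ε x => n ε x a) := fun a => (hn a).mono hε₁₀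
  have hsmall : ∀ i < d, SmoothO ε₁ 3 (fun ε x => iteratedDeriv i (n ε) x ⬝ᵥ F ε x) := by
    intro i hi
    have h1 := SmoothO.dotProduct (smoothO_iteratedDeriv_sub (fun ε hε => hns ε (hsub ε hε))
      (fun ε hε => contDiff_pi.mpr fun a => (hG.smoothO_approxNormal hε₁1 C a).1 ε hε)
      (fun a => (hnapp a).mono hε₁₀) i) hFO
    refine (h1.add (hG.smoothO_approxNormal_approxLift hd hε₁1 C hi)).congr fun ε _ x => ?_
    rw [← add_dotProduct]
    congr 1
    ext a
    simp
  -- the unnormalized lift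
  set P : ℝ → ℝ → Fin (d + 1) → ℝ := fun ε x =>
    (rowMat d (n ε) x)⁻¹ *ᵥ Pi.single 0 ((rowMat d (n ε) x *ᵥ F ε x) 0) with hP
  have hZP : ∀ ε ∈ Set.Ioo 0 ε₁, ∀ x, rowMat d (n ε) x *ᵥ P ε x =
      Pi.single 0 ((rowMat d (n ε) x *ᵥ F ε x) 0) := fun ε hε x => by
    rw [hP, Matrix.mulVec_mulVec, Matrix.mul_nonsing_inv _ (isUnit_of_mem_Icc (hZunit ε hε x)),
      Matrix.one_mulVec]
  -- `P` has the same pairing with `n^{(d)}` as `F` and pairs to zero with the lower derivatives of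
  -- `n`, where `F` pairs to `O(ε³)`. Inverting the matrix of rows transfers the bound to `P - F`.
  have hPF : ∀ a, SmoothO ε₁ 3 (fun ε x => P ε x a - F ε x a) := by
    intro a
    have h1 : ∀ i : Fin (d + 1), SmoothO ε₁ 3 (fun ε x => (if i = 0 then 0 else
        -((-1) ^ (d - (i : ℕ)) * (iteratedDeriv (d - (i : ℕ)) (n ε) x ⬝ᵥ F ε x)))) := by
      intro i
      by_cases hi : i = 0
      · simpa only [if_pos hi] using SmoothO.zero
      · have : (i : ℕ) ≠ 0 := fun h => hi (Fin.ext h)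
        simpa only [if_neg hi] using ((hsmall (d - i) (by omega)).const_mul _).neg
    refine (SmoothO.mulVec (SmoothO.inv (smoothO_rowMat hn') hZunit) h1 a).congr fun ε hε x => ?_
    have h2 : (fun i : Fin (d + 1) => if i = 0 then 0 else
        -((-1) ^ (d - (i : ℕ)) * (iteratedDeriv (d - (i : ℕ)) (n ε) x ⬝ᵥ F ε x))) =
        rowMat d (n ε) x *ᵥ (P ε x - F ε x) := by
      rw [Matrix.mulVec_sub, hZP ε hε x]
      ext i
      by_cases hi : i = 0
      · subst hi; simp
      · rw [if_neg hi, Pi.sub_apply, Pi.single_eq_of_ne hi, rowMat_mulVec, zero_sub]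
    rw [h2, Matrix.mulVec_mulVec, Matrix.nonsing_inv_mul _ (isUnit_of_mem_Icc (hZunit ε hε x)),
      Matrix.one_mulVec]
    rfl
  have hPO : ∀ a, SmoothO ε₁ 0 (fun ε x => P ε x a) := fun a => (hPF a).of_sub hε₁1 (hFO a)
  have hPs : ∀ ε ∈ Set.Ioo 0 ε₁, ContDiff ℝ ∞ (P ε) := fun ε hε =>
    contDiff_pi.mpr fun a => (hPO a).1 ε hε
  have hPM : ∀ ε ∈ Set.Ioo 0 ε₁, ∀ x, P ε (x + 2 * Real.pi) = M *ᵥ P ε x := by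
    intro ε hε x
    have h1 : F ε (x + 2 * Real.pi) = M *ᵥ F ε x := by
      simp only [hF, approxLift]
      rw [hGM, hG.opQ_equivariant hd hGM, Matrix.mulVec_add, Matrix.mulVec_smul, Matrix.mulVec_smul]
    have hMu : IsUnit M.det := by rw [hM]; exact isUnit_one
    simp only [hP]
    rw [rowMat_equivariant (hns ε (hsub ε hε)) (hnM ε (hsub ε hε)), h1, Matrix.mulVec_mulVec,
      mul_assoc, Matrix.nonsing_inv_mul _ hMu, mul_one, Matrix.mul_inv_rev,
      Matrix.nonsing_inv_nonsing_inv _ hMu, Matrix.mulVec_mulVec]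
  -- normalization
  have hW : SmoothO ε₁ 3 (fun ε x => (wmat d (P ε) x).det - 1) := by
    refine ((SmoothO.det_sub_det (smoothO_wmat hPO) (smoothO_wmat hFO)
      (fun i j => smoothO_iteratedDeriv_sub hPs hFs hPF j i)).add
      ((hG.smoothO_wronskian_approxLift hd C).weaken hε₁1 (by norm_num))).congr fun ε _ x => by ring
  have hWper : ∀ ε ∈ Set.Ioo 0 ε₁, ∀ x,
      (wmat d (P ε) (x + 2 * Real.pi)).det = (wmat d (P ε) x).det := fun ε hε x => by
    rw [wmat_equivariant (hPs ε hε) (hPM ε hε), Matrix.det_mul, hM, one_mul]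
  obtain ⟨ε₂, hε₂0, hε₂₁, hWunit⟩ := hW.exists_uniform hε₁0 hε₁1 Real.two_pi_pos three_ne_zero hWper
  have hε₂1 : ε₂ ≤ 1 := hε₂₁.trans hε₁1
  have hsub' : ∀ ε ∈ Set.Ioo 0 ε₂, ε ∈ Set.Ioo 0 ε₁ := fun ε hε => ⟨hε.1, hε.2.trans_le hε₂₁⟩
  obtain ⟨l, hl, hlW, hlper⟩ := (hW.mono hε₂₁).normalizing_factor hε₂1 hWunit d
  have hlO : SmoothO ε₂ 0 l := hl.of_sub hε₂1 (SmoothO.const 1)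
  have hEs : ∀ ε ∈ Set.Ioo 0 ε₂, ContDiff ℝ ∞ (fun x => l ε x • P ε x) := fun ε hε =>
    (hlO.1 ε hε).smul (hPs ε (hsub' ε hε))
  have hEW : ∀ ε ∈ Set.Ioo 0 ε₂, ∀ x, wronskian d (fun x => l ε x • P ε x) x = 1 := fun ε hε x => by
    rw [wronskian_smul (hlO.1 ε hε) (hPs ε (hsub' ε hε))]
    exact hlW ε hε x
  have hnP : ∀ ε ∈ Set.Ioo 0 ε₂, ∀ i < d, ∀ x, iteratedDeriv i (n ε) x ⬝ᵥ P ε x = 0 := by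
    intro ε hε i hi x
    have h1 := congrFun (hZP ε (hsub' ε hε) x) ⟨d - i, by omega⟩
    rw [Pi.single_eq_of_ne (by intro h; have := congrArg Fin.val h; simp at this; omega),
      rowMat_mulVec, show d - (d - i) = i by omega] at h1
    exact (mul_eq_zero.mp h1).resolve_left (pow_ne_zero _ (by norm_num))
  have hnE : ∀ ε ∈ Set.Ioo 0 ε₂, ∀ i < d, ∀ x,
      iteratedDeriv i (n ε) x ⬝ᵥ (l ε x • P ε x) = 0 := fun ε hε i hi x => by
    rw [dotProduct_smul, hnP ε hε i hi x, smul_zero]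
  refine ⟨ε₂, hε₂0, hε₂1, fun ε x => l ε x • P ε x, fun ε hε => ⟨hEs ε hε, hEW ε hε, fun x =>
    ⟨hli ε (hsub ε (hsub' ε hε)) x, fun j hj => ?_⟩⟩, fun a => ?_, fun ε hε x => ?_,
    fun ε hε E' hE' => ?_⟩
  -- All `d` points and `E^{(j)}` lie in the kernel of `n`, which is nonzero as the last row of an
  -- invertible matrix; `n·E^{(j)} = 0` follows by moving derivatives from `n` to `E`.
  · refine det_snoc_eq_zero (n := n ε x) (fun h0 => ?_) (hnG ε (hsub ε (hsub' ε hε)) x) ?_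
    · have h1 : (rowMat d (n ε) x).det = 0 :=
        Matrix.det_eq_zero_of_row_eq_zero (Fin.last d) fun a => by simp [rowMat, h0]
      have := (hZunit ε (hsub' ε hε) x).1
      rw [h1] at this
      norm_num at this
    · have := pairing_eq_zero' (hns ε (hsub ε (hsub' ε hε))) (hEs ε hε)
        (fun i hi x => hnE ε hε i hi x) 0 j (by omega) x
      rwa [iteratedDeriv_zero] at this
  · refine ((hl.mul ((hPO a).mono hε₂₁)).add ((hPF a).mono hε₂₁)).congr fun ε _ x => ?_
    simp only [Pi.smul_apply, smul_eq_mul]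
    ring
  · beta_reduce
    rw [hPM ε (hsub' ε hε), Matrix.mulVec_smul, hlper ε _ _ (hWper ε (hsub' ε hε) x)]
  · have hnε := hns ε (hsub ε (hsub' ε hε))
    refine exists_const_smul hnε (hEs ε hε) hE'.1 (hEW ε hε) hE'.2.1
      (fun x => isUnit_of_mem_Icc (hZunit ε (hsub' ε hε) x)) (hnE ε hε) (fun i hi x => ?_)
    have := pairing_eq_zero hnε hE'.1
      (fun j hj x => hE'.pairing (hnG ε (hsub ε (hsub' ε hε))) hj x) i 0 (by omega) x
    rwa [iteratedDeriv_zero] at this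

end Lift
end

noncomputable section

/-! ## The operator annihilating a normalized curve -/

section Annihilator
variable {d : ℕ} {E : ℝ → Fin (d + 1) → ℝ}

/-- The coefficients of the monic operator annihilating a normalized curve. -/
def annCoeff (d : ℕ) (E : ℝ → Fin (d + 1) → ℝ) (j : ℕ) (x : ℝ) : ℝ :=
  if h : j < d + 1 then -((wmat d E x)⁻¹ *ᵥ iteratedDeriv (d + 1) E x) ⟨j, h⟩ else 0

/-- The coordinates of `L_v E` in the frame of `E` measure the error of the guess `v`; both
uniqueness and the expansion of the coefficients rest on this. -/
lemma inv_mulVec_opL {v : ℕ → ℝ → ℝ} {x : ℝ} (hW : wronskian d E x = 1) {j : ℕ} (hj : j < d) :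
    ((wmat d E x)⁻¹ *ᵥ opL d v E x) ⟨j, by omega⟩ = v j x - annCoeff d E j x := by
  have hu : IsUnit (wmat d E x).det := by
    rw [show (wmat d E x).det = 1 from hW]; exact isUnit_one
  rw [opL, Matrix.mulVec_add, Pi.add_apply, Matrix.mulVec_sum, Finset.sum_apply,
    Finset.sum_eq_single j, annCoeff, dif_pos (by omega), Matrix.mulVec_smul, Pi.smul_apply,
    inv_mulVec_wmat hu ⟨j, by omega⟩, Pi.single_eq_same]
  · simp [add_comm]
  · intro i hi hij
    have := Finset.mem_range.mp hi
    rw [Matrix.mulVec_smul, Pi.smul_apply, inv_mulVec_wmat hu ⟨i, by omega⟩,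
      Pi.single_eq_of_ne (by simpa [Fin.ext_iff] using Ne.symm hij), smul_zero]
  · intro h; exact absurd (Finset.mem_range.mpr hj) h

lemma annCoeff_unique {v : ℕ → ℝ → ℝ} {x : ℝ} (hW : wronskian d E x = 1)
    (hv : opL d v E x = 0) {j : ℕ} (hj : j < d) : v j x = annCoeff d E j x := by
  have h := inv_mulVec_opL (v := v) hW hj
  rw [hv, Matrix.mulVec_zero] at h
  exact (sub_eq_zero.mp h.symm)

/-- The derivative of the constant Wronskian is, by Cramer's rule, the `E^{(d)}`-coordinate of
`E^{(d+1)}`. It vanishes, so no term `∂^d` is needed. -/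
lemma opL_annCoeff (hE : ContDiff ℝ ∞ E) (hW : ∀ x, wronskian d E x = 1) (x : ℝ) :
    opL d (annCoeff d E) E x = 0 := by
  have hdet : (wmat d E x).det = 1 := hW x
  have hu : IsUnit (wmat d E x).det := by rw [hdet]; exact isUnit_one
  have h0 : ((wmat d E x).updateCol (Fin.last d) (iteratedDeriv (d + 1) E x)).det = 0 := by
    have h1 := hasDerivAt_wronskian hE x
    rw [show wronskian d E = fun _ => 1 from funext hW] at h1
    exact h1.unique (hasDerivAt_const x 1)
  have hlast : ((wmat d E x)⁻¹ *ᵥ iteratedDeriv (d + 1) E x) (Fin.last d) = 0 := by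
    rw [← Matrix.cramer_apply, Matrix.cramer_eq_adjugate_mulVec] at h0
    rw [Matrix.inv_def, hdet, Ring.inverse_one, one_smul, h0]
  have h2 : iteratedDeriv (d + 1) E x =
      wmat d E x *ᵥ ((wmat d E x)⁻¹ *ᵥ iteratedDeriv (d + 1) E x) := by
    rw [Matrix.mulVec_mulVec, Matrix.mul_nonsing_inv _ hu, Matrix.one_mulVec]
  rw [wmat_mulVec, Fin.sum_univ_castSucc, hlast, zero_smul, add_zero] at h2
  rw [opL, h2, Finset.sum_range, ← Finset.sum_add_distrib]
  refine Finset.sum_eq_zero fun i _ => ?_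
  rw [Fin.val_castSucc, ← add_smul]
  have : annCoeff d E i x =
      -((wmat d E x)⁻¹ *ᵥ iteratedDeriv (d + 1) E x) i.castSucc := by
    rw [annCoeff, dif_pos (by omega)]
    rfl
  rw [this, add_neg_cancel, zero_smul]

lemma annCoeff_periodic (hE : ContDiff ℝ ∞ E) {M : Matrix (Fin (d + 1)) (Fin (d + 1)) ℝ} {T : ℝ}
    (hM : M.det = 1) (hEM : ∀ x, E (x + T) = M *ᵥ E x) (j : ℕ) (x : ℝ) :
    annCoeff d E j (x + T) = annCoeff d E j x := by
  have hMu : IsUnit M.det := by rw [hM]; exact isUnit_one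
  rw [annCoeff, annCoeff, wmat_equivariant hE hEM, iteratedDeriv_mulVec_of_equivariant hE hEM,
    Matrix.mul_inv_rev, Matrix.mulVec_mulVec, mul_assoc, Matrix.nonsing_inv_mul _ hMu, mul_one]

lemma opL_apply (v : ℕ → ℝ → ℝ) (hE : ContDiff ℝ ∞ E) (x : ℝ) (a : Fin (d + 1)) :
    opL d v E x a = opL d v (fun y => E y a) x := by
  simp only [opL, Pi.add_apply, Finset.sum_apply, Pi.smul_apply, iteratedDeriv_pi_apply hE]

lemma opQ_apply (v : ℕ → ℝ → ℝ) (hE : ContDiff ℝ ∞ E) (x : ℝ) (a : Fin (d + 1)) :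
    opQ d v E x a = opQ d v (fun y => E y a) x := by
  simp only [opQ, Pi.add_apply, Pi.smul_apply, iteratedDeriv_pi_apply hE]

lemma opL_const_smul (v : ℕ → ℝ → ℝ) (s : ℝ) (x : ℝ) :
    opL d v (fun x => s • E x) x = s • opL d v E x := by
  simp only [opL, iteratedDeriv_fun_const_smul_field, smul_add, Finset.smul_sum, smul_comm s]

end Annihilator

/-! ### Third-order expansion of the annihilating operators -/

section Expansion
variable {d : ℕ} {k : Fin d → ℝ} {u c : ℕ → ℝ → ℝ} {G : ℝ → Fin (d + 1) → ℝ}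

/-- The coefficients `c` of the commutator `[Q₂, L]`. -/
def IsCommCoeff (d : ℕ) (u c : ℕ → ℝ → ℝ) : Prop :=
  SmoothPeriodic d c ∧ ∀ f : ℝ → ℝ, ContDiff ℝ ∞ f → ∀ x,
    commQL d u f x = ∑ j ∈ Finset.range d, c j x * iteratedDeriv j f x

lemma IsCurve.sum_commCoeff (hG : IsCurve d u G) (hc : IsCommCoeff d u c) (x : ℝ)
    (a : Fin (d + 1)) :
    ∑ j ∈ Finset.range d, c j x * iteratedDeriv j G x a =
      -opL d u (opQ d u fun y => G y a) x := by
  have hLG : opL d u (fun y => G y a) = fun _ => 0 := by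
    ext y
    rw [← opL_apply u hG.contDiff, hG.2.2.2.2 y, Pi.zero_apply]
  have h := hc.2 _ (hG.contDiff_apply a) x
  simp only [iteratedDeriv_pi_apply hG.contDiff]
  rw [← h, commQL, hLG]
  simp [opQ]

/-- The term free of `ε` is `LG = 0`, and the one in `ε²` is `C (LQ₂ + [Q₂, L])G = C Q₂LG = 0`. Only
a term in `ε⁴` is left. -/
lemma IsCurve.smoothO_opL_approxLift (hd : 2 ≤ d) (hG : IsCurve d u G) (hc : IsCommCoeff d u c)
    {ε₀ : ℝ} (hε₁ : ε₀ ≤ 1) (C : ℝ) (a : Fin (d + 1)) :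
    SmoothO ε₀ 3 (fun ε x => opL d (fun j x => u j x + ε ^ 2 * (C * c j x))
      (approxLift d u G C ε) x a) := by
  have hQ := hG.contDiff_opQ hd
  have h : SmoothO ε₀ 3 (fun ε x => ε ^ 4 * (C ^ 2 * ∑ j ∈ Finset.range d,
      c j x * iteratedDeriv j (opQ d u G) x a)) := by
    refine ((SmoothO.pow_eps 4).weaken hε₁ (by norm_num)).mul (SmoothO.const_mul _
      (SmoothO.sum _ fun j hj => SmoothO.mul (SmoothO.of_contDiff (hc.1 j (Finset.mem_range.mp hj)).1)
        (SmoothO.of_contDiff_vec (contDiff_iteratedDeriv hQ j) a)))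
  refine h.congr fun ε _ x => ?_
  have hF : ∀ j, iteratedDeriv j (approxLift d u G C ε) x =
      iteratedDeriv j G x + (ε ^ 2 * C) • iteratedDeriv j (opQ d u G) x := by
    intro j
    have h2 : approxLift d u G C ε = fun x => G x + (ε ^ 2 * C) • opQ d u G x := by
      ext x; simp [approxLift, mul_assoc]
    have h3 : ContDiff ℝ ∞ fun x => (ε ^ 2 * C) • opQ d u G x :=
      (contDiff_const (c := ε ^ 2 * C)).smul hQ
    rw [h2, iteratedDeriv_fun_add (contDiffAt_of_infty hG.contDiff j x)
      (contDiffAt_of_infty h3 j x), iteratedDeriv_fun_const_smul_field]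
  have h0 : iteratedDeriv (d + 1) G x a + ∑ j ∈ Finset.range d, u j x * iteratedDeriv j G x a = 0 := by
    have := congrFun (hG.2.2.2.2 x) a
    simpa [opL] using this
  have h1 : ∑ j ∈ Finset.range d, c j x * iteratedDeriv j G x a =
      -(iteratedDeriv (d + 1) (opQ d u G) x a +
        ∑ j ∈ Finset.range d, u j x * iteratedDeriv j (opQ d u G) x a) := by
    rw [hG.sum_commCoeff hc, neg_inj]
    have h2 : (opQ d u fun y => G y a) = fun y => opQ d u G y a :=
      funext fun y => (opQ_apply u hG.contDiff y a).symm
    rw [h2, ← opL_apply u hQ]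
    simp [opL]
  simp only [opL, hF, Pi.add_apply, Finset.sum_apply, Pi.smul_apply, smul_eq_mul, add_mul, mul_add,
    Finset.sum_add_distrib]
  have e1 : ∑ j ∈ Finset.range d, ε ^ 2 * (C * c j x) * iteratedDeriv j G x a =
      ε ^ 2 * C * ∑ j ∈ Finset.range d, c j x * iteratedDeriv j G x a := by
    rw [Finset.mul_sum]; exact Finset.sum_congr rfl fun j _ => by ring
  have e2 : ∑ j ∈ Finset.range d, u j x * (ε ^ 2 * C * iteratedDeriv j (opQ d u G) x a) =
      ε ^ 2 * C * ∑ j ∈ Finset.range d, u j x * iteratedDeriv j (opQ d u G) x a := by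
    rw [Finset.mul_sum]; exact Finset.sum_congr rfl fun j _ => by ring
  have e3 : ∑ j ∈ Finset.range d, ε ^ 2 * (C * c j x) *
      (ε ^ 2 * C * iteratedDeriv j (opQ d u G) x a) =
      ε ^ 4 * (C ^ 2 * ∑ j ∈ Finset.range d, c j x * iteratedDeriv j (opQ d u G) x a) := by
    rw [Finset.mul_sum, Finset.mul_sum]; exact Finset.sum_congr rfl fun j _ => by ring
  rw [e1, e2, e3, h1]
  linear_combination -h0

/-- `E` and the approximate lift agree to third order with all derivatives, so the guessed operator
applied to `E` is `O(ε³)`; its coordinates in the frame of `E` are the errors. -/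
lemma IsCurve.smoothO_annCoeff (hd : 2 ≤ d) (hG : IsCurve d u G) (hc : IsCommCoeff d u c)
    {ε₀ : ℝ} (hε₁ : ε₀ ≤ 1) (C : ℝ) {E : ℝ → ℝ → Fin (d + 1) → ℝ}
    (hW : ∀ ε ∈ Set.Ioo 0 ε₀, ∀ x, wronskian d (E ε) x = 1)
    (hE : ∀ a, SmoothO ε₀ 3 (fun ε x => E ε x a - approxLift d u G C ε x a)) {j : ℕ} (hj : j < d) :
    SmoothO ε₀ 3 (fun ε x => annCoeff d (E ε) j x - (u j x + ε ^ 2 * (C * c j x))) := by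
  have hFO := fun a => hG.smoothO_approxLift (ε₀ := ε₀) hd hε₁ C a
  have hEO : ∀ a, SmoothO ε₀ 0 (fun ε x => E ε x a) := fun a => (hE a).of_sub hε₁ (hFO a)
  have hEs : ∀ ε ∈ Set.Ioo 0 ε₀, ContDiff ℝ ∞ (E ε) := fun ε hε =>
    contDiff_pi.mpr fun a => (hEO a).1 ε hε
  have hFs : ∀ ε ∈ Set.Ioo 0 ε₀, ContDiff ℝ ∞ (approxLift d u G C ε) := fun ε hε =>
    contDiff_pi.mpr fun a => (hFO a).1 ε hε
  have hu : ∀ i ∈ Finset.range d, SmoothO ε₀ 0 (fun ε x => u i x + ε ^ 2 * (C * c i x)) :=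
    fun i hi => (SmoothO.of_contDiff (hG.2.2.2.1 i (Finset.mem_range.mp hi)).1).add
      ((smoothO_sq hε₁).mul (SmoothO.const_mul C
        (SmoothO.of_contDiff (hc.1 i (Finset.mem_range.mp hi)).1)))
  have hR : ∀ a, SmoothO ε₀ 3 (fun ε x =>
      opL d (fun j x => u j x + ε ^ 2 * (C * c j x)) (E ε) x a) := by
    intro a
    have h1 := (smoothO_iteratedDeriv_sub hEs hFs hE (d + 1) a).add (SmoothO.sum (Finset.range d)
      fun i hi => (hu i hi).mul_left (smoothO_iteratedDeriv_sub hEs hFs hE i a))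
    refine (h1.add (hG.smoothO_opL_approxLift hd hc hε₁ C a)).congr fun ε _ x => ?_
    simp only [opL, Pi.add_apply, Finset.sum_apply, Pi.smul_apply, smul_eq_mul, mul_sub,
      Finset.sum_sub_distrib]
    ring
  have hinv := SmoothO.inv (smoothO_wmat hEO) (fun ε hε x => by
    rw [show (wmat d (E ε) x).det = 1 from hW ε hε x]; norm_num)
  refine (SmoothO.mulVec hinv hR ⟨j, by omega⟩).neg.congr fun ε hε x => ?_
  rw [inv_mulVec_opL (hW ε hε x) hj]
  ring

/-- The expansion of the envelopes and of their operators. -/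
theorem IsCurve.hasEnvelopeExpansion (hd : 2 ≤ d) (hk : Function.Injective k)
    (hsum : ∑ l, k l = 0) (hG : IsCurve d u G) (hc : IsCommCoeff d u c) :
    HasEnvelopeExpansion d k u G (fun x => limitConst k • opQ d u G x)
      (fun j x => limitConst k * c j x) := by
  obtain ⟨M, hM, hGM⟩ := hG.2.2.1
  obtain ⟨ε₀, hε₀, hε₁, E, hEl, hEF, hEM, -⟩ := hG.exists_envelopeLift hd hk hsum hM hGM
  refine ⟨ε₀, E, fun ε => annCoeff d (E ε), hε₀, fun ε hε =>
    ⟨hEl ε hε, opL_annCoeff (hEl ε hε).1 (hEl ε hε).2.1⟩, fun A => ?_, ?_⟩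
  · choose K hK0 hK using fun a => (hEF a).locO.exists_nonneg A
    refine ⟨∑ a, K a, fun ε hε x hx => ?_⟩
    have := pow_pos hε.1 3
    rw [pi_norm_le_iff_of_nonneg (mul_nonneg (Finset.sum_nonneg fun a _ => hK0 a) this.le)]
    intro a
    refine (hK a ε hε x hx).trans ?_
    gcongr
    exact Finset.single_le_sum (fun a _ => hK0 a) (Finset.mem_univ a)
  · choose! K hK0 hK using fun (j : ℕ) (hj : j < d) =>
      (hG.smoothO_annCoeff hd hc hε₁ _ (fun ε hε => (hEl ε hε).2.1) hEF hj).locO.exists_nonneg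
        (2 * Real.pi)
    refine ⟨∑ j ∈ Finset.range d, K j, fun ε hε j hj x => ?_⟩
    -- The lift is only quasi-periodic, but its operator is periodic, so a bound on one period is
    -- uniform.
    have hper : Function.Periodic (fun x => annCoeff d (E ε) j x -
        (u j x + ε ^ 2 * (limitConst k * c j x))) (2 * Real.pi) := fun x => by
      simp only [annCoeff_periodic (hEl ε hε).1 hM (hEM ε hε), (hG.2.2.2.1 j hj).2 x,
        (hc.1 j hj).2 x]
    obtain ⟨y, hy, hxy⟩ := hper.exists_mem_Ico₀ Real.two_pi_pos x
    have h1 := hK j hj ε hε y (by rw [abs_of_nonneg hy.1]; exact hy.2.le)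
    rw [hxy]
    have := pow_pos hε.1 3
    refine h1.trans ?_
    gcongr
    exact Finset.single_le_sum (fun j hj => hK0 j (Finset.mem_range.mp hj)) (Finset.mem_range.mpr hj)

/-- The velocity of the operators is determined by the curve. -/
theorem IsCurve.velocity_unique (hd : 2 ≤ d) (hk : Function.Injective k)
    (hsum : ∑ l, k l = 0) (hG : IsCurve d u G) (hc : IsCommCoeff d u c)
    {B : ℝ → Fin (d + 1) → ℝ} {w : ℕ → ℝ → ℝ} (hw : HasEnvelopeExpansion d k u G B w)
    {j : ℕ} (hj : j < d) (x : ℝ) : w j x = limitConst k * c j x := by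
  obtain ⟨M, hM, hGM⟩ := hG.2.2.1
  obtain ⟨ε₀, hε₀, hε₁, E, hEl, hEF, hEM, huniq⟩ := hG.exists_envelopeLift hd hk hsum hM hGM
  obtain ⟨ε₁, E', u', hε₁0, hE', -, K', hK'⟩ := hw
  obtain ⟨K, hK0, hK⟩ := (hG.smoothO_annCoeff hd hc hε₁ _ (fun ε hε => (hEl ε hε).2.1) hEF
    hj).locO.exists_nonneg |x|
  -- Both lifts are proportional and have the same operator. Comparing its two expansions and
  -- dividing by `ε²` leaves `O(ε)`.
  have key : ∀ ε, 0 < ε → ε < ε₀ → ε < ε₁ → |w j x - limitConst k * c j x| ≤ (K + |K'|) * ε := by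
    intro ε h0 h1 h2
    obtain ⟨s, hs, hEs⟩ := huniq ε ⟨h0, h1⟩ _ (hE' ε ⟨h0, h2⟩).1
    have h3 : opL d (u' ε) (E ε) x = 0 := by
      have := (hE' ε ⟨h0, h2⟩).2 x
      rw [hEs, opL_const_smul] at this
      exact (smul_eq_zero.mp this).resolve_left hs
    have h4 := annCoeff_unique ((hEl ε ⟨h0, h1⟩).2.1 x) h3 hj
    have h5 := hK ε ⟨h0, h1⟩ x le_rfl
    have h6 := hK' ε ⟨h0, h2⟩ j hj x
    rw [h4] at h6
    have h7 : ε ^ 2 * (w j x - limitConst k * c j x) =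
        (annCoeff d (E ε) j x - (u j x + ε ^ 2 * (limitConst k * c j x))) -
        (annCoeff d (E ε) j x - (u j x + ε ^ 2 * w j x)) := by ring
    have h8 : ε ^ 2 * |w j x - limitConst k * c j x| ≤ ε ^ 2 * ((K + |K'|) * ε) := by
      rw [← abs_of_pos (pow_pos h0 2), ← abs_mul, h7, abs_of_pos (pow_pos h0 2)]
      refine (abs_sub _ _).trans ?_
      have := mul_le_mul_of_nonneg_right (le_abs_self K') (pow_pos h0 3).le
      nlinarith
    exact le_of_mul_le_mul_left h8 (pow_pos h0 2)
  by_contra hne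
  have hpos : 0 < |w j x - limitConst k * c j x| := abs_pos.mpr (sub_ne_zero.mpr hne)
  set δ := |w j x - limitConst k * c j x|
  have hK1 : 0 < K + |K'| + 1 := by positivity
  set ε := min (min (ε₀ / 2) (ε₁ / 2)) (δ / (2 * (K + |K'| + 1)))
  have hε : 0 < ε := by positivity
  have h1 := key ε hε
    (((min_le_left _ _).trans (min_le_left _ _)).trans_lt (half_lt_self hε₀))
    (((min_le_left _ _).trans (min_le_right _ _)).trans_lt (half_lt_self hε₁0))
  have h2 : ε * (2 * (K + |K'| + 1)) ≤ δ := (le_div_iff₀ (by positivity)).mp (min_le_right _ _)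
  nlinarith

end Expansion
end

noncomputable section

/-! ## Linear differential equations -/

section LinearODE
open scoped Manifold NNReal
variable {F : Type*} [NormedAddCommGroup F] [NormedSpace ℝ F]

/-- Global solutions of linear equations with bounded coefficients. -/
lemma exists_linearODE_solution [CompleteSpace F] {A : ℝ → F →L[ℝ] F} (hA : ContDiff ℝ ∞ A)
    {K : ℝ≥0} (hK : ∀ t, ‖A t‖ ≤ K) (y₀ : F) :
    ∃ y : ℝ → F, y 0 = y₀ ∧ ∀ t, HasDerivAt y (A t (y t)) t := by
  -- Time is added as a coordinate, which makes the equation autonomous.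
  set v : (z : ℝ × F) → TangentSpace 𝓘(ℝ, ℝ × F) z := fun z => ((1 : ℝ), A z.1 z.2) with hv
  have hvs : ContDiff ℝ 1 (fun z : ℝ × F => ((1 : ℝ), A z.1 z.2)) := by
    refine contDiff_const.prodMk ?_
    exact ((hA.of_le (by exact_mod_cast le_top)).comp contDiff_fst).clm_apply contDiff_snd
  have hvm : ContMDiff 𝓘(ℝ, ℝ × F) 𝓘(ℝ, ℝ × F).tangent 1
      (fun z => (⟨z, v z⟩ : TangentBundle 𝓘(ℝ, ℝ × F) (ℝ × F))) :=
    contMDiff_vectorSpace_iff_contDiff.mpr hvs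
  -- A lifetime independent of the starting point: on the ball of radius `‖x₀‖ + 1` the speed is at
  -- most `K (2‖x₀‖ + 1)`, and `δ` times this is at most the radius. Uniform lifetimes give global
  -- solutions.
  set δ : ℝ≥0 := 1 / (2 * (K + 1)) with hδ
  have hδ0 : (0 : ℝ) < δ := by rw [hδ]; positivity
  have hloc : ∀ z : ℝ × F, ∃ γ : ℝ → ℝ × F, γ 0 = z ∧
      IsMIntegralCurveOn (I := 𝓘(ℝ, ℝ × F)) γ v (Set.Ioo (-(δ : ℝ)) δ) := by
    rintro ⟨t₀, x₀⟩
    have hmem : t₀ ∈ Set.Icc (t₀ - δ) (t₀ + δ) := ⟨by linarith, by linarith⟩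
    have hPL : IsPicardLindelof (fun t y => A t y) (⟨t₀, hmem⟩ : Set.Icc (t₀ - δ) (t₀ + δ)) x₀
        (‖x₀‖₊ + 1) 0 (K * (2 * ‖x₀‖₊ + 1)) K := by
      refine ⟨fun t _ => ?_, fun x _ => ?_, fun t _ x hx => ?_, ?_⟩
      · exact ((A t).lipschitz.weaken (by exact_mod_cast hK t)).lipschitzOnWith
      · exact (hA.continuous.clm_apply continuous_const).continuousOn
      · refine ((A t).le_of_opNorm_le (hK t) x).trans ?_
        rw [mem_closedBall_iff_norm] at hx
        have h1 : ‖x‖ ≤ ‖x - x₀‖ + ‖x₀‖ := by simpa using norm_add_le (x - x₀) x₀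
        push_cast at hx ⊢
        gcongr
        linarith
      · simp only [add_sub_cancel_left, sub_sub_cancel, max_self, hδ]
        push_cast
        rw [sub_zero, mul_one_div, div_le_iff₀ (by positivity)]
        have := NNReal.coe_nonneg K
        have := norm_nonneg x₀
        nlinarith
    obtain ⟨α, hα0, hα⟩ := hPL.exists_eq_forall_mem_Icc_hasDerivWithinAt₀
    refine ⟨fun s => (s + t₀, α (s + t₀)), by simp [hα0], fun s hs => ?_⟩
    have hs' : s + t₀ ∈ Set.Ioo (t₀ - δ) (t₀ + δ) := ⟨by linarith [hs.1], by linarith [hs.2]⟩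
    have h1 := (hα (s + t₀) (Set.Ioo_subset_Icc_self hs')).hasDerivAt (Icc_mem_nhds hs'.1 hs'.2)
    have h2 : HasDerivAt (fun s => (s + t₀, α (s + t₀))) ((1 : ℝ), A (s + t₀) (α (s + t₀))) s :=
      ((hasDerivAt_id s).add_const t₀).prodMk (h1.comp_add_const s t₀)
    exact hasMFDerivWithinAt_iff_hasFDerivWithinAt.mpr h2.hasFDerivAt.hasFDerivWithinAt
  obtain ⟨γ, hγ0, hγ⟩ := exists_isMIntegralCurve_of_isMIntegralCurveOn hvm hδ0 hloc ((0 : ℝ), y₀)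
  have hγd : ∀ t, HasDerivAt γ ((1 : ℝ), A (γ t).1 (γ t).2) t := fun t => by
    have h : HasFDerivAt γ ((1 : ℝ →L[ℝ] ℝ).smulRight ((1 : ℝ), A (γ t).1 (γ t).2)) t :=
      hasMFDerivAt_iff_hasFDerivAt.mp (hγ t)
    simpa using h.hasDerivAt
  have hfst : ∀ t, (γ t).1 = t := by
    have h1 : ∀ t, HasDerivAt (fun t => (γ t).1 - t) 0 t := fun t => by
      have h2 : HasDerivAt (fun t => (γ t).1) 1 t := by
        exact (hasFDerivAt_fst (𝕜 := ℝ) (p := γ t)).comp_hasDerivAt t (hγd t)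
      exact (h2.sub (hasDerivAt_id t)).congr_deriv (sub_self 1)
    intro t
    have := is_const_of_deriv_eq_zero (fun t => (h1 t).differentiableAt) (fun t => (h1 t).deriv) t 0
    simp only [hγ0, sub_zero] at this
    linarith
  refine ⟨fun t => (γ t).2, by simp [hγ0], fun t => ?_⟩
  have := (hasFDerivAt_snd (𝕜 := ℝ) (p := γ t)).comp_hasDerivAt t (hγd t)
  rw [hfst] at this
  exact this

lemma linearODE_unique {A : ℝ → F →L[ℝ] F} {K : ℝ≥0} (hK : ∀ t, ‖A t‖ ≤ K) {y z : ℝ → F}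
    (hy : ∀ t, HasDerivAt y (A t (y t)) t) (hz : ∀ t, HasDerivAt z (A t (z t)) t)
    (h0 : y 0 = z 0) : y = z :=
  ODE_solution_unique_univ (v := fun t y => A t y) (s := fun _ => Set.univ) (K := K)
    (fun t => ((A t).lipschitz.weaken (by exact_mod_cast hK t)).lipschitzOnWith)
    (fun t => ⟨hy t, trivial⟩) (fun t => ⟨hz t, trivial⟩) h0

end LinearODE

/-! ### The companion system and the existence of normalized curves -/

section Companion
variable {d : ℕ} {u : ℕ → ℝ → ℝ}
open scoped NNReal

/-- The companion system of `L f = 0`. -/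
def companion (d : ℕ) (u : ℕ → ℝ → ℝ) (t : ℝ) : (Fin (d + 1) → ℝ) →L[ℝ] (Fin (d + 1) → ℝ) :=
  (ContinuousLinearMap.pi fun j : Fin (d + 1) =>
    if h : (j : ℕ) < d then ContinuousLinearMap.proj ⟨j + 1, by omega⟩ else 0) +
  ∑ i : Fin d, u i t • ContinuousLinearMap.pi fun j : Fin (d + 1) =>
    if (j : ℕ) < d then 0 else -ContinuousLinearMap.proj (R := ℝ) (φ := fun _ => ℝ) i.castSucc

lemma companion_apply_lt (t : ℝ) (y : Fin (d + 1) → ℝ) {j : ℕ} (hj : j < d) :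
    companion d u t y ⟨j, by omega⟩ = y ⟨j + 1, by omega⟩ := by
  simp [companion, hj, Finset.sum_apply]

lemma companion_apply_last (t : ℝ) (y : Fin (d + 1) → ℝ) :
    companion d u t y (Fin.last d) = -∑ i : Fin d, u i t * y i.castSucc := by
  simp [companion, Finset.sum_apply]

lemma contDiff_companion (hu : SmoothPeriodic d u) : ContDiff ℝ ∞ (companion d u) :=
  contDiff_const.add (ContDiff.sum fun i _ => (hu i i.2).1.smul contDiff_const)

lemma exists_bound_companion (hu : SmoothPeriodic d u) : ∃ K : ℝ≥0, ∀ t, ‖companion d u t‖ ≤ K := by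
  obtain ⟨K, hK⟩ := (isCompact_Icc (a := (0 : ℝ)) (b := 2 * Real.pi)).exists_bound_of_continuousOn
    (contDiff_companion hu).continuous.continuousOn
  refine ⟨K.toNNReal, fun t => ?_⟩
  have hper : Function.Periodic (companion d u) (2 * Real.pi) := fun t => by
    simp only [companion, fun i : Fin d => (hu i i.2).2 t]
  obtain ⟨s, hs, hts⟩ := hper.exists_mem_Ico₀ Real.two_pi_pos t
  rw [hts]
  exact (hK s (Set.Ico_subset_Icc_self hs)).trans (Real.le_coe_toNNReal K)

/-- The jet of a solution of `L f = 0` solves the companion system. -/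
lemma hasDerivAt_jet {f : ℝ → ℝ} (hf : ContDiff ℝ ∞ f) (hL : ∀ x, opL d u f x = 0) (x : ℝ) :
    HasDerivAt (fun x => fun j : Fin (d + 1) => iteratedDeriv (j : ℕ) f x)
      (companion d u x fun j : Fin (d + 1) => iteratedDeriv (j : ℕ) f x) x := by
  rw [hasDerivAt_pi]
  intro j
  refine (hasDerivAt_iteratedDeriv hf j x).congr_deriv ?_
  by_cases hj : (j : ℕ) < d
  · exact (companion_apply_lt (u := u) x (fun j => iteratedDeriv (j : ℕ) f x) hj).symm
  · obtain rfl : j = Fin.last d := Fin.ext (by simp; omega)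
    rw [companion_apply_last]
    have := hL x
    simp only [opL, smul_eq_mul, Finset.sum_range] at this
    exact eq_neg_of_add_eq_zero_left this

lemma opL_eq_zero_unique (hu : SmoothPeriodic d u) {f g : ℝ → ℝ} (hf : ContDiff ℝ ∞ f)
    (hg : ContDiff ℝ ∞ g) (hLf : ∀ x, opL d u f x = 0) (hLg : ∀ x, opL d u g x = 0)
    (h0 : ∀ j < d + 1, iteratedDeriv j f 0 = iteratedDeriv j g 0) : f = g := by
  obtain ⟨K, hK⟩ := exists_bound_companion hu
  have h := linearODE_unique hK (hasDerivAt_jet hf hLf) (hasDerivAt_jet hg hLg)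
    (funext fun j => h0 j j.2)
  ext x
  simpa using congrFun (congrFun h x) 0

lemma exists_opL_eq_zero (hu : SmoothPeriodic d u) (y₀ : Fin (d + 1) → ℝ) :
    ∃ f : ℝ → ℝ, ContDiff ℝ ∞ f ∧ (∀ x, opL d u f x = 0) ∧
      ∀ j : Fin (d + 1), iteratedDeriv (j : ℕ) f 0 = y₀ j := by
  obtain ⟨K, hK⟩ := exists_bound_companion hu
  obtain ⟨y, hy0, hy⟩ := exists_linearODE_solution (contDiff_companion hu) hK y₀
  have hys : ContDiff ℝ ∞ y := by
    rw [contDiff_infty]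
    intro n
    induction n with
    | zero => exact contDiff_zero.mpr (continuous_iff_continuousAt.mpr fun t => (hy t).continuousAt)
    | succ n ih =>
      rw [show ((n + 1 : ℕ) : WithTop ℕ∞) = n + 1 by push_cast; rfl, contDiff_succ_iff_deriv]
      refine ⟨fun t => (hy t).differentiableAt, by simp, ?_⟩
      rw [show deriv y = fun t => companion d u t (y t) from funext fun t => (hy t).deriv]
      exact ((contDiff_companion hu).of_le (by exact_mod_cast le_top)).clm_apply ih
  have hjet : ∀ j : ℕ, ∀ hj : j < d + 1, iteratedDeriv j (fun t => y t 0) = fun t => y t ⟨j, hj⟩ := by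
    intro j
    induction j with
    | zero => intro _; simp
    | succ j ih =>
      intro hj
      ext t
      rw [iteratedDeriv_succ, ih (by omega), (hasDerivAt_pi.mp (hy t) ⟨j, by omega⟩).deriv,
        companion_apply_lt t _ (by omega)]
  refine ⟨fun t => y t 0, contDiff_pi.mp hys 0, fun x => ?_, fun j => ?_⟩
  · simp only [opL, smul_eq_mul]
    rw [iteratedDeriv_succ, hjet d (by omega), (hasDerivAt_pi.mp (hy x) ⟨d, by omega⟩).deriv]
    rw [show (⟨d, by omega⟩ : Fin (d + 1)) = Fin.last d from rfl, companion_apply_last,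
      Finset.sum_range, neg_add_eq_zero]
    refine Finset.sum_congr rfl fun i _ => ?_
    rw [hjet i (by omega)]
    rfl
  · rw [hjet j j.2]
    exact congrFun hy0 j

lemma opL_comp_add {f : ℝ → ℝ} {T : ℝ} (hu : ∀ j < d, Function.Periodic (u j) T) (x : ℝ) :
    opL d u (fun y => f (y + T)) x = opL d u f (x + T) := by
  simp only [opL, iteratedDeriv_comp_add_const]
  congr 1
  exact Finset.sum_congr rfl fun j hj => by rw [hu j (Finset.mem_range.mp hj)]

/-- Every operator annihilates a normalized quasi-periodic curve. -/
theorem exists_isCurve (hu : SmoothPeriodic d u) :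
    ∃ G : ℝ → Fin (d + 1) → ℝ, IsCurve d u G := by
  choose f hfs hfL hf0 using fun a : Fin (d + 1) => exists_opL_eq_zero hu (Pi.single a 1)
  set G : ℝ → Fin (d + 1) → ℝ := fun x a => f a x with hGdef
  have hGs : ContDiff ℝ ∞ G := contDiff_pi.mpr hfs
  have hGL : ∀ x, opL d u G x = 0 := fun x => by
    ext a
    rw [opL_apply u hGs]
    exact hfL a x
  have hG0 : wmat d G 0 = 1 := by
    ext a j
    change iteratedDeriv (j : ℕ) G 0 a = _
    rw [iteratedDeriv_pi_apply hGs, Matrix.one_apply]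
    change iteratedDeriv (j : ℕ) (f a) 0 = _
    rw [hf0 a j, Pi.single_apply]
    simp only [eq_comm]
  -- Liouville's formula without a term `∂^d`: the Wronskian is constant, and the initial jets were
  -- chosen to make it `1`.
  have hW : ∀ x, wronskian d G x = 1 := by
    have h1 : ∀ x, HasDerivAt (wronskian d G) 0 x := fun x => by
      refine (hasDerivAt_wronskian hGs x).congr_deriv ?_
      have h2 : iteratedDeriv (d + 1) G x =
          wmat d G x *ᵥ Fin.snoc (α := fun _ => ℝ) (fun i : Fin d => -u i x) 0 := by
        rw [wmat_mulVec, Fin.sum_univ_castSucc, Fin.snoc_last, zero_smul, add_zero,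
          eq_neg_of_add_eq_zero_left (hGL x), Finset.sum_range, ← Finset.sum_neg_distrib]
        refine Finset.sum_congr rfl fun i _ => ?_
        rw [Fin.snoc_castSucc, neg_smul]
        rfl
      rw [← Matrix.cramer_apply, h2, Matrix.cramer_eq_adjugate_mulVec, Matrix.mulVec_mulVec,
        Matrix.adjugate_mul, Matrix.smul_mulVec, Matrix.one_mulVec, Pi.smul_apply, Fin.snoc_last,
        smul_zero]
    intro x
    rw [is_const_of_deriv_eq_zero (fun x => (h1 x).differentiableAt) (fun x => (h1 x).deriv) x 0]
    change (wmat d G 0).det = 1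
    rw [hG0, Matrix.det_one]
  refine ⟨G, hGs, hW, ⟨wmat d G (2 * Real.pi), hW _, fun x => ?_⟩, hu, hGL⟩
  ext a
  have hgs : ContDiff ℝ ∞ fun x => (wmat d G (2 * Real.pi) *ᵥ G x) a := by
    change ContDiff ℝ ∞ fun x => ∑ b, wmat d G (2 * Real.pi) a b * f b x
    exact ContDiff.sum fun b _ => contDiff_const.mul (hfs b)
  have hgd : ∀ j x, iteratedDeriv j (fun x => (wmat d G (2 * Real.pi) *ᵥ G x) a) x =
      (wmat d G (2 * Real.pi) *ᵥ iteratedDeriv j G x) a := by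
    intro j x
    simp only [Matrix.mulVec, dotProduct]
    rw [iteratedDeriv_fun_sum fun b _ => contDiffAt_of_infty (contDiff_const.mul (hfs b)) j x]
    refine Finset.sum_congr rfl fun b _ => ?_
    rw [iteratedDeriv_const_mul_field, iteratedDeriv_pi_apply hGs]
  -- Both sides solve `Lf = 0`, the left one by periodicity of `u`, and have equal jets at `0`. The
  -- monodromy is the Wronskian matrix at `2π` because that at `0` is the identity.
  have key : (fun x => f a (x + 2 * Real.pi)) = fun x => (wmat d G (2 * Real.pi) *ᵥ G x) a := by
    refine opL_eq_zero_unique hu ((hfs a).comp (contDiff_id.add contDiff_const)) hgs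
      (fun x => ?_) (fun x => ?_) (fun j hj => ?_)
    · rw [opL_comp_add fun j hj => (hu j hj).2]
      exact hfL a _
    · have h1 : opL d u (fun x => (wmat d G (2 * Real.pi) *ᵥ G x) a) x =
          (wmat d G (2 * Real.pi) *ᵥ opL d u G x) a := by
        simp only [opL, hgd, Matrix.mulVec_add, Matrix.mulVec_sum, Matrix.mulVec_smul,
          Pi.add_apply, Finset.sum_apply, Pi.smul_apply]
      rw [h1, hGL, Matrix.mulVec_zero, Pi.zero_apply]
    · rw [hgd, iteratedDeriv_comp_add_const]
      have h2 : iteratedDeriv j G 0 = Pi.single (⟨j, hj⟩ : Fin (d + 1)) 1 := by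
        ext b
        have := congrFun (congrFun hG0 b) ⟨j, hj⟩
        rw [Pi.single_apply, ← Matrix.one_apply, ← this]
        rfl
      rw [h2, Matrix.mulVec_single_one]
      beta_reduce
      rw [zero_add, ← iteratedDeriv_pi_apply hGs]
      rfl
  exact congrFun key x

end Companion
end

noncomputable section

/-! ## Arithmetic progressions and tuples of differences -/

lemma mem_arithProg {a : ℤ} {m n : ℕ} {x : ℤ} :
    x ∈ arithProg a m n ↔ ∃ i < n, x = a + m * (i : ℤ) := by
  simp only [arithProg, Finset.mem_image, Finset.mem_range, eq_comm]

lemma mem_dualProg {a : ℤ} {m d p : ℕ} (hp : p ≤ d + 1) {x : ℤ} :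
    x ∈ dualProg m d a p ↔ ∃ i < d + 1 - p, x = a - m * (i : ℤ) := by
  rw [dualProg, mem_arithProg]
  constructor
  · rintro ⟨i, hi, rfl⟩
    refine ⟨d - p - i, by omega, ?_⟩
    rw [show ((d - p - i : ℕ) : ℤ) = d - p - i by omega]
    ring
  · rintro ⟨i, hi, rfl⟩
    refine ⟨d - p - i, by omega, ?_⟩
    rw [show ((d - p - i : ℕ) : ℤ) = d - p - i by omega]
    ring

lemma card_arithProg {m : ℕ} (hm : 1 ≤ m) (a : ℤ) (n : ℕ) : (arithProg a m n).card = n := by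
  rw [arithProg, Finset.card_image_of_injective, Finset.card_range]
  intro i j h
  simpa [show m ≠ 0 by omega] using h

/-- A common element `a - m i = b - m j` would give `a + m j = b + m i`. Here `i ≤ d - p = q - 2`
and `j ≤ p - 2`, so this number lies in both original progressions. -/
lemma disjoint_dualProg {m d p q : ℕ} {a b : ℤ} (hp : 1 ≤ p) (hq : 1 ≤ q) (hpq : p + q = d + 2)
    (hJ : Disjoint (arithProg a m p) (arithProg b m q)) :
    Disjoint (dualProg m d a p) (dualProg m d b q) := by
  rw [Finset.disjoint_left] at hJ ⊢
  intro x hx hy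
  obtain ⟨i, hi, rfl⟩ := (mem_dualProg (by omega)).mp hx
  obtain ⟨j, hj, hij⟩ := (mem_dualProg (by omega)).mp hy
  exact hJ (mem_arithProg.mpr ⟨j, by omega, rfl⟩)
    (mem_arithProg.mpr ⟨i, by omega, by linear_combination hij⟩)

lemma card_dualProg_union {m d p q : ℕ} {a b : ℤ} (hm : 1 ≤ m) (hp : 1 ≤ p) (hq : 1 ≤ q)
    (hpq : p + q = d + 2) (hJ : Disjoint (arithProg a m p) (arithProg b m q)) :
    (dualProg m d a p ∪ dualProg m d b q).card = d := by
  rw [Finset.card_union_of_disjoint (disjoint_dualProg hp hq hpq hJ), dualProg, dualProg,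
    card_arithProg hm, card_arithProg hm]
  omega

lemma isLongDiagonal_intersectionTuple {m d p q : ℕ} {a b : ℤ} (hp : 1 ≤ p) (hq : 1 ≤ q)
    (hpq : p + q = d + 2) (hJ : Disjoint (arithProg a m p) (arithProg b m q)) :
    IsLongDiagonal m d (jumpTuple m d) (intersectionTuple m d a b p q) :=
  ⟨rfl, _, _, _, _, by omega, disjoint_dualProg hp hq hpq hJ, rfl⟩

lemma offset_zero (I : List ℕ) : offset I 0 = 0 := by simp [offset]

lemma offset_replicate {d m l : ℕ} (hl : l < d) :
    offset (List.replicate (d - 1) m) l = m * (l : ℤ) := by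
  rw [offset, List.take_replicate, List.sum_replicate, min_eq_left (by omega), smul_eq_mul]
  push_cast
  ring

lemma offset_reverse_add (I : List ℕ) (l : ℕ) :
    offset I.reverse l + offset I (I.length - l) = (I.sum : ℤ) := by
  rw [offset, offset, List.take_reverse, List.sum_reverse, add_comm, ← Nat.cast_add,
    List.sum_take_add_sum_drop]

lemma length_differences (S : Finset ℤ) : (differences S).length = S.card - 1 := by
  simp [differences]

/-- The offsets of the tuple of differences are the elements of the set, translated. -/
lemma offset_differences {S : Finset ℤ} {d : ℕ} (hS : S.card = d) (hd : 0 < d) (l : Fin d) :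
    offset (differences S) l = S.orderEmbOfFin hS l - S.orderEmbOfFin hS ⟨0, hd⟩ := by
  obtain ⟨l, hl⟩ := l
  induction l with
  | zero => simp [offset_zero]
  | succ l ih =>
    have hlt : l < (differences S).length := by rw [length_differences]; omega
    have hmono : S.orderEmbOfFin hS ⟨l, by omega⟩ ≤ S.orderEmbOfFin hS ⟨l + 1, hl⟩ :=
      (S.orderEmbOfFin hS).monotone (by simp)
    have ih' := ih (by omega)
    simp only [offset] at ih' ⊢
    rw [List.sum_take_succ _ _ hlt]
    rw [Nat.cast_add, ih']
    have h1 : ((differences S)[l] : ℤ) =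
        S.orderEmbOfFin hS ⟨l + 1, hl⟩ - S.orderEmbOfFin hS ⟨l, by omega⟩ := by
      simp only [Finset.orderEmbOfFin_apply] at hmono ⊢
      simp only [differences, List.getElem_zipWith, List.getElem_tail]
      rw [Int.toNat_of_nonneg (by simpa using hmono)]
      rfl
    rw [h1]
    ring

lemma offset_differences_strictMono {S : Finset ℤ} {d : ℕ} (hS : S.card = d) :
    StrictMono fun l : Fin d => offset (differences S) l := by
  intro l l' h
  have hd : 0 < d := l.pos
  simp only [offset_differences hS hd]
  have := (S.orderEmbOfFin hS).strictMono h
  linarith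

/-- Offsets start at `0` and not at the least element of `S`; that element is the fixed index shift
of the realization. -/
lemma iInf_offset_differences {α : Type*} [CompleteLattice α] {S : Finset ℤ} {d : ℕ}
    (hS : S.card = d) (hd : 0 < d) (f : ℤ → α) (k : ℤ) :
    ⨅ l : Fin d, f (k + S.orderEmbOfFin hS ⟨0, hd⟩ + offset (differences S) l) =
      ⨅ s ∈ S, f (k + s) := by
  simp only [offset_differences hS hd, add_assoc, add_sub_cancel]
  apply le_antisymm
  · refine le_iInf₂ fun s hs => ?_
    rw [← Finset.mem_coe, ← Finset.range_orderEmbOfFin S hS] at hs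
    obtain ⟨l, rfl⟩ := hs
    exact iInf_le _ l
  · exact le_iInf fun l => iInf₂_le _ (Finset.orderEmbOfFin_mem S hS l)

/-! ## Centered offsets -/

lemma sum_centeredOffset {d : ℕ} (hd : 0 < d) (I : List ℕ) : ∑ l, centeredOffset d I l = 0 := by
  have : (d : ℝ) ≠ 0 := by positivity
  simp only [centeredOffset, Finset.sum_sub_distrib, Finset.sum_const, Finset.card_univ,
    Fintype.card_fin, nsmul_eq_mul]
  field_simp
  ring

lemma centeredOffset_reverse_injective {S : Finset ℤ} {d : ℕ} (hS : S.card = d) :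
    Function.Injective (centeredOffset d (differences S).reverse) := by
  intro l l' h
  simp only [centeredOffset, sub_left_inj, Int.cast_inj] at h
  have hlen : (differences S).length = d - 1 := by rw [length_differences, hS]
  have h1 := offset_reverse_add (differences S) l
  have h2 := offset_reverse_add (differences S) l'
  rw [hlen] at h1 h2
  have h3 := (offset_differences_strictMono hS).injective (a₁ := ⟨d - 1 - l, by omega⟩)
    (a₂ := ⟨d - 1 - l', by omega⟩) (by dsimp only; omega)
  rw [Fin.mk.injEq] at h3
  omega

/-- At least two distinct nodes exist, so they cannot all vanish. -/
lemma limitConst_pos {d : ℕ} (hd : 2 ≤ d) {k : Fin d → ℝ} (hk : Function.Injective k) :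
    0 < limitConst k := by
  have h1 : (2 : ℝ) ≤ d := by exact_mod_cast hd
  refine div_pos ?_ (mul_pos two_pos (mul_pos (by linarith) (by linarith)))
  refine lt_of_le_of_ne (Finset.sum_nonneg fun l _ => sq_nonneg _) fun h => ?_
  have h2 : ∀ l, k l = 0 := fun l => by
    simpa using (Finset.sum_eq_zero_iff_of_nonneg fun l _ => sq_nonneg (k l)).mp h.symm l
  have h3 := hk ((h2 ⟨0, by omega⟩).trans (h2 ⟨1, by omega⟩).symm)
  simp at h3

/-! ## The inverse map -/

section Inverse
variable {d : ℕ} {I R : List ℕ} {v v' v'' : PolygonIn (Fin (d + 1) → ℝ)}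

lemma finrank_iSup_submodule {E ι : Type} [AddCommGroup E] [Module ℝ E] [Fintype ι]
    {v : ι → ℙ ℝ E} (hv : Projectivization.Independent v) :
    Module.finrank ℝ (⨆ l, (v l).submodule : Submodule ℝ E) = Fintype.card ι := by
  have h : ⨆ l, (v l).submodule = Submodule.span ℝ (Set.range (Projectivization.rep ∘ v)) := by
    rw [Submodule.span_range_eq_iSup]
    exact iSup_congr fun l => Projectivization.submodule_eq _
  rw [h]
  exact finrank_span_eq_card (Projectivization.independent_iff.mp hv)

lemma IsPentagramImage.finrank_diagHyperplane (h : IsPentagramImage d I R v v') (k : ℤ) :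
    Module.finrank ℝ (diagHyperplane d I v k) = d := by
  rw [diagHyperplane, finrank_iSup_submodule (h.1 k), Fintype.card_fin]

/-- Each `v'_k` lies on the hyperplanes that define it, so the `d` points of `v'` taken with jumps
`R*` from `k` all lie on `P_{k+∑R}` and, being independent, span it. Likewise `v_{k+∑I+∑R}` lies on
all the hyperplanes that cut out `v''_k`. -/
lemma IsPentagramImage.comp_reverse (hI : I.length = d - 1) (hR : R.length = d - 1)
    (h : IsPentagramImage d I R v v') (h' : IsPentagramImage d R.reverse I.reverse v' v'') :
    v'' = shiftPolygon (I.sum + R.sum) v := by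
  have hP : ∀ k, diagHyperplane d R.reverse v' k = diagHyperplane d I v (k + R.sum) := fun k => by
    refine Submodule.eq_of_le_of_finrank_eq (iSup_le fun l => ?_)
      ((h'.finrank_diagHyperplane k).trans (h.finrank_diagHyperplane _).symm)
    rw [h.2]
    have h1 := offset_reverse_add R l
    rw [hR] at h1
    refine (iInf_le _ (⟨d - 1 - l, by omega⟩ : Fin d)).trans_eq ?_
    rw [add_assoc, h1]
  funext k
  refine Projectivization.submodule_injective (Submodule.eq_of_le_of_finrank_eq ?_ ?_).symm
  · rw [h'.2 k]
    refine le_iInf fun l => ?_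
    rw [hP]
    have h1 := offset_reverse_add I l
    rw [hI] at h1
    refine le_trans (le_of_eq ?_) (le_iSup _ (⟨d - 1 - l, by omega⟩ : Fin d))
    rw [shiftPolygon]
    congr 2
    linarith
  · rw [Projectivization.finrank_submodule, Projectivization.finrank_submodule]

lemma areInverseUpToShift_reverse (hI : I.length = d - 1) (hR : R.length = d - 1) :
    AreInverseUpToShift d I R R.reverse I.reverse := by
  refine ⟨I.sum + R.sum, fun v v' v'' => ⟨fun h h' => h.comp_reverse hI hR h', fun h h' => ?_⟩⟩
  have := h.comp_reverse (v'' := v'') (by simpa using hR) (by simpa using hI) (by simpa using h')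
  rw [List.sum_reverse, List.sum_reverse] at this
  rw [this]
  funext k
  simp only [shiftPolygon, add_comm (R.sum : ℤ)]

end Inverse
end

noncomputable section

/-! ## Refactorization -/

section Refactorization
variable {N : ℕ} {Jm Jp : Finset ℤ} {a a' : ℤ → ℤ → ℝ}

lemma diffOp_apply (J : Finset ℤ) (a : ℤ → ℤ → ℝ) (V : ℤ → Fin N → ℝ) (i : ℤ) (c : Fin N) :
    diffOp J a V i c = diffOp J a (fun i => V i c) i := by
  simp [diffOp, Finset.sum_apply]

lemma diffOp_union {E : Type} [AddCommGroup E] [Module ℝ E] (hJ : Disjoint Jm Jp)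
    (a : ℤ → ℤ → ℝ) (V : ℤ → E) : diffOp (Jm ∪ Jp) a V = diffOp Jm a V + diffOp Jp a V :=
  funext fun _ => Finset.sum_union hJ

lemma diffOp_neg {E : Type} [AddCommGroup E] [Module ℝ E] (J : Finset ℤ) (a : ℤ → ℤ → ℝ)
    (V : ℤ → E) : diffOp J a (-V) = -diffOp J a V :=
  funext fun _ => by simp [diffOp]

lemma IsRefactorization.apply (h : IsRefactorization Jm Jp a a') (V : ℤ → Fin N → ℝ) :
    diffOp Jp a' (diffOp Jm a V) = diffOp Jm a' (diffOp Jp a V) := by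
  funext i c
  rw [diffOp_apply, diffOp_apply]
  simp only [diffOp_apply _ a V]
  exact congrFun (h fun i => V i c) i

lemma diffOp_ne_zero {E : Type} [AddCommGroup E] [Module ℝ E] {J : Finset ℤ} {V : ℤ → E} {i j : ℤ}
    (hV : LinearIndependent ℝ fun j : J => V (i + j)) (hj : j ∈ J) (haj : a j i ≠ 0) :
    diffOp J a V i ≠ 0 := by
  intro h
  rw [diffOp, ← Finset.sum_coe_sort] at h
  exact haj (Fintype.linearIndependent_iff.mp hV (fun j => a j i) h ⟨j, hj⟩)

lemma diffOp_mem_spanAt {E : Type} [AddCommGroup E] [Module ℝ E] {J : Finset ℤ} {V : ℤ → E}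
    {v : PolygonIn E} (hV : ∀ i, V i ∈ (v i).submodule) (i : ℤ) :
    diffOp J a V i ∈ spanAt J v i :=
  Submodule.sum_mem _ fun j hj => Submodule.smul_mem _ _
    (Submodule.mem_iSup_of_mem j (Submodule.mem_iSup_of_mem hj (hV _)))

/-- The image of a polygon under the map of a pair corresponds to the refactored operators. -/
theorem OperatorOf.pairImage {v v' : PolygonIn (Fin N → ℝ)} (hJ : Disjoint Jm Jp)
    (ha : ∀ i, ∃ j ∈ Jm ∪ Jp, a j i ≠ 0) (href : IsRefactorization Jm Jp a a')
    (hop : OperatorOf (Jm ∪ Jp) a v) (him : IsPairImage Jm Jp v v') :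
    OperatorOf (Jm ∪ Jp) a' v' := by
  obtain ⟨V, hV0, hVv, hDV⟩ := hop
  obtain ⟨-, hm, hp, hv'⟩ := him
  have hmem : ∀ i, V i ∈ (v i).submodule := fun i => by
    rw [hVv, Projectivization.submodule_mk]
    exact Submodule.mem_span_singleton_self _
  have hind : ∀ {J : Finset ℤ}, (∀ i, Projectivization.Independent fun j : J => v (i + j)) →
      ∀ i, LinearIndependent ℝ fun j : J => V (i + j) := fun {J} h i => by
    have h1 : (fun j : J => v (i + j)) = fun j : J => Projectivization.mk ℝ (V (i + j)) (hV0 _) :=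
      funext fun j => hVv _
    have h2 := h i
    rw [h1, Projectivization.independent_iff_iSupIndep] at h2
    simp only [Projectivization.submodule_mk] at h2
    exact (iSupIndep_iff_linearIndependent_of_ne_zero (R := ℝ) fun j : J => hV0 (i + j)).mp h2
  -- This common value `D₋V = -D₊V` is the lift of the image: it lies in both spans, and the
  -- refactorization relation makes `D'` annihilate it.
  have hneg : diffOp Jm a V = -diffOp Jp a V :=
    eq_neg_of_add_eq_zero_left ((diffOp_union hJ a V).symm.trans hDV)
  have hW0 : ∀ i, diffOp Jm a V i ≠ 0 := fun i => by
    obtain ⟨j, hj, haj⟩ := ha i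
    rcases Finset.mem_union.mp hj with hj | hj
    · exact diffOp_ne_zero (hind hm i) hj haj
    · rw [hneg, Pi.neg_apply, neg_ne_zero]
      exact diffOp_ne_zero (hind hp i) hj haj
  refine ⟨diffOp Jm a V, hW0, fun i => ?_, ?_⟩
  · have h1 : diffOp Jm a V i ∈ (v' i).submodule := by
      rw [hv' i]
      refine ⟨diffOp_mem_spanAt hmem i, ?_⟩
      rw [hneg]
      exact Submodule.neg_mem _ (diffOp_mem_spanAt hmem i)
    refine (Projectivization.submodule_injective (Submodule.eq_of_le_of_finrank_eq ?_ ?_)).symm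
    · rw [Projectivization.submodule_mk, Submodule.span_singleton_le_iff_mem]
      exact h1
    · rw [Projectivization.finrank_submodule, Projectivization.finrank_submodule]
  · rw [diffOp_union hJ, href.apply, hneg, diffOp_neg, neg_add_cancel]

end Refactorization

/-! ## The long-diagonal realization -/

section Codim
variable {E ι : Type*} [AddCommGroup E] [Module ℝ E] [FiniteDimensional ℝ E]

lemma finrank_le_finrank_inf_add_one {A H : Submodule ℝ E}
    (hH : Module.finrank ℝ E ≤ Module.finrank ℝ H + 1) :
    Module.finrank ℝ A ≤ Module.finrank ℝ (A ⊓ H : Submodule ℝ E) + 1 := by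
  have h1 := Submodule.finrank_sup_add_finrank_inf_eq A H
  have h2 := Submodule.finrank_le (A ⊔ H)
  omega

lemma finrank_le_finrank_inf_add_card [DecidableEq ι] (A : Submodule ℝ E)
    (H : ι → Submodule ℝ E) (S : Finset ι)
    (hH : ∀ s ∈ S, Module.finrank ℝ E ≤ Module.finrank ℝ (H s) + 1) :
    Module.finrank ℝ A ≤ Module.finrank ℝ (A ⊓ ⨅ s ∈ S, H s : Submodule ℝ E) + S.card := by
  induction S using Finset.induction_on with
  | empty =>
    have h : (⨅ s ∈ (∅ : Finset ι), H s) = ⊤ := iInf₂_eq_top.mpr fun s hs => by simp at hs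
    rw [h, inf_top_eq]
    exact Nat.le_add_right _ _
  | insert s S hs ih =>
    rw [Finset.iInf_insert, Finset.card_insert_of_notMem hs, inf_left_comm, inf_comm]
    have h1 := ih fun t ht => hH t (Finset.mem_insert_of_mem ht)
    have h2 := finrank_le_finrank_inf_add_one (A := A ⊓ ⨅ s ∈ S, H s)
      (hH s (Finset.mem_insert_self s S))
    omega

end Codim

section Realization
variable {m d p q : ℕ} {a b : ℤ} {R : List ℕ} {v v' : PolygonIn (Fin (d + 1) → ℝ)}

lemma spanAt_eq_iSup {E : Type} [AddCommGroup E] [Module ℝ E] (J : Finset ℤ) (v : PolygonIn E)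
    (i : ℤ) : spanAt J v i = ⨆ j : J, (v (i + j)).submodule := by
  rw [spanAt, iSup_subtype']

lemma independent_arithProg {i : ℤ}
    (h : Projectivization.Independent fun l : Fin p => v (i + a + m * (l : ℕ))) :
    Projectivization.Independent fun j : arithProg a m p => v (i + j) := by
  rw [Projectivization.independent_iff] at h ⊢
  choose l hl hj using fun j : arithProg a m p => mem_arithProg.mp j.2
  have hinj : Function.Injective fun j : arithProg a m p => (⟨l j, hl j⟩ : Fin p) := by
    intro j j' h
    rw [Fin.mk.injEq] at h
    exact Subtype.ext (by rw [hj j, hj j', h])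
  convert h.comp _ hinj using 1
  funext j
  simp only [Function.comp_apply, hj j, add_assoc]

lemma diagHyperplane_jumpTuple (d m : ℕ) (v : PolygonIn (Fin (d + 1) → ℝ)) (k : ℤ) :
    diagHyperplane d (jumpTuple m d) v k = ⨆ l : Fin d, (v (k + m * (l : ℕ))).submodule :=
  iSup_congr fun l => by rw [jumpTuple, offset_replicate l.2]

lemma submodule_le_diagHyperplane {k i : ℤ} {l : ℕ} (hl : l < d) (hi : i = k + m * (l : ℤ)) :
    (v i).submodule ≤ diagHyperplane d (jumpTuple m d) v k := by
  rw [diagHyperplane_jumpTuple, hi]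
  exact le_iSup (fun l : Fin d => (v (k + m * (l : ℕ))).submodule) ⟨l, hl⟩

/-- The span of the `d + 1` points contains both hyperplanes, hence exceeds the first one and is the
whole space. -/
lemma independent_of_hyperplane_ne {k : ℤ}
    (hP : Module.finrank ℝ (diagHyperplane d (jumpTuple m d) v k) = d)
    (hne : ¬ diagHyperplane d (jumpTuple m d) v (k + m) ≤ diagHyperplane d (jumpTuple m d) v k) :
    Projectivization.Independent fun l : Fin (d + 1) => v (k + m * (l : ℕ)) := by
  rw [Projectivization.independent_iff]
  refine linearIndependent_of_top_le_span_of_card_eq_finrank ?_ (by simp)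
  rw [Submodule.span_range_eq_iSup]
  have h1 : ∀ l : Fin (d + 1), (v (k + m * (l : ℕ))).submodule ≤ ⨆ l : Fin (d + 1),
      Submodule.span ℝ {(Projectivization.rep ∘ fun l : Fin (d + 1) => v (k + m * (l : ℕ))) l} :=
    fun l => (Projectivization.submodule_eq _).trans_le (le_iSup (fun l : Fin (d + 1) =>
      Submodule.span ℝ {(Projectivization.rep ∘ fun l : Fin (d + 1) => v (k + m * (l : ℕ))) l}) l)
  set X := ⨆ l : Fin (d + 1),
      Submodule.span ℝ {(Projectivization.rep ∘ fun l : Fin (d + 1) => v (k + m * (l : ℕ))) l}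
  have h2 : diagHyperplane d (jumpTuple m d) v k ≤ X := by
    rw [diagHyperplane_jumpTuple]
    exact iSup_le fun l => h1 l.castSucc
  have h3 : diagHyperplane d (jumpTuple m d) v (k + m) ≤ X := by
    rw [diagHyperplane_jumpTuple]
    refine iSup_le fun l => le_trans (le_of_eq ?_) (h1 l.succ)
    congr 2
    rw [Fin.val_succ]
    push_cast
    ring
  have h4 : diagHyperplane d (jumpTuple m d) v k < X :=
    lt_of_le_of_ne h2 fun h => hne (h ▸ h3)
  have h5 := Submodule.finrank_lt_finrank_of_lt h4
  refine (Submodule.eq_top_of_finrank_eq (le_antisymm (Submodule.finrank_le X) ?_)).ge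
  rw [Module.finrank_fin_fun]
  omega

/-- The hyperplanes through the points of one progression intersect in the span of these points. -/
lemma independent_and_spanAt_eq (hm : 1 ≤ m) (hd : 2 ≤ d) (hp : 1 ≤ p) (hq : 1 ≤ q)
    (hpq : p + q = d + 2)
    (hI : ∀ k, Projectivization.Independent fun l : Fin d => v (k + offset (jumpTuple m d) l))
    (h1 : ∀ i, Module.finrank ℝ (⨅ r ∈ dualProg m d a p ∪ dualProg m d b q,
      diagHyperplane d (jumpTuple m d) v (i + r) : Submodule ℝ (Fin (d + 1) → ℝ)) = 1) (i : ℤ) :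
    Projectivization.Independent (fun j : arithProg a m p => v (i + j)) ∧
      spanAt (arithProg a m p) v i =
        ⨅ r ∈ dualProg m d a p, diagHyperplane d (jumpTuple m d) v (i + r) := by
  set P := diagHyperplane d (jumpTuple m d) v with hPdef
  have hP : ∀ k, Module.finrank ℝ (P k) = d := fun k => by
    rw [hPdef, diagHyperplane, finrank_iSup_submodule (hI k), Fintype.card_fin]
  have hcodim : ∀ k, Module.finrank ℝ (Fin (d + 1) → ℝ) ≤ Module.finrank ℝ (P k) + 1 := fun k => by
    rw [hP, Module.finrank_fin_fun]
  have hind : Projectivization.Independent fun l : Fin p => v (i + a + m * (l : ℕ)) := by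
    -- For `p ≤ d` the points are among those defining one hyperplane. The remaining case is `p = d
    -- + 1`, `q = 1`, where the intersection of hyperplanes attached to `a` is empty of conditions.
    rcases Nat.lt_or_ge d p with hpd | hpd
    · obtain rfl : p = d + 1 := by omega
      obtain rfl : q = 1 := by omega
      refine independent_of_hyperplane_ne (hP _) fun hle => ?_
      have hmem : ∀ t : ℕ, t ≤ 1 → b - m * (t : ℤ) ∈ dualProg m d b 1 := fun t ht =>
        (mem_dualProg (by omega)).mpr ⟨t, by omega, rfl⟩
      have hb0 := hmem 0 (by omega)
      have hb1 := hmem 1 (by omega)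
      rw [Nat.cast_zero, mul_zero, sub_zero] at hb0
      rw [Nat.cast_one, mul_one] at hb1
      have hne : b ≠ b - m := by omega
      -- At this index the elements `b - m` and `b` give `P_{i+a}` and `P_{i+a+m}`. If the second
      -- were contained in the first, `d - 1` hyperplanes would already meet in a line,
      -- contradicting that they meet in dimension at least `2`.
      have h2 := h1 (i + a - b + m)
      have hempty : dualProg m d a (d + 1) = ∅ := by simp [dualProg, arithProg]
      rw [hempty, Finset.empty_union] at h2
      have h3 := finrank_le_finrank_inf_add_card (⊤ : Submodule ℝ (Fin (d + 1) → ℝ))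
        (fun r => P (i + a - b + m + r)) ((dualProg m d b 1).erase (b - m)) fun s _ => hcodim _
      have h4 : (⨅ r ∈ (dualProg m d b 1).erase (b - m), P (i + a - b + m + r)) ≤
          ⨅ r ∈ dualProg m d b 1, P (i + a - b + m + r) := by
        refine le_iInf₂ fun r hr => ?_
        by_cases hrb : r = b - m
        · refine (iInf₂_le b (Finset.mem_erase.mpr ⟨hne, hb0⟩)).trans ?_
          rw [hrb, show i + a - b + m + b = i + a + m by ring,
            show i + a - b + m + (b - m) = i + a by ring]
          exact hle
        · exact iInf₂_le r (Finset.mem_erase.mpr ⟨hrb, hr⟩)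
      have h5 := Submodule.finrank_mono h4
      rw [h2] at h5
      have h6 : ((dualProg m d b 1).erase (b - m)).card = d - 1 := by
        rw [Finset.card_erase_of_mem hb1, dualProg, card_arithProg hm]
        omega
      rw [top_inf_eq, finrank_top, Module.finrank_fin_fun, h6] at h3
      omega
    · have := hI (i + a)
      rw [Projectivization.independent_iff] at this ⊢
      convert this.comp _ (Fin.castLE_injective hpd) using 1
      funext l
      simp only [Function.comp_apply, jumpTuple, Fin.val_castLE, offset_replicate (l.2.trans_le hpd)]
  have hind' := independent_arithProg hind
  refine ⟨hind', Submodule.eq_of_le_of_finrank_le ?_ ?_⟩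
  · refine iSup₂_le fun j hj => le_iInf₂ fun r hr => ?_
    obtain ⟨l, hl, rfl⟩ := mem_arithProg.mp hj
    obtain ⟨t, ht, rfl⟩ := (mem_dualProg (by omega)).mp hr
    exact submodule_le_diagHyperplane (l := l + t) (by omega) (by push_cast; ring)
  · rw [spanAt_eq_iSup, finrank_iSup_submodule hind', Fintype.card_coe, card_arithProg hm]
    -- Dropping the other progression raises the dimension from `1` by at most `d + 1 - q`, that is
    -- to at most `p`, the dimension of the span.
    have h2 := finrank_le_finrank_inf_add_card (⨅ r ∈ dualProg m d a p, P (i + r))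
      (fun r => P (i + r)) (dualProg m d b q) fun s _ => hcodim _
    rw [← Finset.iInf_union, h1 i, dualProg, dualProg, card_arithProg hm] at h2
    rw [dualProg]
    omega

/-- The long-diagonal map is given by the formula of the pair of progressions. -/
theorem isPairImage_shiftPolygon (hm : 1 ≤ m) (hd : 2 ≤ d) (hp : 1 ≤ p) (hq : 1 ≤ q)
    (hpq : p + q = d + 2) (hJ : Disjoint (arithProg a m p) (arithProg b m q))
    (h : IsPentagramImage d (jumpTuple m d) (intersectionTuple m d a b p q) v v') :
    IsPairImage (arithProg a m p) (arithProg b m q) v (shiftPolygon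
      ((dualProg m d a p ∪ dualProg m d b q).orderEmbOfFin (card_dualProg_union hm hp hq hpq hJ)
        ⟨0, by omega⟩) v') := by
  set s := (dualProg m d a p ∪ dualProg m d b q).orderEmbOfFin (card_dualProg_union hm hp hq hpq hJ)
        ⟨0, by omega⟩ with hs
  have hv' : ∀ i, (shiftPolygon s v' i).submodule = ⨅ r ∈ dualProg m d a p ∪ dualProg m d b q,
      diagHyperplane d (jumpTuple m d) v (i + r) := fun i => by
    rw [shiftPolygon, h.2, intersectionTuple]
    exact iInf_offset_differences _ (by omega) (diagHyperplane d (jumpTuple m d) v) i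
  have h1 : ∀ i, Module.finrank ℝ (⨅ r ∈ dualProg m d a p ∪ dualProg m d b q,
      diagHyperplane d (jumpTuple m d) v (i + r) : Submodule ℝ (Fin (d + 1) → ℝ)) = 1 := fun i => by
    rw [← hv', Projectivization.finrank_submodule]
  have ha := independent_and_spanAt_eq hm hd hp hq hpq h.1 h1
  have hb := independent_and_spanAt_eq hm hd hq hp (by omega) h.1
    (fun i => by rw [Finset.union_comm]; exact h1 i)
  refine ⟨fun i => ?_, fun i => (ha i).1, fun i => (hb i).1, fun i => ?_⟩
  -- Corrugation is automatic in `ℝP^d`, since `|J| - 2 = d`.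
  · rw [Finset.card_union_of_disjoint hJ, card_arithProg hm, card_arithProg hm, hpq]
    have := Submodule.finrank_le (spanAt (arithProg a m p ∪ arithProg b m q) v i)
    rw [Module.finrank_fin_fun] at this
    omega
  · rw [hv', Finset.iInf_union, (ha i).2, (hb i).2]

theorem isRealizedBy_jumpTuple (hm : 1 ≤ m) (hd : 2 ≤ d) (hp : 1 ≤ p) (hq : 1 ≤ q)
    (hpq : p + q = d + 2) (hJ : Disjoint (arithProg a m p) (arithProg b m q)) :
    IsRealizedBy d (arithProg a m p) (arithProg b m q) (jumpTuple m d)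
      (intersectionTuple m d a b p q) := by
  refine ⟨_, fun v v' h => ⟨isPairImage_shiftPolygon hm hd hp hq hpq hJ h, ?_⟩⟩
  intro α α' hα href hop
  exact ⟨hop.pairImage hJ hα href (isPairImage_shiftPolygon hm hd hp hq hpq hJ h),
    fun N w w' hw him => hw.pairImage hJ hα href him⟩

end Realization
end

noncomputable section

/-! ## Velocities of operators -/

/-- A function whose only nonzero derivative at `x` is the `j`-th. -/
lemma exists_jet (x : ℝ) (j : ℕ) : ∃ f : ℝ → ℝ, ContDiff ℝ ∞ f ∧
    ∀ i, iteratedDeriv i f x = if i = j then 1 else 0 := by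
  refine ⟨fun y => (j.factorial : ℝ)⁻¹ * (y - x) ^ j, by fun_prop, fun i => ?_⟩
  have h1 := congrFun (iteratedDeriv_comp_sub_const i (fun y : ℝ => (j.factorial : ℝ)⁻¹ * y ^ j) x) x
  rw [h1, sub_self, iteratedDeriv_const_mul_field, iteratedDeriv_fun_pow_zero]
  split_ifs with h
  · exact inv_mul_cancel₀ (by positivity)
  · simp

section Evolution
variable {d : ℕ} {u c w : ℕ → ℝ → ℝ}

lemma sum_jet {x : ℝ} {f : ℝ → ℝ} {j : ℕ} (hj : j < d)
    (hf : ∀ i, iteratedDeriv i f x = if i = j then 1 else 0) (e : ℕ → ℝ) :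
    ∑ i ∈ Finset.range d, e i * iteratedDeriv i f x = e j := by
  simp only [hf, mul_ite, mul_one, mul_zero, Finset.sum_ite_eq', Finset.mem_range, hj, if_true]

lemma forall_sum_eq_commQL_iff (hc : IsCommCoeff d u c) (r : ℝ) :
    (∀ f : ℝ → ℝ, ContDiff ℝ ∞ f → ∀ x,
      ∑ j ∈ Finset.range d, w j x * iteratedDeriv j f x = r * commQL d u f x) ↔
      ∀ j < d, ∀ x, w j x = r * c j x := by
  constructor
  · intro h j hj x
    obtain ⟨f, hfs, hf⟩ := exists_jet x j
    have := h f hfs x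
    rwa [hc.2 f hfs, sum_jet hj hf fun i => w i x, sum_jet hj hf fun i => c i x] at this
  · intro h f hf x
    rw [hc.2 f hf, Finset.mul_sum]
    refine Finset.sum_congr rfl fun j hj => ?_
    rw [h j (Finset.mem_range.mp hj), mul_assoc]

/-- An operator evolves with a velocity exactly when its coefficients do. -/
lemma hasDerivAt_opL_iff {u : ℝ → ℕ → ℝ → ℝ} {e : ℕ → ℝ} {t x : ℝ} :
    (∀ f : ℝ → ℝ, ContDiff ℝ ∞ f → HasDerivAt (fun s => opL d (u s) f x)
      (∑ j ∈ Finset.range d, e j * iteratedDeriv j f x) t) ↔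
      ∀ j < d, HasDerivAt (fun s => u s j x) (e j) t := by
  constructor
  · intro h j hj
    obtain ⟨f, hfs, hf⟩ := exists_jet x j
    have h1 := (h f hfs).sub_const (iteratedDeriv (d + 1) f x)
    rw [sum_jet hj hf] at h1
    refine h1.congr_of_eventuallyEq (Filter.Eventually.of_forall fun s => ?_)
    simp only [opL, smul_eq_mul]
    rw [sum_jet hj hf fun i => u s i x]
    ring
  · intro h f _
    exact (HasDerivAt.fun_sum fun j hj =>
      (h j (Finset.mem_range.mp hj)).mul_const _).const_add _

lemma HasEnvelopeExpansion.congr {k : Fin d → ℝ} {G B : ℝ → Fin (d + 1) → ℝ} {w' : ℕ → ℝ → ℝ}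
    (h : HasEnvelopeExpansion d k u G B w) (hw : ∀ j < d, ∀ x, w' j x = w j x) :
    HasEnvelopeExpansion d k u G B w' := by
  obtain ⟨ε₀, E, uε, h0, h1, h2, K, hK⟩ := h
  exact ⟨ε₀, E, uε, h0, h1, h2, K, fun ε hε j hj x => by rw [hw j hj]; exact hK ε hε j hj x⟩

end Evolution

/-! ### The limit flow and the change of time -/

section Limit
variable {m d p q : ℕ} {a b : ℤ}

/-- The constant of the continuous limit. -/
def timeConst (m d : ℕ) (a b : ℤ) (p q : ℕ) : ℝ :=
  limitConst (centeredOffset d (intersectionTuple m d a b p q).reverse)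

/-- Uniqueness of the velocity along any curve gives one direction, existence of a curve for `u` the
other. The minus sign is the time reversal. -/
lemma isRefactorizationVelocity_iff (hm : 1 ≤ m) (hd : 2 ≤ d)
    (hS : (dualProg m d a p ∪ dualProg m d b q).card = d) {u c : ℕ → ℝ → ℝ}
    (hu : SmoothPeriodic d u) (hc : IsCommCoeff d u c) (w : ℕ → ℝ → ℝ) :
    IsRefactorizationVelocity m d a b p q u w ↔
      ∀ j < d, ∀ x, w j x = -timeConst m d a b p q * c j x := by
  have hinj : Function.Injective (centeredOffset d (intersectionTuple m d a b p q).reverse) :=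
    centeredOffset_reverse_injective hS
  have hsum := sum_centeredOffset (by omega) (intersectionTuple m d a b p q).reverse (d := d)
  constructor
  · rintro ⟨-, G, B, hG, hGB⟩ j hj x
    have h := hG.velocity_unique hd hinj hsum hc hGB hj x
    rw [timeConst]
    linarith
  · intro h
    obtain ⟨G, hG⟩ := exists_isCurve hu
    refine ⟨⟨m, hm, by rw [jumpTuple, List.reverse_replicate]⟩, G, _, hG,
      (hG.hasEnvelopeExpansion hd hinj hsum hc).congr fun j hj x => ?_⟩
    rw [h j hj, timeConst]
    ring

lemma isRefactorizationLimitSolutionOn_iff (hm : 1 ≤ m) (hd : 2 ≤ d)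
    (hS : (dualProg m d a p ∪ dualProg m d b q).card = d) {C : ℝ} (hC : C ≠ 0)
    (hCt : C = timeConst m d a b p q) (S : Set ℝ) (u : ℝ → ℕ → ℝ → ℝ) :
    IsRefactorizationLimitSolutionOn m d a b p q S u ↔
      IsKdVSolutionOn d {t : ℝ | -t / C ∈ S} (fun t => u (-t / C)) := by
  have hcomm : ∀ {u : ℕ → ℝ → ℝ}, SmoothPeriodic d u → ∃ c, IsCommCoeff d u c :=
    fun hu => isLowerOrder_commQL (by omega) hu
  constructor
  · intro h t ht
    obtain ⟨hu, w, hw, hwd⟩ := h (-t / C) ht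
    refine ⟨hu, fun f hf x => ?_⟩
    obtain ⟨c, hc⟩ := hcomm hu
    rw [isRefactorizationVelocity_iff hm hd hS hu hc, ← hCt] at hw
    have h1 := hasDerivAt_opL_iff.mpr (fun j hj => hwd j hj x) f hf
    have h2 : HasDerivAt (fun s : ℝ => -s / C) (-1 / C) t := (hasDerivAt_id t).neg.div_const C
    refine (h1.comp t h2).congr_deriv ?_
    rw [(forall_sum_eq_commQL_iff hc _).mpr hw f hf]
    field_simp
  · intro h t ht
    -- The substitution `t ↦ -C t` inverts `t ↦ -t / C`.
    have ht' : -(-C * t) / C = t := by field_simp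
    obtain ⟨hu, hud⟩ := h (-C * t) (by change -(-C * t) / C ∈ S; rwa [ht'])
    simp only [ht'] at hu hud
    obtain ⟨c, hc⟩ := hcomm hu
    refine ⟨hu, fun j x => -C * c j x, ?_, fun j hj x => ?_⟩
    · rw [isRefactorizationVelocity_iff hm hd hS hu hc, ← hCt]
      exact fun _ _ _ => rfl
    · refine hasDerivAt_opL_iff (d := d) (e := fun j => -C * c j x).mp (fun f hf => ?_) j hj
      have h2 : HasDerivAt (fun s : ℝ => -C * s) (-C) t := by
        simpa using (hasDerivAt_id t).const_mul (-C)
      have h3 := (hud f hf x).comp t h2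
      refine (h3.congr_deriv ?_).congr_of_eventuallyEq (Filter.Eventually.of_forall fun s => ?_)
      · rw [(forall_sum_eq_commQL_iff (w := fun j x => -C * c j x) hc (-C)).mpr
          (fun _ _ _ => rfl) f hf, mul_comm]
      · simp only [Function.comp_apply]
        rw [show -(-C * s) / C = s by field_simp]

end Limit
end

noncomputable section

/-! ## The Boussinesq equation -/

section MixedPartials
variable {F : ℝ × ℝ → ℝ} {S : Set ℝ}

lemma ContDiffOn.contDiffAt_of_isOpen_prod (hF : ContDiffOn ℝ ∞ F (S ×ˢ Set.univ)) (hS : IsOpen S)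
    {t : ℝ} (ht : t ∈ S) (x : ℝ) : ContDiffAt ℝ ∞ F (t, x) :=
  hF.contDiffAt ((hS.prod isOpen_univ).mem_nhds ⟨ht, trivial⟩)

lemma hasDerivAt_fst_of_contDiffAt {t x : ℝ} (hF : ContDiffAt ℝ ∞ F (t, x)) :
    HasDerivAt (fun s => F (s, x)) (fderiv ℝ F (t, x) (1, 0)) t :=
  (hF.differentiableAt (by simp)).hasFDerivAt.comp_hasDerivAt t
    ((hasDerivAt_id t).prodMk (hasDerivAt_const t x))

lemma hasDerivAt_snd_of_contDiffAt {t x : ℝ} (hF : ContDiffAt ℝ ∞ F (t, x)) :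
    HasDerivAt (fun y => F (t, y)) (fderiv ℝ F (t, x) (0, 1)) x :=
  (hF.differentiableAt (by simp)).hasFDerivAt.comp_hasDerivAt x
    ((hasDerivAt_const x t).prodMk (hasDerivAt_id x))

lemma contDiffAt_fderiv_apply {z : ℝ × ℝ} (hF : ContDiffAt ℝ ∞ F z) (e : ℝ × ℝ) :
    ContDiffAt ℝ ∞ (fun z => fderiv ℝ F z e) z :=
  (hF.fderiv_right (by simp)).clm_apply contDiffAt_const

lemma contDiffOn_deriv_snd (hF : ContDiffOn ℝ ∞ F (S ×ˢ Set.univ)) (hS : IsOpen S) :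
    ContDiffOn ℝ ∞ (fun z : ℝ × ℝ => deriv (fun y => F (z.1, y)) z.2) (S ×ˢ Set.univ) := by
  intro z hz
  have h : ∀ z ∈ S ×ˢ (Set.univ : Set ℝ),
      deriv (fun y => F (z.1, y)) z.2 = fderiv ℝ F z (0, 1) := fun z hz =>
    (hasDerivAt_snd_of_contDiffAt (hF.contDiffAt_of_isOpen_prod hS hz.1 z.2)).deriv
  exact ((contDiffAt_fderiv_apply (hF.contDiffAt_of_isOpen_prod hS hz.1 z.2)
    (0, 1)).contDiffWithinAt).congr h (h z hz)

/-- The partial derivatives of a smooth function commute. -/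
lemma hasDerivAt_deriv_snd (hF : ContDiffOn ℝ ∞ F (S ×ˢ Set.univ)) (hS : IsOpen S) {t : ℝ}
    (ht : t ∈ S) (x : ℝ) :
    HasDerivAt (fun s => deriv (fun y => F (s, y)) x)
      (deriv (fun y => deriv (fun s => F (s, y)) t) x) t := by
  have hFt := fun x => hF.contDiffAt_of_isOpen_prod hS ht x
  have h1 : (fun y => deriv (fun s => F (s, y)) t) = fun y => fderiv ℝ F (t, y) (1, 0) :=
    funext fun y => (hasDerivAt_fst_of_contDiffAt (hFt y)).deriv
  have h2 := hasDerivAt_fst_of_contDiffAt (contDiffAt_fderiv_apply (hFt x) (0, 1))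
  have h3 := hasDerivAt_snd_of_contDiffAt (contDiffAt_fderiv_apply (hFt x) (1, 0))
  have h4 : (fun s => deriv (fun y => F (s, y)) x) =ᶠ[nhds t] fun s => fderiv ℝ F (s, x) (0, 1) := by
    filter_upwards [hS.mem_nhds ht] with s hs
    exact (hasDerivAt_snd_of_contDiffAt (hF.contDiffAt_of_isOpen_prod hS hs x)).deriv
  refine (h2.congr_of_eventuallyEq h4).congr_deriv ?_
  rw [h1, h3.deriv]
  have hd : DifferentiableAt ℝ (fderiv ℝ F) (t, x) :=
    ((hFt x).fderiv_right (m := ∞) (by simp)).differentiableAt (by simp)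
  have h5 : ∀ e, fderiv ℝ (fun z => fderiv ℝ F z e) (t, x) =
      (ContinuousLinearMap.apply ℝ ℝ e).comp (fderiv ℝ (fderiv ℝ F) (t, x)) := fun e =>
    ((ContinuousLinearMap.apply ℝ ℝ e).hasFDerivAt.comp (t, x) hd.hasFDerivAt).fderiv
  rw [h5, h5]
  exact ((hFt x).isSymmSndFDerivAt
    (by rw [minSmoothness_of_isRCLikeNormedField]; exact ENat.LEInfty.out)).eq (1, 0) (0, 1)

end MixedPartials

section Boussinesq
variable {u : ℕ → ℝ → ℝ}

/-- At the point `x` only the Leibniz terms with one derivative on `y - x` survive. Testing an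
operator on `y - x` at `x` thus isolates its coefficient of `∂`, and testing on `1` the coefficient
of order `0`. -/
lemma iteratedDeriv_mul_sub {g : ℝ → ℝ} (hg : ContDiff ℝ ∞ g) (x : ℝ) (n : ℕ) :
    iteratedDeriv (n + 1) (fun y => g y * (y - x)) x = (n + 1) * iteratedDeriv n g x := by
  have h1 : ∀ y, HasDerivAt (fun y : ℝ => y - x) 1 y := fun y => (hasDerivAt_id y).sub_const x
  have hs : ContDiff ℝ ∞ fun y : ℝ => y - x := by fun_prop
  induction n generalizing g with
  | zero =>
    rw [zero_add, iteratedDeriv_one,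
      ((hg.differentiable (by simp) x).hasDerivAt.fun_mul (h1 x)).deriv]
    simp
  | succ n ih =>
    have hg' := contDiff_deriv hg
    have h2 : deriv (fun y => g y * (y - x)) = fun y => deriv g y * (y - x) + g y :=
      funext fun y => by
        rw [((hg.differentiable (by simp) y).hasDerivAt.fun_mul (h1 y)).deriv, mul_one]
    rw [iteratedDeriv_succ', h2, iteratedDeriv_fun_add
      (contDiffAt_of_infty (hg'.mul hs) _ _)
      (contDiffAt_of_infty hg _ _)]
    have h3 := ih hg'
    rw [← iteratedDeriv_succ'] at h3
    change iteratedDeriv (n + 1) (fun y => deriv g y * (y - x)) x + _ = _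
    rw [h3]
    push_cast
    ring

lemma commQL_two_one (x : ℝ) :
    commQL 2 u (fun _ => 1) x = iteratedDeriv 2 (u 0) x -
      2 / 3 * iteratedDeriv 3 (u 1) x - 2 / 3 * (u 1 x * iteratedDeriv 1 (u 1) x) := by
  have h1 : opL 2 u (fun _ => (1 : ℝ)) = u 0 := by
    ext y
    simp [opL, iteratedDeriv_const]
  have h2 : opQ 2 u (fun _ => (1 : ℝ)) = fun y => 2 / 3 * u 1 y := by
    ext y
    simp [opQ, iteratedDeriv_const]
    norm_num
  rw [commQL, h1, h2]
  simp only [opL, opQ, iteratedDeriv_const_mul_field, Finset.sum_range_succ, Finset.sum_range_zero,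
    smul_eq_mul, iteratedDeriv_zero]
  norm_num
  ring

lemma commQL_two_sub (hu : SmoothPeriodic 2 u) (x : ℝ) :
    commQL 2 u (fun y => y - x) x = 2 * iteratedDeriv 1 (u 0) x - iteratedDeriv 2 (u 1) x := by
  have hj : ∀ y, iteratedDeriv 1 (fun y : ℝ => y - x) y = 1 := fun y => by
    rw [iteratedDeriv_one]; simp
  have hj' : ∀ n y, iteratedDeriv (n + 2) (fun y : ℝ => y - x) y = 0 := fun n y => by
    rw [iteratedDeriv_succ', iteratedDeriv_succ',
      show deriv (fun y : ℝ => y - x) = fun _ => 1 by ext; simp]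
    simp
  have h1 : opL 2 u (fun y => y - x) = fun y => u 0 y * (y - x) + u 1 y := by
    ext y
    simp only [opL, hj' 1, Finset.sum_range_succ, Finset.sum_range_zero, iteratedDeriv_zero, hj,
      smul_eq_mul]
    ring
  have h2 : opQ 2 u (fun y => y - x) = fun y => 2 / 3 * u 1 y * (y - x) := by
    ext y
    simp only [opQ, hj' 0, smul_eq_mul]
    norm_num
  have hs : ContDiff ℝ ∞ fun y : ℝ => y - x := by fun_prop
  have hu0 := (hu 0 (by norm_num)).1
  have hu1 := (hu 1 (by norm_num)).1
  have hu1' : ContDiff ℝ ∞ fun y => 2 / 3 * u 1 y := contDiff_const.mul hu1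
  rw [commQL, h1, h2]
  simp only [opL, opQ, Finset.sum_range_succ, Finset.sum_range_zero, smul_eq_mul, iteratedDeriv_zero]
  rw [iteratedDeriv_fun_add (contDiffAt_of_infty (hu0.mul hs) _ _)
    (contDiffAt_of_infty hu1 _ _), iteratedDeriv_mul_sub hu1' x 2]
  have h3 := iteratedDeriv_mul_sub hu1' x 0
  have h4 := iteratedDeriv_mul_sub hu0 x 1
  simp only [zero_add, Nat.reduceAdd] at h3 h4
  change iteratedDeriv 2 (fun y => u 0 y * (y - x)) x + _ + _ - _ = _
  rw [h3, h4]
  simp only [iteratedDeriv_const_mul_field, iteratedDeriv_zero]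
  norm_num
  ring

/-- The `(2, 3)`-KdV equation in coordinates. -/
lemma IsKdVSolutionOn.hasDerivAt_coeff_two {S : Set ℝ} {u : ℝ → ℕ → ℝ → ℝ}
    (h : IsKdVSolutionOn 2 S u) {t : ℝ} (ht : t ∈ S) (x : ℝ) :
    HasDerivAt (fun s => u s 1 x)
        (2 * iteratedDeriv 1 (u t 0) x - iteratedDeriv 2 (u t 1) x) t ∧
      HasDerivAt (fun s => u s 0 x) (iteratedDeriv 2 (u t 0) x -
        2 / 3 * iteratedDeriv 3 (u t 1) x - 2 / 3 * (u t 1 x * iteratedDeriv 1 (u t 1) x)) t := by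
  obtain ⟨hu, hd⟩ := h t ht
  obtain ⟨c, hc⟩ : ∃ c, IsCommCoeff 2 (u t) c := isLowerOrder_commQL (by norm_num) hu
  have h1 := hasDerivAt_opL_iff (e := fun j => c j x).mp fun f hf => by
    rw [← hc.2 f hf]
    exact hd f hf x
  have hc0 := hc.2 (fun _ => 1) contDiff_const x
  have hc1 := hc.2 (fun y => y - x) (by fun_prop) x
  rw [commQL_two_one] at hc0
  rw [commQL_two_sub hu] at hc1
  simp only [Finset.sum_range_succ, Finset.sum_range_zero, iteratedDeriv_zero, iteratedDeriv_one,
    deriv_const, deriv_sub_const_fun, deriv_id''] at hc0 hc1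
  exact ⟨(h1 1 (by norm_num)).congr_deriv (by rw [iteratedDeriv_one]; linear_combination -hc1),
    (h1 0 (by norm_num)).congr_deriv (by rw [iteratedDeriv_one]; linear_combination -hc0)⟩

/-- The `(2, 3)`-KdV equation reduces to the Boussinesq equation. -/
theorem IsKdVSolutionOn.boussinesq {S : Set ℝ} {u : ℝ → ℕ → ℝ → ℝ} (hS : IsOpen S)
    (h : IsKdVSolutionOn 2 S u)
    (hsm : ∀ j < 2, ContDiffOn ℝ ∞ (fun z : ℝ × ℝ => u z.1 j z.2) (S ×ˢ Set.univ))
    {t : ℝ} (x : ℝ) (ht : Real.sqrt 3 * t ∈ S) :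
    iteratedDeriv 2 (fun s => u (Real.sqrt 3 * s) 1 x) t
      + 2 * iteratedDeriv 2 (fun y => u (Real.sqrt 3 * t) 1 y ^ 2) x
      + iteratedDeriv 4 (fun y => u (Real.sqrt 3 * t) 1 y) x = 0 := by
  set r := Real.sqrt 3
  have hr : r * r = 3 := Real.mul_self_sqrt (by norm_num)
  set τ := r * t
  have hu0 := ((h τ ht).1 0 (by norm_num)).1
  have hu1 := ((h τ ht).1 1 (by norm_num)).1
  have D0 := fun j x => hasDerivAt_iteratedDeriv hu0 j x
  have D1 := fun j x => hasDerivAt_iteratedDeriv hu1 j x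
  have hT1 : (fun y => deriv (fun s => u s 1 y) τ) =
      fun y => 2 * iteratedDeriv 1 (u τ 0) y - iteratedDeriv 2 (u τ 1) y :=
    funext fun y => (h.hasDerivAt_coeff_two ht y).1.deriv
  have hT0 : (fun y => deriv (fun s => u s 0 y) τ) = fun y => iteratedDeriv 2 (u τ 0) y -
        2 / 3 * iteratedDeriv 3 (u τ 1) y - 2 / 3 * (u τ 1 y * iteratedDeriv 1 (u τ 1) y) :=
    funext fun y => (h.hasDerivAt_coeff_two ht y).2.deriv
  have hV : ∀ y, HasDerivAt (fun y => deriv (fun s => u s 0 y) τ)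
      (iteratedDeriv 3 (u τ 0) y - 2 / 3 * iteratedDeriv 4 (u τ 1) y -
        2 / 3 * (iteratedDeriv 1 (u τ 1) y * iteratedDeriv 1 (u τ 1) y +
          u τ 1 y * iteratedDeriv 2 (u τ 1) y)) y := fun y => by
    rw [hT0]
    have h1 := D1 0 y
    simp only [iteratedDeriv_zero] at h1
    exact ((D0 2 y).sub ((D1 3 y).const_mul _)).sub ((h1.mul (D1 1 y)).const_mul _)
  have hW : ∀ y, HasDerivAt (fun y => deriv (fun s => u s 1 y) τ)
      (2 * iteratedDeriv 2 (u τ 0) y - iteratedDeriv 3 (u τ 1) y) y := fun y => by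
    rw [hT1]
    exact ((D0 1 y).const_mul _).sub (D1 2 y)
  have hWW : HasDerivAt (fun y => deriv (fun y => deriv (fun s => u s 1 y) τ) y)
      (2 * iteratedDeriv 3 (u τ 0) x - iteratedDeriv 4 (u τ 1) x) x := by
    rw [show (fun y => deriv (fun y => deriv (fun s => u s 1 y) τ) y) = _ from
      funext fun y => (hW y).deriv]
    exact ((D0 2 x).const_mul _).sub (D1 3 x)
  -- Differentiating `u_t = 2v_x - u_xx` in time needs `v_xt` and `u_xxt`; they come from `v_t` and
  -- `u_t` by interchanging derivatives.
  have hx0 := hasDerivAt_deriv_snd (hsm 0 (by norm_num)) hS ht x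
  have hx1 := fun y => hasDerivAt_deriv_snd (hsm 1 (by norm_num)) hS ht y
  have hxx1 := hasDerivAt_deriv_snd (contDiffOn_deriv_snd (hsm 1 (by norm_num)) hS) hS ht x
  dsimp only at hx0 hx1 hxx1
  rw [(hV x).deriv] at hx0
  rw [show (fun y => deriv (fun s => deriv (fun y => u s 1 y) y) τ) = _ from
    funext fun y => (hx1 y).deriv, hWW.deriv] at hxx1
  have hg2 := (hx0.const_mul 2).sub hxx1
  have hrt : ∀ s, HasDerivAt (fun s : ℝ => r * s) r s := fun s => by
    simpa using (hasDerivAt_id s).const_mul r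
  have hd1 : deriv (fun s => u (r * s) 1 x) =ᶠ[nhds t]
      fun s => r * (2 * deriv (fun y => u (r * s) 0 y) x -
        deriv (fun y => deriv (fun y => u (r * s) 1 y) y) x) := by
    filter_upwards [(hS.preimage (continuous_const_mul r)).mem_nhds ht] with s hs
    have h1 := ((h.hasDerivAt_coeff_two hs x).1.comp s (hrt s)).deriv
    rw [iteratedDeriv_one, iteratedDeriv_succ, iteratedDeriv_one, mul_comm] at h1
    exact h1
  have hd2 : iteratedDeriv 2 (fun s => u (r * s) 1 x) t = r * ((2 *
      (iteratedDeriv 3 (u τ 0) x - 2 / 3 * iteratedDeriv 4 (u τ 1) x -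
        2 / 3 * (iteratedDeriv 1 (u τ 1) x * iteratedDeriv 1 (u τ 1) x +
          u τ 1 x * iteratedDeriv 2 (u τ 1) x)) -
      (2 * iteratedDeriv 3 (u τ 0) x - iteratedDeriv 4 (u τ 1) x)) * r) := by
    rw [iteratedDeriv_succ, iteratedDeriv_one, hd1.deriv_eq]
    exact ((hg2.comp t (hrt t)).const_mul r).deriv
  have hsq : iteratedDeriv 2 (fun y => u τ 1 y ^ 2) x =
      2 * (iteratedDeriv 1 (u τ 1) x * iteratedDeriv 1 (u τ 1) x +
          u τ 1 x * iteratedDeriv 2 (u τ 1) x) := by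
    have h0 := fun y => D1 0 y
    simp only [iteratedDeriv_zero, zero_add] at h0
    have h1 : deriv (fun y => u τ 1 y ^ 2) = fun y => 2 * (u τ 1 y * iteratedDeriv 1 (u τ 1) y) :=
      funext fun y => by rw [((h0 y).fun_pow 2).deriv]; ring
    rw [iteratedDeriv_succ, iteratedDeriv_one, h1]
    exact (((h0 x).mul (D1 1 x)).const_mul 2).deriv
  rw [hd2, hsq]
  -- The terms `v_xxx` cancel and `u_tt = -(1/3)u_xxxx - (4/3)(u_x² + u u_xx)`; the rescaling
  -- multiplies it by `r² = 3`.
  linear_combination (-(1 / 3) * iteratedDeriv 4 (u τ 1) x - 4 / 3 * (iteratedDeriv 1 (u τ 1) x *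
    iteratedDeriv 1 (u τ 1) x + u τ 1 x * iteratedDeriv 2 (u τ 1) x)) * hr

end Boussinesq
end

/-! ### The main theorem -/

theorem mainTheorem8 (m d p q : ℕ) (a b : ℤ) (hm : 1 ≤ m) (hd : 2 ≤ d)
    (hp : 1 ≤ p) (hq : 1 ≤ q) (hpq : p + q = d + 2)
    (hJ : Disjoint (arithProg a m p) (arithProg b m q)) :
    -- the long-diagonal realization and its inverse
    IsLongDiagonal m d (jumpTuple m d) (intersectionTuple m d a b p q) ∧
    IsRealizedBy d (arithProg a m p) (arithProg b m q)
      (jumpTuple m d) (intersectionTuple m d a b p q) ∧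
    AreInverseUpToShift d (jumpTuple m d) (intersectionTuple m d a b p q)
      (intersectionTuple m d a b p q).reverse (jumpTuple m d).reverse ∧
    (∃ C : ℝ, 0 < C ∧
      -- evolution of curves under the limit of the inverse map: `dG/dt = C Q₂ G`
      (∀ (u : ℕ → ℝ → ℝ) (G : ℝ → Fin (d + 1) → ℝ), IsCurve d u G →
        ∃ w : ℕ → ℝ → ℝ,
          HasEnvelopeExpansion d (centeredOffset d (intersectionTuple m d a b p q).reverse)
            u G (fun x => C • opQ d u G x) w) ∧
      -- evolution of operators under the limit of the map: `dL/dt = - C [Q₂, L]`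
      (∀ u : ℕ → ℝ → ℝ, SmoothPeriodic d u → ∀ w : ℕ → ℝ → ℝ,
        IsRefactorizationVelocity m d a b p q u w ↔
          ∀ f : ℝ → ℝ, ContDiff ℝ ∞ f → ∀ x : ℝ,
            ∑ j ∈ Finset.range d, w j x * iteratedDeriv j f x = -C * commQL d u f x) ∧
      -- the limit flow is the KdV flow up to a rescaling and a reversal of time
      (∀ (S : Set ℝ) (u : ℝ → ℕ → ℝ → ℝ),
        IsRefactorizationLimitSolutionOn m d a b p q S u ↔
          IsKdVSolutionOn d {t : ℝ | -t / C ∈ S} (fun t => u (-t / C)))) ∧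
    -- for `d = 2` the KdV flow reduces to the Boussinesq equation
    (d = 2 → ∀ (S : Set ℝ) (u : ℝ → ℕ → ℝ → ℝ), IsOpen S → IsKdVSolutionOn d S u →
      (∀ j < d, ContDiffOn ℝ ∞ (fun z : ℝ × ℝ => u z.1 j z.2) (S ×ˢ Set.univ)) →
      ∀ t x : ℝ, Real.sqrt 3 * t ∈ S →
        iteratedDeriv 2 (fun s => u (Real.sqrt 3 * s) 1 x) t
          + 2 * iteratedDeriv 2 (fun y => u (Real.sqrt 3 * t) 1 y ^ 2) x
          + iteratedDeriv 4 (fun y => u (Real.sqrt 3 * t) 1 y) x = 0) := by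
  have hS := card_dualProg_union hm hp hq hpq hJ
  have hinj : Function.Injective (centeredOffset d (intersectionTuple m d a b p q).reverse) :=
    centeredOffset_reverse_injective hS
  have hsum := sum_centeredOffset (by omega) (intersectionTuple m d a b p q).reverse (d := d)
  have hC := limitConst_pos hd hinj
  refine ⟨isLongDiagonal_intersectionTuple hp hq hpq hJ, isRealizedBy_jumpTuple hm hd hp hq hpq hJ,
    areInverseUpToShift_reverse List.length_replicate
      (by rw [intersectionTuple, length_differences, hS]),
    ⟨timeConst m d a b p q, hC, fun u G hG => ?_, fun u hu w => ?_, fun S u =>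
      isRefactorizationLimitSolutionOn_iff hm hd hS hC.ne' rfl S u⟩, ?_⟩
  · obtain ⟨c, hc⟩ : ∃ c, IsCommCoeff d u c := isLowerOrder_commQL (by omega) hG.2.2.2.1
    exact ⟨_, hG.hasEnvelopeExpansion hd hinj hsum hc⟩
  · obtain ⟨c, hc⟩ : ∃ c, IsCommCoeff d u c := isLowerOrder_commQL (by omega) hu
    rw [isRefactorizationVelocity_iff hm hd hS hu hc, forall_sum_eq_commQL_iff hc]
  · rintro rfl S u hS' h hsm t x ht
    exact h.boussinesq hS' hsm x ht
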